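/- Let $D\ge 1$ and let $\sigma$ be an oriented real-analytic $D$-manifold (Hausdorff, without boundary). An edge is an analytic embedding $e:[0,1]\to\sigma$, and a surface is an analytic embedding $S:[0,1]^{D-1}\to\sigma$ (analytic on a neighbourhood of the closed interval, resp. cube). Their distributional form factors are $$F_e^a(x)=\int_0^1 dt\,\dot e^a(t)\,\delta^D(x,e(t)),\qquad F_{S,a}(x)=\int_{[0,1]^{D-1}}d^{D-1}t\;\epsilon_{aa_1\dots a_{D-1}}S^{a_1}_{,t_1}(t)\cdots S^{a_{D-1}}_{,t_{D-1}}(t)\,\delta^D(x,S(t)),$$ that is, the functionals $A\mapsto\int_0^1A_a(e(t))\,\dot e^a(t)\,dt$ on smooth compactly supported one-forms and $E\mapsto\int E^a(S(t))\,\epsilon_{aa_1\dots a_{D-1}}S^{a_1}_{,t_1}\cdots S^{a_{D-1}}_{,t_{D-1}}\,d^{D-1}t$ on smooth compactly supported vector densities of weight one. Let $H_{\rm edge}$ and $H_{\rm surface}$ be the real vector spaces of finite real linear combinations of the $F_e$, resp. of the $F_S$, and let $H=H_{\rm edge}\oplus H_{\rm surface}$. The oriented intersection number of an edge and a surface is $$I(e,S)=\sum_{p=e(t)=S(u)}\tfrac12\bigl(\kappa^+_p-\kappa^-_p\bigr)\,\Theta_S(p).$$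 Here $\kappa^+_p$ is $1$, $-1$ or $0$ according to whether the part of $e$ just after $p$ runs above, below or inside the oriented analytic hypersurface that extends $S$ near $p$, where a vector $v$ points above if $\epsilon_{aa_1\dots a_{D-1}}v^aS^{a_1}_{,t_1}\cdots S^{a_{D-1}}_{,t_{D-1}}>0$; $\kappa^-_p$ is defined likewise by the part of $e$ just before $p$; and $\kappa^-_p=0$ at the initial point of $e$, $\kappa^+_p=0$ at its final point. The weight $\Theta_S(p)$ is the fraction of the unit ball of $T_pS$ taken up by the tangent cone of $S$ at $p$, with respect to an arbitrarily chosen inner product on each $T_p\sigma$; it is $1$ at interior points of $S$. Thus a transversal crossing in the interior of $S$ contributes the sign of $\epsilon_{aa_1\dots a_{D-1}}\dot e^aS^{a_1}_{,t_1}\cdots S^{a_{D-1}}_{,t_{D-1}}$. Then, for every choice of these inner products, $I$ extends uniquely to a well-defined bilinear map $I:H_{\rm edge}\times H_{\rm surface}\to\mathbb R$ with $I(F_e,F_S)=I(e,S)$ for all edges $e$ and surfaces $S$, and the alternating bilinear form $$\sigma\bigl((e,S),(e',S')\bigr)=I(e,S')-I(e',S)$$ on $H$ is nondegenerate: if $\sigma((e,S),(e',S'))=0$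 for all $(e',S')\in H$, then $(e,S)=(0,0)$. -/

import Mathlib

open Set Filter Topology MeasureTheory
open scoped Manifold ContDiff Bundle

namespace FormFactor

/-- The model space of a `D`-dimensional manifold, with `D = d + 1`. -/
abbrev Model (d : ℕ) : Type := EuclideanSpace ℝ (Fin (d + 1))

/-- The atlas is oriented: all transition maps have positive Jacobian determinant. -/
def IsOrientedAtlas (d : ℕ) (M : Type*) [TopologicalSpace M] [ChartedSpace (Model d) M] : Prop :=
  ∀ φ ∈ atlas (Model d) M, ∀ ψ ∈ atlas (Model d) M, ∀ x ∈ φ.source ∩ ψ.source,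
    0 < (fderiv ℝ (ψ ∘ φ.symm) (φ x)).det

/-- `ε_{a a₁ … a_d} v^a w₁^{a₁} ⋯ w_d^{a_d}`, with the Levi-Civita symbol `ε`. It is applied to
tangent vectors at a point `x` of a manifold, whose components are those in the chart at `x`. -/
noncomputable def leviCivita {d : ℕ} (v : Model d) (w : Fin d → Model d) : ℝ :=
  Matrix.det (Matrix.of fun i j => (Fin.cons v w : Fin (d + 1) → Model d) i j)

/-- The closed parameter cube `[0,1]^{D-1}`. -/
def cube (d : ℕ) : Set (Fin d → ℝ) := Icc 0 1

section

variable (d : ℕ) (M : Type*) [TopologicalSpace M] [ChartedSpace (Model d) M]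
  [IsManifold (𝓡 (d + 1)) ω M]

/-- An embedded analytic oriented path `[0,1] → M`. It is given by a map on `ℝ` that is analytic on
a neighbourhood of `[0,1]`; only its values on `[0,1]` matter. An injective immersion of the compact
interval into a Hausdorff manifold is an embedding. -/
structure Edge where
  toFun : ℝ → M
  analytic : ∀ t ∈ Icc (0 : ℝ) 1, ContMDiffAt 𝓘(ℝ, ℝ) (𝓡 (d + 1)) ω toFun t
  injOn : InjOn toFun (Icc 0 1)
  immersion : ∀ t ∈ Icc (0 : ℝ) 1,
    Function.Injective (mfderiv 𝓘(ℝ, ℝ) (𝓡 (d + 1)) toFun t)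

/-- An embedded analytic oriented surface `[0,1]^{D-1} → M`, given by a map that is analytic on a
neighbourhood of the cube; only its values on the cube matter. -/
structure Surface where
  toFun : (Fin d → ℝ) → M
  analytic : ∀ u ∈ cube d, ContMDiffAt 𝓘(ℝ, Fin d → ℝ) (𝓡 (d + 1)) ω toFun u
  injOn : InjOn toFun (cube d)
  immersion : ∀ u ∈ cube d,
    Function.Injective (mfderiv 𝓘(ℝ, Fin d → ℝ) (𝓡 (d + 1)) toFun u)

/-- Test one-forms: smooth, compactly supported sections of the cotangent bundle. -/
structure TestOneForm where
  toFun : ∀ x : M, TangentSpace (𝓡 (d + 1)) x →L[ℝ] ℝ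
  smooth : ContMDiff (𝓡 (d + 1)) ((𝓡 (d + 1)).prod 𝓘(ℝ, Model d →L[ℝ] ℝ)) ∞
    (fun x => Bundle.TotalSpace.mk' (Model d →L[ℝ] ℝ) x (toFun x))
  compactSupport : IsCompact (closure {x | toFun x ≠ 0})

/-- Test vector densities of weight one: `toFun x` consists of the components in the chart at `x`.
In another chart with Jacobian `J` the components are `|det J|⁻¹ J (toFun x)`; these are required
to be smooth functions. -/
structure TestVectorDensity where
  toFun : ∀ x : M, TangentSpace (𝓡 (d + 1)) x
  smooth : ∀ x₀ : M, ContMDiffOn (𝓡 (d + 1)) 𝓘(ℝ, Model d) ∞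
    (fun x => |(tangentCoordChange (𝓡 (d + 1)) x x₀ x).det|⁻¹ •
      tangentCoordChange (𝓡 (d + 1)) x x₀ x (toFun x)) (chartAt (Model d) x₀).source
  compactSupport : IsCompact (closure {x | toFun x ≠ 0})

end

section

variable {d : ℕ} {M : Type*} [TopologicalSpace M] [ChartedSpace (Model d) M]
  [IsManifold (𝓡 (d + 1)) ω M]

/-- The velocity `ė(t)`. -/
noncomputable def Edge.velocity (e : Edge d M) (t : ℝ) : TangentSpace (𝓡 (d + 1)) (e.toFun t) :=
  mfderiv 𝓘(ℝ, ℝ) (𝓡 (d + 1)) e.toFun t (1 : ℝ)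

/-- The coordinate tangent vector `∂S/∂t_i` at the parameter `u`. -/
noncomputable def Surface.partialDeriv (S : Surface d M) (u : Fin d → ℝ) (i : Fin d) :
    TangentSpace (𝓡 (d + 1)) (S.toFun u) :=
  mfderiv 𝓘(ℝ, Fin d → ℝ) (𝓡 (d + 1)) S.toFun u (Pi.single i 1 : Fin d → ℝ)

/-- The form factor `F_e^a(x) = ∫₀¹ dt ė^a(t) δ(x, e(t))`, a distribution acting on one-forms:
`A ↦ ∫₀¹ dt A_a(e(t)) ė^a(t)`. -/
noncomputable def Edge.formFactor (e : Edge d M) : TestOneForm d M → ℝ :=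
  fun A => ∫ t in (0 : ℝ)..1, A.toFun (e.toFun t) (e.velocity t)

/-- The form factor `F_{S,a}(x) = ∫ du ε_{a a₁ … a_d} S^{a₁}_{,1} ⋯ S^{a_d}_{,d} δ(x, S(u))`,
a distribution acting on vector densities. -/
noncomputable def Surface.formFactor (S : Surface d M) : TestVectorDensity d M → ℝ :=
  fun E => ∫ u in cube d, leviCivita (E.toFun (S.toFun u)) (S.partialDeriv u)

variable (d M) in
/-- The space of finite real linear combinations of form factors of edges. -/
noncomputable def HEdge : Submodule ℝ (TestOneForm d M → ℝ) :=
  Submodule.span ℝ (range (Edge.formFactor (d := d) (M := M)))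

variable (d M) in
/-- The space of finite real linear combinations of form factors of surfaces. -/
noncomputable def HSurface : Submodule ℝ (TestVectorDensity d M → ℝ) :=
  Submodule.span ℝ (range (Surface.formFactor (d := d) (M := M)))

/-- The form factor of an edge as an element of `HEdge`. -/
noncomputable def Edge.toH (e : Edge d M) : HEdge d M :=
  ⟨e.formFactor, Submodule.subset_span (mem_range_self e)⟩

/-- The form factor of a surface as an element of `HSurface`. -/
noncomputable def Surface.toH (S : Surface d M) : HSurface d M :=
  ⟨S.formFactor, Submodule.subset_span (mem_range_self S)⟩

/-- `φ` is an analytic defining function, at the parameter `u`, of the hypersurface that extends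
`S` across its boundary: it vanishes on the hypersurface, its differential at `S u` is nonzero, and
it increases towards the positive side of the oriented surface. -/
def Surface.IsDefiningFunction (S : Surface d M) (u : Fin d → ℝ) (φ : M → ℝ) : Prop :=
  ContMDiffAt (𝓡 (d + 1)) 𝓘(ℝ, ℝ) ω φ (S.toFun u) ∧
  (∀ᶠ v in 𝓝 u, φ (S.toFun v) = 0) ∧
  ∃ w : TangentSpace (𝓡 (d + 1)) (S.toFun u),
    0 < leviCivita w (S.partialDeriv u) ∧
    (0 : ℝ) < mfderiv (𝓡 (d + 1)) 𝓘(ℝ, ℝ) φ (S.toFun u) w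

open Classical in
/-- The side of `S` at `S u` on which the curve `s ↦ γ s` runs for small `s > 0`: `1` if it runs
above, `-1` if it runs below, and `0` otherwise (then an analytic `γ` runs inside the surface). -/
noncomputable def Surface.side (S : Surface d M) (u : Fin d → ℝ) (γ : ℝ → M) : ℝ :=
  if ∃ φ, S.IsDefiningFunction u φ ∧ ∀ᶠ s in 𝓝[>] (0 : ℝ), 0 < φ (γ s) then 1
  else if ∃ φ, S.IsDefiningFunction u φ ∧ ∀ᶠ s in 𝓝[>] (0 : ℝ), φ (γ s) < 0 then -1
  else 0

/-- The directions at `u` that point into the parameter cube. -/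
def cubeDirections (u : Fin d → ℝ) : Set (Fin d → ℝ) :=
  {x | ∀ i, (u i = 0 → 0 ≤ x i) ∧ (u i = 1 → x i ≤ 0)}

/-- The parameter vectors that `dS_u` maps into the unit ball of the metric `g`. -/
def Surface.unitBall (S : Surface d M)
    (g : Bundle.RiemannianMetric (fun x : M => TangentSpace (𝓡 (d + 1)) x)) (u : Fin d → ℝ) :
    Set (Fin d → ℝ) :=
  {x | g.inner (S.toFun u) (mfderiv 𝓘(ℝ, Fin d → ℝ) (𝓡 (d + 1)) S.toFun u x)
      (mfderiv 𝓘(ℝ, Fin d → ℝ) (𝓡 (d + 1)) S.toFun u x) ≤ 1}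

/-- The density of `S` at its point `S u` in the hypersurface that extends `S`: the fraction of the
unit ball of the tangent space of `S` that is taken up by the tangent cone of `S`. It is `1` at
interior points, `1/2` on the faces, and the normalized solid angle at the corners. -/
noncomputable def Surface.density (S : Surface d M)
    (g : Bundle.RiemannianMetric (fun x : M => TangentSpace (𝓡 (d + 1)) x)) (u : Fin d → ℝ) : ℝ :=
  volume.real (S.unitBall g u ∩ cubeDirections u) / volume.real (S.unitBall g u)

/-- The contribution of the intersection point `e t = S u`: half the difference of the sides of the
outgoing and of the incoming branch of `e` (an end point of `e` has only one branch), times the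
density of `S`. A crossing in the interior of `S` counts `±1`, a touching `0`, an end point of `e`
off the surface `±1/2`, and a branch of `e` inside `S` counts `0`. -/
noncomputable def localIntersection
    (g : Bundle.RiemannianMetric (fun x : M => TangentSpace (𝓡 (d + 1)) x))
    (e : Edge d M) (S : Surface d M) (t : ℝ) (u : Fin d → ℝ) : ℝ :=
  S.density g u * (1 / 2) *
    ((if t < 1 then S.side u (fun s => e.toFun (t + s)) else 0) -
      (if 0 < t then S.side u (fun s => e.toFun (t - s)) else 0))

/-- The oriented intersection number of an edge and a surface. -/
noncomputable def orientedIntersection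
    (g : Bundle.RiemannianMetric (fun x : M => TangentSpace (𝓡 (d + 1)) x))
    (e : Edge d M) (S : Surface d M) : ℝ :=
  ∑ᶠ p ∈ {p : ℝ × (Fin d → ℝ) | p.1 ∈ Icc (0 : ℝ) 1 ∧ p.2 ∈ cube d ∧ e.toFun p.1 = S.toFun p.2},
    localIntersection g e S p.1 p.2

/-- `I` is the bilinear extension of the oriented intersection number to linear combinations of
form factors. -/
def IsIntersectionPairing
    (g : Bundle.RiemannianMetric (fun x : M => TangentSpace (𝓡 (d + 1)) x))
    (I : HEdge d M →ₗ[ℝ] HSurface d M →ₗ[ℝ] ℝ) : Prop :=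
  ∀ (e : Edge d M) (S : Surface d M), I e.toH S.toH = orientedIntersection g e S

/-- The presymplectic form `σ((e,S),(e',S')) = I(e,S') - I(e',S)` on `HEdge ⊕ HSurface`. -/
noncomputable def symplecticForm (I : HEdge d M →ₗ[ℝ] HSurface d M →ₗ[ℝ] ℝ) :
    LinearMap.BilinForm ℝ (HEdge d M × HSurface d M) :=
  I.compl₁₂ (LinearMap.fst ℝ _ _) (LinearMap.snd ℝ _ _) -
    (I.compl₁₂ (LinearMap.fst ℝ _ _) (LinearMap.snd ℝ _ _)).flip

theorem symplecticForm_apply (I : HEdge d M →ₗ[ℝ] HSurface d M →ₗ[ℝ] ℝ)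
    (x y : HEdge d M × HSurface d M) :
    symplecticForm I x y = I x.1 y.2 - I y.1 x.2 := rfl

end

end FormFactor

set_option linter.unusedSectionVars false

/-! The number `I(e,S)` is a finite sum of contributions of points `p` of the manifold. To extend it
bilinearly to the spans, it must respect linear relations among form factors, in each slot and at
each `p` separately. Analyticity is what makes this work: a curve has a constant side immediately
after and before `p`, and a surface either lies in a given analytic hypersurface near `p` or meets
it in a null set.

Relations between edges. Let `G` be a smooth function that agrees near `p` with a defining function
of the hypersurface extending `S`. Test the relation with `χ d(θ_ε ∘ G)`, where `χ` is a bump at `p`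
and `θ_ε` a smooth step from `-1/2` to `1/2` with `θ_ε 0 = 0`. By the fundamental theorem of
calculus, for small `ε` an edge contributes exactly `(κ⁺ - κ⁻)/2`, and a missing branch at an end
point contributes `0`. The weight of `S` at `p` is a common factor
(`Edge.eventually_formFactor_stepForm`, `sum_intersectionAt_edge_eq_zero`).

Relations between surfaces. Powers of a cutoff function localize a relation to any compact subset of
a chart domain (`sum_setIntegral_surface_eq_zero`). Take for this subset the part of a hypersurface
`φ = 0` within `g_p`-distance `r` of `p`, divide by `r^d` and let `r → 0`. Surfaces not contained in
`φ = 0` near `p` drop out. Each of the others leaves its signed surface element times the volume of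
its tangent cone in the unit ball (`Surface.tendsto_integral_zone`). Up to a factor common to the
whole group, this is the density times the orientation relative to `φ`, so the weighted sides of any
branch cancel within each group (`sum_density_mul_side_eq_zero_of_group`). The inner product only
fixes the shape of the shrinking sets, so any choice is admissible.

Nondegeneracy. Pairing with `(0,S)` and `(e,0)` reduces the claim to this: a combination whose
intersection numbers all vanish is zero. Two analytic patches of equal dimension coincide locally,
up to reparametrization, at almost all of their common points (`ae_overlap`). At such a generic
point a small transversal affine patch of complementary dimension meets each patch of the
combination that passes through the point exactly once, with sign `±1`, and meets no other. Hence
the signed coefficients of the overlapping patches cancel almost everywhere, and a change of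
variables turns this cancellation into the vanishing of the sum of integrals
(`sum_integral_eq_zero_of_overlap`). -/

namespace FormFactor

/-! ### Zero sets of analytic functions and retractions onto immersions -/

section VectorSpace

variable {E : Type*} [NormedAddCommGroup E] [NormedSpace ℝ E]

/-- The zero set of an analytic function of one variable on an open interval, if it is not the whole
interval, is a null set. -/
theorem volume_zeros_inter_eq_zero {f : ℝ → ℝ} {U : Set ℝ} (hU : IsOpen U) (hc : IsPreconnected U)
    (hf : AnalyticOnNhd ℝ f U) {t₀ : ℝ} (h₀ : t₀ ∈ U) (hne : f t₀ ≠ 0) :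
    volume (U ∩ {t | f t = 0}) = 0 := by
  rcases hf.eqOn_zero_or_eventually_ne_zero_of_preconnected hc with h | h
  · exact absurd (h h₀) hne
  · have h1 : ∀ᵐ t ∂(volume.restrict U), f t ≠ 0 :=
      (ae_restrict_le_codiscreteWithin hU.measurableSet) h
    rw [ae_restrict_iff' hU.measurableSet] at h1
    refine measure_mono_null (fun t ht => ?_) h1
    simp only [mem_compl_iff, mem_ofPred_eq]
    intro hh
    exact hh ht.1 ht.2

/-- Near a point around which it does not vanish identically, an analytic function has a null
zero set. -/
theorem exists_nhds_measure_zeros_eq_zero [FiniteDimensional ℝ E] [MeasurableSpace E] [BorelSpace E]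
    (μ : Measure E) [μ.IsAddHaarMeasure] {f : E → ℝ} {x₀ : E} (hf : AnalyticAt ℝ f x₀)
    (hne : ¬ ∀ᶠ x in 𝓝 x₀, f x = 0) : ∃ N ∈ 𝓝 x₀, μ (N ∩ {x | f x = 0}) = 0 := by
  obtain ⟨r, hr, hball⟩ := Metric.eventually_nhds_iff_ball.1 hf.eventually_analyticAt
  obtain ⟨y, hy, hfy⟩ : ∃ y ∈ Metric.ball x₀ r, f y ≠ 0 := by
    by_contra! hcon
    exact hne (Metric.eventually_nhds_iff_ball.2 ⟨r, hr, hcon⟩)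
  set B := Metric.ball x₀ r with hB
  have hfB : ContinuousOn f B := fun x hx => (hball x hx).continuousAt.continuousWithinAt
  refine ⟨B, Metric.ball_mem_nhds _ hr, ?_⟩
  set Z : Set E := B ∩ {x | f x = 0} with hZ
  have hZm : MeasurableSet Z := by
    have : Z = B \ (B ∩ f ⁻¹' {0}ᶜ) := by
      ext x; simp [hZ]
    rw [this]
    exact Metric.isOpen_ball.measurableSet.diff
      (hfB.isOpen_inter_preimage Metric.isOpen_ball isOpen_compl_singleton).measurableSet
  -- Dilation about `y` with ratio `t`. For fixed `x` the path in `t` extends affinely to `y` at `t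
  -- = 0`, where `f ≠ 0`, so it meets `Z` in a null set. Fubini then gives a ratio in `[1,2]` for
  -- which the preimage of `Z` is null, and this preimage is a homothetic copy of `Z`.
  let h : E × ℝ → E := fun p => y + p.2 • (p.1 - y)
  have hh : Continuous h := by fun_prop
  let ν : Measure ℝ := volume.restrict (Icc 1 2)
  have hW : MeasurableSet (h ⁻¹' Z) := hh.measurable hZm
  have hline : ∀ x : E, ν (Prod.mk x ⁻¹' (h ⁻¹' Z)) = 0 := by
    intro x
    let l : ℝ → E := fun t => y + t • (x - y)
    have hl : Continuous l := by fun_prop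
    have hla : ∀ t, AnalyticAt ℝ l t := fun t =>
      analyticAt_const.add (analyticAt_id.smul analyticAt_const)
    have hUo : IsOpen (l ⁻¹' B) := Metric.isOpen_ball.preimage hl
    have hUc : Convex ℝ (l ⁻¹' B) := by
      have : l ⁻¹' B = (AffineMap.lineMap y x : ℝ →ᵃ[ℝ] E) ⁻¹' B := by
        ext t; simp [l, AffineMap.lineMap_apply, add_comm]
      rw [this]
      exact (convex_ball _ _).affine_preimage _
    have := volume_zeros_inter_eq_zero (f := f ∘ l) hUo hUc.isPreconnected
      (fun t ht => (hball _ ht).comp (hla t)) (t₀ := 0) (by simpa [l] using hy) (by simpa [l] using hfy)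
    refine measure_mono_null ?_ ((Measure.restrict_le_self _).trans this.le |>.antisymm bot_le)
    intro t ht
    exact ⟨ht.1, ht.2⟩
  have h0 : (μ.prod ν) (h ⁻¹' Z) = 0 := by
    rw [Measure.measure_prod_null hW]
    exact Eventually.of_forall hline
  have h1 : ∀ᵐ t ∂ν, μ ((fun x => (x, t)) ⁻¹' (h ⁻¹' Z)) = 0 := by
    have : (ν.prod μ) (Prod.swap ⁻¹' (h ⁻¹' Z)) = 0 := by
      rw [← Measure.map_apply measurable_swap hW, Measure.prod_swap, h0]
    exact Measure.measure_ae_null_of_prod_null this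
  have hν : ν ≠ 0 := by
    simp [ν, Measure.restrict_eq_zero]
  have : (ae ν).NeBot := ae_neBot.2 hν
  obtain ⟨t, ht, htI⟩ := (h1.and (ae_restrict_mem measurableSet_Icc)).exists
  have ht0 : t ≠ 0 := by have := htI.1; linarith
  have h2 : (fun x => (x, t)) ⁻¹' (h ⁻¹' Z) = AffineMap.homothety y t⁻¹ '' Z := by
    ext x
    simp only [mem_preimage, mem_image, AffineMap.homothety_apply, vsub_eq_sub, vadd_eq_add]
    constructor
    · intro hx
      refine ⟨_, hx, ?_⟩
      simp [h, smul_smul, ht0]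
    · rintro ⟨z, hz, rfl⟩
      have : h (t⁻¹ • (z - y) + y, t) = z := by simp [h, smul_smul, ht0]
      rwa [this]
  rw [h2, Measure.addHaar_image_homothety] at ht
  refine (mul_eq_zero.1 ht).resolve_left ?_
  rw [ENNReal.ofReal_eq_zero, not_le]
  positivity

variable {V : Type*} [NormedAddCommGroup V] [NormedSpace ℝ V]

theorem exists_continuousLinearMap_leftInverse [FiniteDimensional ℝ E] [FiniteDimensional ℝ V]
    {A : E →L[ℝ] V} (hA : Function.Injective A) :
    ∃ P : V →L[ℝ] E, P.comp A = ContinuousLinearMap.id ℝ E := by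
  obtain ⟨g, hg⟩ := (A : E →ₗ[ℝ] V).exists_leftInverse_of_injective
    (LinearMap.ker_eq_bot.2 hA)
  refine ⟨LinearMap.toContinuousLinearMap g, ?_⟩
  ext x
  exact LinearMap.congr_fun hg x

/-- A function with injective strict derivative is locally injective. -/
theorem exists_nhds_injOn_of_hasStrictFDerivAt [FiniteDimensional ℝ E] [FiniteDimensional ℝ V]
    {F : E → V} {A : E →L[ℝ] V} {u₀ : E} (hF : HasStrictFDerivAt F A u₀)
    (hA : Function.Injective A) : ∃ N ∈ 𝓝 u₀, InjOn F N := by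
  obtain ⟨P, hP⟩ := exists_continuousLinearMap_leftInverse hA
  -- Composing with a left inverse of `A` makes the derivative the identity, so the inverse function
  -- theorem applies.
  have h1 : HasStrictFDerivAt (fun u => P (F u))
      ((ContinuousLinearEquiv.refl ℝ E : E ≃L[ℝ] E) : E →L[ℝ] E) u₀ := by
    have := P.hasStrictFDerivAt.comp u₀ hF
    rw [hP] at this
    exact this
  have : CompleteSpace E := FiniteDimensional.complete ℝ E
  refine ⟨(h1.toOpenPartialHomeomorph _).source,
    (h1.toOpenPartialHomeomorph _).open_source.mem_nhds h1.mem_toOpenPartialHomeomorph_source, ?_⟩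
  intro a ha b hb hab
  refine (h1.toOpenPartialHomeomorph _).injOn ha hb ?_
  simp [hab]

/-- Local retraction onto the image of an analytic immersion `F`: an analytic map `r` with
`r (F v) = v`, such that `z - F (r z)` lies in a fixed complement of the tangent space. -/
theorem exists_analytic_retraction [FiniteDimensional ℝ E] [FiniteDimensional ℝ V]
    {F : E → V} {u₀ : E} (hF : ContDiffAt ℝ ω F u₀)
    (hA : Function.Injective (fderiv ℝ F u₀)) :
    ∃ (r : V → E) (P : V →L[ℝ] E), ContDiffAt ℝ ω r (F u₀) ∧
      (∀ᶠ v in 𝓝 u₀, r (F v) = v) ∧ (∀ᶠ z in 𝓝 (F u₀), P (z - F (r z)) = 0) ∧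
      P.comp (fderiv ℝ F u₀) = ContinuousLinearMap.id ℝ E := by
  obtain ⟨P, hP⟩ := exists_continuousLinearMap_leftInverse hA
  have : CompleteSpace E := FiniteDimensional.complete ℝ E
  -- `ρ` has the identity as derivative at `u₀`, hence an analytic local inverse `τ`. The retraction
  -- is `τ ∘ P`, and its defect lies in the kernel of `P`, which is a complement of the tangent
  -- space.
  set ρ : E → E := fun u => P (F u)
  have hρ : ContDiffAt ℝ ω ρ u₀ := P.contDiff.contDiffAt.comp u₀ hF
  have hω : (ω : WithTop ℕ∞) ≠ 0 := by simp
  have hd : HasFDerivAt ρ ((ContinuousLinearEquiv.refl ℝ E : E ≃L[ℝ] E) : E →L[ℝ] E) u₀ := by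
    have := P.hasFDerivAt.comp u₀ (hF.differentiableAt hω).hasFDerivAt
    rw [hP] at this
    exact this
  have hs := hρ.hasStrictFDerivAt' hd hω
  set τ := hρ.localInverse hd hω
  have hτ : ContDiffAt ℝ ω τ (ρ u₀) := hρ.to_localInverse hd hω
  refine ⟨fun z => τ (P z), P, ?_, ?_, ?_, hP⟩
  · exact ContDiffAt.comp (F u₀) hτ P.contDiff.contDiffAt
  · exact hs.eventually_left_inverse
  · have h2 : ∀ᶠ y in 𝓝 (ρ u₀), ρ (τ y) = y := hs.eventually_right_inverse
    have h3 : Tendsto (fun z => P z) (𝓝 (F u₀)) (𝓝 (ρ u₀)) := P.continuous.continuousAt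
    filter_upwards [h3.eventually h2] with z hz
    rw [map_sub, sub_eq_zero]
    exact hz.symm

end VectorSpace

/-! ### Compactness lemmas -/

section Topology

/-- If every point of the compact set `K` that `f` sends to `p` has `N` as a neighbourhood, then the
points of `K` that are sent close to `p` lie in `N`. -/
theorem eventually_forall_mem_of_isCompact {X Y : Type*} [TopologicalSpace X] [TopologicalSpace Y]
    [T2Space Y] {K N : Set X} (hK : IsCompact K) {f : X → Y} (hf : ContinuousOn f K) {p : Y}
    (hN : ∀ u ∈ K, f u = p → N ∈ 𝓝 u) : ∀ᶠ x in 𝓝 p, ∀ u ∈ K, f u = x → u ∈ N := by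
  have hc : IsCompact (K \ interior N) := hK.diff isOpen_interior
  have hi : IsClosed (f '' (K \ interior N)) :=
    (hc.image_of_continuousOn (hf.mono sdiff_subset)).isClosed
  have hp : p ∉ f '' (K \ interior N) := by
    rintro ⟨u, hu, hup⟩
    exact hu.2 (mem_interior_iff_mem_nhds.2 (hN u hu.1 hup))
  filter_upwards [hi.isOpen_compl.mem_nhds hp] with x hx u hu hux
  by_contra hcon
  exact hx ⟨u, ⟨hu, fun h => hcon (interior_subset h)⟩, hux⟩

/-- A subset of a compact set without accumulation points is finite. -/
theorem finite_of_forall_eventually_notMem {X : Type*} [TopologicalSpace X] {K A : Set X}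
    (hK : IsCompact K) (hA : A ⊆ K) (h : ∀ x ∈ K, ∀ᶠ y in 𝓝[≠] x, y ∉ A) : A.Finite := by
  by_contra hinf
  obtain ⟨x, hx, hacc⟩ := Set.Infinite.exists_accPt_of_subset_isCompact hinf hK hA
  rw [accPt_iff_frequently_nhdsNE] at hacc
  exact hacc (h x hx)

end Topology

/-! ### The Levi-Civita symbol and transversality -/

section LeviCivita

variable {d : ℕ}

theorem leviCivita_eq_basis_det (v : Model d) (w : Fin d → Model d) :
    leviCivita v w = (EuclideanSpace.basisFun (Fin (d + 1)) ℝ).toBasis.det (Fin.cons v w) := by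
  rw [leviCivita, Module.Basis.det_apply, ← Matrix.det_transpose]
  congr 1

theorem leviCivita_map (T : Model d →L[ℝ] Model d) (v : Model d) (w : Fin d → Model d) :
    leviCivita (T v) (fun i => T (w i)) = T.det * leviCivita v w := by
  rw [leviCivita_eq_basis_det, leviCivita_eq_basis_det]
  have : (Fin.cons (T v) (fun i => T (w i)) : Fin (d + 1) → Model d) =
      (T : Model d →ₗ[ℝ] Model d) ∘ (Fin.cons v w) := by
    ext i : 1
    refine Fin.cases ?_ (fun j => ?_) i <;> simp
  rw [this, Module.Basis.det_comp]

/-- The linear functional `v ↦ ε(v, w₁, …, w_d)`. -/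
noncomputable def leviCivitaLeft (w : Fin d → Model d) : Model d →L[ℝ] ℝ :=
  LinearMap.toContinuousLinearMap
    { toFun := fun v => leviCivita v w
      map_add' := fun a b => by
        simp only [leviCivita_eq_basis_det]
        exact (EuclideanSpace.basisFun (Fin (d + 1)) ℝ).toBasis.det.toMultilinearMap.cons_add w a b
      map_smul' := fun c a => by
        simp only [leviCivita_eq_basis_det]
        exact (EuclideanSpace.basisFun (Fin (d + 1)) ℝ).toBasis.det.toMultilinearMap.cons_smul w c a }

@[simp] theorem leviCivitaLeft_apply (w : Fin d → Model d) (v : Model d) :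
    leviCivitaLeft w v = leviCivita v w := rfl

theorem leviCivita_right_eq_zero (w : Fin d → Model d) (i : Fin d) : leviCivita (w i) w = 0 := by
  rw [leviCivita_eq_basis_det]
  exact AlternatingMap.map_eq_zero_of_eq _ _ (i := 0) (j := i.succ) (by simp)
    (Fin.succ_ne_zero i).symm

theorem leviCivita_image_eq_zero (A : (Fin d → ℝ) →L[ℝ] Model d) (x : Fin d → ℝ) :
    leviCivita (A x) (fun i => A (Pi.single i 1)) = 0 := by
  have : A x = ∑ i, x i • A (Pi.single i 1) := by
    conv_lhs => rw [pi_eq_sum_univ' x]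
    simp only [map_sum, map_smul]
  rw [this, ← leviCivitaLeft_apply, map_sum]
  refine Finset.sum_eq_zero fun i _ => ?_
  rw [map_smul, leviCivitaLeft_apply, leviCivita_right_eq_zero (fun i => A (Pi.single i 1)) i,
    smul_zero]

theorem leviCivita_ne_zero_iff {v : Model d} {w : Fin d → Model d} :
    leviCivita v w ≠ 0 ↔ LinearIndependent ℝ (Fin.cons v w : Fin (d + 1) → Model d) := by
  rw [leviCivita_eq_basis_det, ← isUnit_iff_ne_zero, ← Module.Basis.is_basis_iff_det]
  refine ⟨fun h => h.1, fun h => ⟨h, ?_⟩⟩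
  exact h.span_eq_top_of_card_eq_finrank (by simp)

/-- Reparametrization by a linear map multiplies the surface element by its determinant. -/
theorem leviCivita_comp_right (v : Model d) (A : (Fin d → ℝ) →L[ℝ] Model d)
    (G : (Fin d → ℝ) →L[ℝ] (Fin d → ℝ)) :
    leviCivita v (fun i => A (G (Pi.single i 1))) =
      G.det * leviCivita v (fun i => A (Pi.single i 1)) := by
  let D := (EuclideanSpace.basisFun (Fin (d + 1)) ℝ).toBasis.det
  let f : (Fin d → ℝ) [⋀^Fin d]→ₗ[ℝ] ℝ :=
    (D.curryLeft v).compLinearMap (A : (Fin d → ℝ) →ₗ[ℝ] Model d)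
  have hf : ∀ x : Fin d → (Fin d → ℝ), f x = leviCivita v (fun i => A (x i)) := by
    intro x
    rw [leviCivita_eq_basis_det]
    rfl
  have h2 := f.eq_smul_basis_det (Pi.basisFun ℝ (Fin d))
  rw [← hf, ← hf, h2]
  simp only [AlternatingMap.smul_apply, smul_eq_mul]
  have h3 : (fun i => G (Pi.single i 1)) =
      (G : (Fin d → ℝ) →ₗ[ℝ] (Fin d → ℝ)) ∘ (Pi.basisFun ℝ (Fin d)) := by
    ext i : 1; simp
  have h4 : (fun i => (Pi.single i 1 : Fin d → ℝ)) = (Pi.basisFun ℝ (Fin d)) := by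
    ext i : 1; simp
  rw [h3, h4, Module.Basis.det_comp, Module.Basis.det_self]
  simp only [mul_one]
  rw [mul_comm]

/-- The `d` independent image vectors cannot span a space of dimension `d + 1`. Any vector outside
their span works up to sign. -/
theorem exists_leviCivita_pos_of_injective {A : (Fin d → ℝ) →L[ℝ] Model d}
    (hA : Function.Injective A) : ∃ v, 0 < leviCivita v (fun i => A (Pi.single i 1)) := by
  have hli : LinearIndependent ℝ (fun i => A (Pi.single i 1)) := by
    have := (Pi.basisFun ℝ (Fin d)).linearIndependent.map' (A : (Fin d → ℝ) →ₗ[ℝ] Model d)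
      (LinearMap.ker_eq_bot.2 hA)
    have h : (fun i => A (Pi.single i 1)) =
        (A : (Fin d → ℝ) →ₗ[ℝ] Model d) ∘ (Pi.basisFun ℝ (Fin d)) := by
      ext i : 1; simp
    rw [h]
    exact this
  obtain ⟨v, hv⟩ : ∃ v : Model d, v ∉ Submodule.span ℝ (range fun i => A (Pi.single i 1)) := by
    by_contra! hcon
    have h1 := (Submodule.eq_top_iff'.2 hcon)
    have h2 := finrank_span_eq_card hli
    rw [h1, finrank_top] at h2
    simp at h2
  have h3 : leviCivita v (fun i => A (Pi.single i 1)) ≠ 0 :=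
    leviCivita_ne_zero_iff.2 (hli.finCons hv)
  rcases lt_or_gt_of_ne h3 with h | h
  · refine ⟨-v, ?_⟩
    rw [← leviCivitaLeft_apply, map_neg, leviCivitaLeft_apply]
    linarith
  · exact ⟨v, h⟩

/-- Replacing the `i`-th basis vector by `v` gives determinant equal to the `i`-th coordinate of
`v`. A transposition moves `v` to the first slot at the cost of a sign, so if all values vanished,
then so would every coordinate. -/
theorem exists_leviCivita_ne_zero_of_ne_zero {v : Model d} (hv : v ≠ 0) :
    ∃ w : Fin d → Model d, leviCivita v w ≠ 0 := by
  by_contra! hcon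
  let D := (EuclideanSpace.basisFun (Fin (d + 1)) ℝ).toBasis.det
  have h0 : ∀ f : Fin (d + 1) → Model d, f 0 = v → D f = 0 := by
    intro f hf
    have := hcon (Fin.tail f)
    rw [leviCivita_eq_basis_det] at this
    rwa [← hf, Fin.cons_self_tail] at this
  let b := (EuclideanSpace.basisFun (Fin (d + 1)) ℝ).toBasis
  obtain ⟨i, hi⟩ : ∃ i, b.repr v i ≠ 0 := by
    by_contra! h
    exact hv (b.repr.map_eq_zero_iff.1 (Finsupp.ext h))
  have hcr : D (Function.update b i v) = b.repr v i := by
    have hsum : v = ∑ j, b.repr v j • b j := (b.sum_repr v).symm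
    conv_lhs => rw [hsum]
    rw [D.map_update_sum]
    rw [Finset.sum_eq_single i]
    · rw [D.map_update_smul, Function.update_eq_self]
      rw [Module.Basis.det_self, smul_eq_mul, mul_one]
    · intro j _ hji
      rw [D.map_update_smul, D.map_eq_zero_of_eq _ (i := i) (j := j) _ hji.symm, smul_zero]
      simp [hji]
    · simp
  have hsw : D (Function.update b i v ∘ Equiv.swap 0 i) = 0 := by
    apply h0
    simp
  have := D.map_perm (Function.update b i v) (Equiv.swap 0 i)
  rw [hsw, hcr] at this
  rcases Int.units_eq_one_or (Equiv.Perm.sign (Equiv.swap 0 i)) with h | h <;> rw [h] at this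
  · simp at this; exact hi this.symm
  · simp at this; exact hi this

/-- A vector outside a hyperplane is transversal to it. -/
theorem injective_of_leviCivita_ne_zero {v : Model d} {A : (Fin d → ℝ) →L[ℝ] Model d}
    (h : leviCivita v (fun i => A (Pi.single i 1)) ≠ 0) {a : ℝ} {x : Fin d → ℝ}
    (hax : a • v = A x) : a = 0 ∧ x = 0 := by
  have h1 : a = 0 := by
    have := leviCivita_image_eq_zero A x
    rw [← hax, ← leviCivitaLeft_apply, map_smul, leviCivitaLeft_apply, smul_eq_mul] at this
    exact (mul_eq_zero.1 this).resolve_right h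
  refine ⟨h1, ?_⟩
  have hli := (linearIndependent_finCons.1 (leviCivita_ne_zero_iff.1 h)).1
  rw [h1, zero_smul] at hax
  have h2 : ∑ i, x i • A (Pi.single i 1) = 0 := by
    rw [hax]
    conv_rhs => rw [pi_eq_sum_univ' x]
    simp only [map_sum, map_smul]
  ext i
  exact Fintype.linearIndependent_iff.1 hli x h2 i

/-- Every vector is the sum of a multiple of a transversal vector and a tangent vector. -/
theorem exists_eq_smul_add_of_leviCivita_ne_zero {v : Model d} {A : (Fin d → ℝ) →L[ℝ] Model d}
    (h : leviCivita v (fun i => A (Pi.single i 1)) ≠ 0) (z : Model d) :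
    ∃ (a : ℝ) (x : Fin d → ℝ), z = a • v + A x := by
  have hsp := (leviCivita_ne_zero_iff.1 h).span_eq_top_of_card_eq_finrank (by simp)
  have hz : z ∈ Submodule.span ℝ (range (Fin.cons v fun i => A (Pi.single i 1) :
    Fin (d + 1) → Model d)) := by rw [hsp]; trivial
  rw [Submodule.mem_span_range_iff_exists_fun] at hz
  obtain ⟨c, hc⟩ := hz
  refine ⟨c 0, fun i => c i.succ, ?_⟩
  rw [← hc, Fin.sum_univ_succ]
  simp only [Fin.cons_zero, Fin.cons_succ]
  congr 1
  conv_rhs => rw [pi_eq_sum_univ' (fun i : Fin d => c i.succ)]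
  simp only [map_sum, map_smul]

/-- A functional that vanishes on a hyperplane is a multiple of `ε(·, w₁, …, w_d)`. -/
theorem functional_eq_mul_leviCivita {v : Model d} {A : (Fin d → ℝ) →L[ℝ] Model d}
    (h : leviCivita v (fun i => A (Pi.single i 1)) ≠ 0) {f : Model d →L[ℝ] ℝ}
    (hf : ∀ x, f (A x) = 0) (z : Model d) :
    f z = f v / leviCivita v (fun i => A (Pi.single i 1)) *
      leviCivita z (fun i => A (Pi.single i 1)) := by
  obtain ⟨a, x, rfl⟩ := exists_eq_smul_add_of_leviCivita_ne_zero h z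
  rw [← leviCivitaLeft_apply _ (a • v + A x)]
  simp only [map_add, map_smul, hf, leviCivitaLeft_apply, leviCivita_image_eq_zero, smul_eq_mul,
    add_zero]
  field_simp

end LeviCivita

/-! ### Derivatives in charts and local retractions on the manifold -/

section Manifold

variable {d : ℕ} {M : Type*} [TopologicalSpace M] [ChartedSpace (Model d) M]
  [IsManifold (𝓡 (d + 1)) ω M]
  {E : Type*} [NormedAddCommGroup E] [NormedSpace ℝ E]

/-- The derivative of a map into `M`, in the chart at the image point. -/
noncomputable def chartDeriv (f : E → M) (u : E) : E →L[ℝ] Model d :=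
  mfderiv 𝓘(ℝ, E) (𝓡 (d + 1)) f u

theorem chartDeriv_injective {f : E → M} {u : E}
    (hi : Function.Injective (mfderiv 𝓘(ℝ, E) (𝓡 (d + 1)) f u)) :
    Function.Injective (chartDeriv (d := d) f u) := hi

variable (M) in
theorem isManifold_of_le_omega (n : WithTop ℕ∞) : IsManifold (𝓡 (d + 1)) n M :=
  IsManifold.of_le (n := ω) le_top

/-- The coordinates of the derivative of a map in the chart at `x₀`. -/
theorem hasFDerivAt_extChartAt_comp {f : E → M} {u : E}
    (hf : MDifferentiableAt 𝓘(ℝ, E) (𝓡 (d + 1)) f u) {x₀ : M}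
    (hx : f u ∈ (chartAt (Model d) x₀).source) :
    HasFDerivAt (fun v => extChartAt (𝓡 (d + 1)) x₀ (f v))
      ((tangentCoordChange (𝓡 (d + 1)) (f u) x₀ (f u)).comp
        (chartDeriv f u)) u := by
  have : IsManifold (𝓡 (d + 1)) 1 M := isManifold_of_le_omega M 1
  have h1 : HasMFDerivAt (𝓡 (d + 1)) 𝓘(ℝ, Model d) (chartAt (Model d) x₀) (f u)
      (tangentCoordChange (𝓡 (d + 1)) (f u) x₀ (f u)) := by
    rw [← mfderiv_chartAt_eq_tangentCoordChange hx]
    exact (mdifferentiableAt_atlas (ChartedSpace.chart_mem_atlas _) hx).hasMFDerivAt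
  have h2 := h1.comp u hf.hasMFDerivAt
  exact h2.hasFDerivAt

theorem contDiffAt_extChartAt_comp {n : WithTop ℕ∞} {f : E → M} {u : E}
    (hf : ContMDiffAt 𝓘(ℝ, E) (𝓡 (d + 1)) n f u) {x₀ : M}
    (hx : f u ∈ (chartAt (Model d) x₀).source) :
    ContDiffAt ℝ n (fun v => extChartAt (𝓡 (d + 1)) x₀ (f v)) u := by
  have : IsManifold (𝓡 (d + 1)) n M := isManifold_of_le_omega M n
  rw [← contMDiffAt_iff_contDiffAt]
  exact (contMDiffAt_extChartAt' (n := n) hx).comp u hf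

theorem tangentCoordChange_self_eq_id (x : M) :
    tangentCoordChange (𝓡 (d + 1)) x x x = ContinuousLinearMap.id ℝ (Model d) := by
  have : IsManifold (𝓡 (d + 1)) 1 M := isManifold_of_le_omega M 1
  ext1 v
  exact tangentCoordChange_self (mem_extChartAt_source x)

/-- In an oriented atlas all tangent coordinate changes have positive determinant. -/
theorem IsOrientedAtlas.det_tangentCoordChange_pos (hM : IsOrientedAtlas d M) {x y z : M}
    (hx : z ∈ (chartAt (Model d) x).source) (hy : z ∈ (chartAt (Model d) y).source) :
    0 < (tangentCoordChange (𝓡 (d + 1)) x y z).det := by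
  have := hM _ (chart_mem_atlas (Model d) x) _ (chart_mem_atlas (Model d) y) z ⟨hx, hy⟩
  rw [tangentCoordChange_def]
  simpa [fderivWithin_univ] using this

/-- The derivative of `f` is given by that of its representation in the chart at `f u`. -/
theorem fderiv_extChartAt_comp_self {f : E → M} {u : E}
    (hf : MDifferentiableAt 𝓘(ℝ, E) (𝓡 (d + 1)) f u) :
    fderiv ℝ (fun v => extChartAt (𝓡 (d + 1)) (f u) (f v)) u =
      chartDeriv f u := by
  have h := (hasFDerivAt_extChartAt_comp hf (mem_chart_source (Model d) (f u))).fderiv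
  rw [h, tangentCoordChange_self_eq_id, ContinuousLinearMap.id_comp]

/-- Local retraction `r` onto the image of an analytic immersion `f`, with defect `q`. -/
theorem exists_analytic_retraction_manifold [FiniteDimensional ℝ E] {f : E → M} {u₀ : E}
    (hf : ContMDiffAt 𝓘(ℝ, E) (𝓡 (d + 1)) ω f u₀)
    (hi : Function.Injective (chartDeriv (d := d) f u₀)) :
    ∃ (r : M → E) (q : M → Model d) (P : Model d →L[ℝ] E),
      ContMDiffAt (𝓡 (d + 1)) 𝓘(ℝ, E) ω r (f u₀) ∧
      ContMDiffAt (𝓡 (d + 1)) 𝓘(ℝ, Model d) ω q (f u₀) ∧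
      (∀ᶠ v in 𝓝 u₀, r (f v) = v) ∧ (∀ᶠ v in 𝓝 u₀, q (f v) = 0) ∧
      (∀ᶠ x in 𝓝 (f u₀), q x = 0 → f (r x) = x) ∧
      (∀ᶠ x in 𝓝 (f u₀), P (q x) = 0) ∧
      (∀ x, q x = extChartAt (𝓡 (d + 1)) (f u₀) x -
        extChartAt (𝓡 (d + 1)) (f u₀) (f (r x))) ∧
      P.comp (chartDeriv f u₀) =
        ContinuousLinearMap.id ℝ E := by
  set p := f u₀ with hp
  have hω : (ω : WithTop ℕ∞) ≠ 0 := by simp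
  have hmd : MDifferentiableAt 𝓘(ℝ, E) (𝓡 (d + 1)) f u₀ := hf.mdifferentiableAt hω
  set F : E → Model d := fun v => extChartAt (𝓡 (d + 1)) p (f v) with hFdef
  have hF : ContDiffAt ℝ ω F u₀ := contDiffAt_extChartAt_comp hf (mem_chart_source _ _)
  have hFd : fderiv ℝ F u₀ = (chartDeriv f u₀) :=
    fderiv_extChartAt_comp_self hmd
  obtain ⟨r, P, hr, hrF, hP, hPd⟩ := exists_analytic_retraction hF (by rw [hFd]; exact hi)
  have hφ : ContMDiffAt (𝓡 (d + 1)) 𝓘(ℝ, Model d) ω (extChartAt (𝓡 (d + 1)) p) p :=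
    contMDiffAt_extChartAt
  have hr' : ContMDiffAt (𝓡 (d + 1)) 𝓘(ℝ, E) ω (fun x => r (extChartAt (𝓡 (d + 1)) p x)) p :=
    ContMDiffAt.comp p (hr.contMDiffAt) hφ
  have hru : r (extChartAt (𝓡 (d + 1)) p p) = u₀ := hrF.self_of_nhds
  have hfr : Tendsto (fun x => f (r (extChartAt (𝓡 (d + 1)) p x))) (𝓝 p) (𝓝 p) := by
    have h1 : Tendsto (fun x => r (extChartAt (𝓡 (d + 1)) p x)) (𝓝 p) (𝓝 u₀) := by
      have := hr'.continuousAt.tendsto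
      rwa [hru] at this
    exact hf.continuousAt.tendsto.comp h1
  have hφt : Tendsto (extChartAt (𝓡 (d + 1)) p) (𝓝 p) (𝓝 (F u₀)) :=
    (continuousAt_extChartAt p)
  refine ⟨fun x => r (extChartAt (𝓡 (d + 1)) p x),
    fun x => extChartAt (𝓡 (d + 1)) p x - F (r (extChartAt (𝓡 (d + 1)) p x)), P, hr', ?_, hrF,
    ?_, ?_, ?_, fun x => rfl, by rw [← hFd, hPd]⟩
  · have hF' : ContMDiffAt 𝓘(ℝ, E) 𝓘(ℝ, Model d) ω F (r (extChartAt (𝓡 (d + 1)) p p)) := by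
      rw [hru]; exact hF.contMDiffAt
    have h2 : ContMDiffAt (𝓡 (d + 1)) 𝓘(ℝ, Model d) ω
        (fun x => F (r (extChartAt (𝓡 (d + 1)) p x))) p :=
      ContMDiffAt.comp (g := F) (f := fun x => r (extChartAt (𝓡 (d + 1)) p x)) p hF' hr'
    exact hφ.sub h2
  · filter_upwards [hrF] with v hv
    change F v - F (r (F v)) = 0
    rw [hv, sub_self]
  · have hs : (chartAt (Model d) p).source ∈ 𝓝 p := chart_source_mem_nhds _ _
    filter_upwards [hs, hfr hs] with x hx hx' hq
    have hx2 : x ∈ (extChartAt (𝓡 (d + 1)) p).source := by rwa [extChartAt_source]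
    have hx3 : f (r (extChartAt (𝓡 (d + 1)) p x)) ∈ (extChartAt (𝓡 (d + 1)) p).source := by
      rwa [extChartAt_source]
    exact (extChartAt (𝓡 (d + 1)) p).injOn hx3 hx2 (sub_eq_zero.1 hq).symm
  · exact hφt.eventually hP

end Manifold

/-! ### Defining functions of a surface and the side of a curve -/

section DefiningFunction

variable {d : ℕ} {M : Type*} [TopologicalSpace M] [ChartedSpace (Model d) M]
  [IsManifold (𝓡 (d + 1)) ω M]
  {E : Type*} [NormedAddCommGroup E] [NormedSpace ℝ E]

/-- The differential of a function, in the chart at the base point. -/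
noncomputable def chartCodiff (φ : M → ℝ) (x : M) : Model d →L[ℝ] ℝ :=
  mfderiv (𝓡 (d + 1)) 𝓘(ℝ, ℝ) φ x

theorem hasFDerivAt_comp_of_mdifferentiableAt {φ : M → ℝ} {f : E → M} {u : E}
    (hφ : MDifferentiableAt (𝓡 (d + 1)) 𝓘(ℝ, ℝ) φ (f u))
    (hf : MDifferentiableAt 𝓘(ℝ, E) (𝓡 (d + 1)) f u) :
    HasFDerivAt (fun v => φ (f v)) ((chartCodiff φ (f u)).comp (chartDeriv (d := d) f u)) u :=
  (hφ.hasMFDerivAt.comp u hf.hasMFDerivAt).hasFDerivAt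

theorem hasFDerivAt_comp_extChartAt_symm {φ : M → ℝ} {p : M}
    (hφ : MDifferentiableAt (𝓡 (d + 1)) 𝓘(ℝ, ℝ) φ p) :
    HasFDerivAt (fun z => φ ((extChartAt (𝓡 (d + 1)) p).symm z)) (chartCodiff φ p)
      (extChartAt (𝓡 (d + 1)) p p) := by
  have := hφ.hasMFDerivAt.2
  simp only [ModelWithCorners.range_eq_univ] at this
  exact this.hasFDerivAt univ_mem

theorem contDiffAt_comp_extChartAt_symm {F : Type*} [NormedAddCommGroup F] [NormedSpace ℝ F]
    {n : WithTop ℕ∞} {φ : M → F} {p : M}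
    (hφ : ContMDiffAt (𝓡 (d + 1)) 𝓘(ℝ, F) n φ p) :
    ContDiffAt ℝ n (fun z => φ ((extChartAt (𝓡 (d + 1)) p).symm z))
      (extChartAt (𝓡 (d + 1)) p p) := by
  have := (contMDiffAt_iff.1 hφ).2
  simp only [ModelWithCorners.range_eq_univ] at this
  exact this.contDiffAt univ_mem

variable {S : Surface d M} {u : Fin d → ℝ}

theorem Surface.mdifferentiableAt (S : Surface d M) (hu : u ∈ cube d) :
    MDifferentiableAt 𝓘(ℝ, Fin d → ℝ) (𝓡 (d + 1)) S.toFun u :=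
  (S.analytic u hu).mdifferentiableAt (by simp)

theorem Surface.partialDeriv_eq (S : Surface d M) (u : Fin d → ℝ) :
    S.partialDeriv u = fun i => chartDeriv S.toFun u (Pi.single i 1) := rfl

theorem Surface.exists_leviCivita_pos (S : Surface d M) (hu : u ∈ cube d) :
    ∃ w : Model d, 0 < leviCivita w (S.partialDeriv u) :=
  exists_leviCivita_pos_of_injective (chartDeriv_injective (S.immersion u hu))

theorem Surface.codiff_chartDeriv_eq_zero (hu : u ∈ cube d) {φ : M → ℝ}
    (hφ : ContMDiffAt (𝓡 (d + 1)) 𝓘(ℝ, ℝ) ω φ (S.toFun u))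
    (h0 : ∀ᶠ v in 𝓝 u, φ (S.toFun v) = 0) (x : Fin d → ℝ) :
    chartCodiff φ (S.toFun u) (chartDeriv (d := d) S.toFun u x) = 0 := by
  have h1 := hasFDerivAt_comp_of_mdifferentiableAt (hφ.mdifferentiableAt (by simp))
    (S.mdifferentiableAt hu)
  have h2 : HasFDerivAt (fun v => φ (S.toFun v)) (0 : (Fin d → ℝ) →L[ℝ] ℝ) u :=
    (hasFDerivAt_const (0 : ℝ) u).congr_of_eventuallyEq h0
  exact DFunLike.congr_fun (h1.unique h2) x

/-- A function that vanishes on `S` near `S u` has differential proportional to the normal. -/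
theorem Surface.codiff_eq_mul_leviCivita (hu : u ∈ cube d) {φ : M → ℝ}
    (hφ : ContMDiffAt (𝓡 (d + 1)) 𝓘(ℝ, ℝ) ω φ (S.toFun u))
    (h0 : ∀ᶠ v in 𝓝 u, φ (S.toFun v) = 0) {w : Model d}
    (hw : leviCivita w (S.partialDeriv u) ≠ 0) (z : Model d) :
    chartCodiff φ (S.toFun u) z = chartCodiff φ (S.toFun u) w /
      leviCivita w (S.partialDeriv u) * leviCivita z (S.partialDeriv u) :=
  functional_eq_mul_leviCivita hw (Surface.codiff_chartDeriv_eq_zero hu hφ h0) z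

theorem Surface.IsDefiningFunction.exists_codiff_eq (hu : u ∈ cube d) {φ : M → ℝ}
    (h : S.IsDefiningFunction u φ) : ∃ c : ℝ, 0 < c ∧ ∀ z : Model d,
      chartCodiff φ (S.toFun u) z = c * leviCivita z (S.partialDeriv u) := by
  obtain ⟨hφ, h0, w, hw, hdw⟩ := h
  exact ⟨_, div_pos hdw hw, Surface.codiff_eq_mul_leviCivita hu hφ h0 hw.ne'⟩

theorem Surface.leviCivita_ne_zero_of_codiff_ne_zero (hu : u ∈ cube d) {φ : M → ℝ}
    (hφ : ContMDiffAt (𝓡 (d + 1)) 𝓘(ℝ, ℝ) ω φ (S.toFun u))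
    (h0 : ∀ᶠ v in 𝓝 u, φ (S.toFun v) = 0) {w : Model d}
    (hw : chartCodiff φ (S.toFun u) w ≠ 0) : leviCivita w (S.partialDeriv u) ≠ 0 := by
  obtain ⟨v, hv⟩ := S.exists_leviCivita_pos hu
  have := Surface.codiff_eq_mul_leviCivita hu hφ h0 hv.ne' w
  intro h
  rw [h, mul_zero] at this
  exact hw this

theorem Surface.isDefiningFunction_neg {φ : M → ℝ}
    (hφ : ContMDiffAt (𝓡 (d + 1)) 𝓘(ℝ, ℝ) ω φ (S.toFun u))
    (h0 : ∀ᶠ v in 𝓝 u, φ (S.toFun v) = 0) {w : Model d}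
    (hw : 0 < chartCodiff φ (S.toFun u) w) (hl : leviCivita w (S.partialDeriv u) < 0) :
    S.IsDefiningFunction u (-φ) := by
  refine ⟨hφ.neg, ?_, -w, ?_, ?_⟩
  · filter_upwards [h0] with v hv
    simp [hv]
  · have h2 : leviCivita (-w) (S.partialDeriv u) = - leviCivita w (S.partialDeriv u) :=
      map_neg (leviCivitaLeft (S.partialDeriv u)) w
    change 0 < leviCivita (-w) (S.partialDeriv u)
    linarith
  · have h1 : mfderiv (𝓡 (d + 1)) 𝓘(ℝ, ℝ) (-φ) (S.toFun u) =
        - mfderiv (𝓡 (d + 1)) 𝓘(ℝ, ℝ) φ (S.toFun u) := mfderiv_neg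
    rw [h1]
    have h2 : (-mfderiv (𝓡 (d + 1)) 𝓘(ℝ, ℝ) φ (S.toFun u) : Model d →L[ℝ] ℝ) (-w) =
      chartCodiff φ (S.toFun u) w := by
      change (-chartCodiff φ (S.toFun u)) (-w) = _
      simp
    exact h2 ▸ hw

/-- The local retraction onto a surface: `r` is a left inverse of `S`, the defect `q x` is a
multiple of a transversal vector, and the sign of every defining function at `x` is that of the
normal component of `q x`. -/
theorem Surface.exists_retraction (S : Surface d M) (hu : u ∈ cube d) :
    ∃ (r : M → Fin d → ℝ) (q : M → Model d),
      ContMDiffAt (𝓡 (d + 1)) 𝓘(ℝ, Fin d → ℝ) ω r (S.toFun u) ∧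
      (∀ᶠ v in 𝓝 u, r (S.toFun v) = v) ∧
      (∀ᶠ x in 𝓝 (S.toFun u), leviCivita (q x) (S.partialDeriv u) = 0 → S.toFun (r x) = x) ∧
      S.IsDefiningFunction u (fun x => leviCivita (q x) (S.partialDeriv u)) ∧
      ∀ φ, S.IsDefiningFunction u φ → ∀ᶠ x in 𝓝 (S.toFun u),
        SignType.sign (φ x) = SignType.sign (leviCivita (q x) (S.partialDeriv u)) := by
  obtain ⟨r, q, P, hr, hq, hrS, hqS, hq0, hPq, hqe, hPA⟩ :=
    exists_analytic_retraction_manifold (S.analytic u hu) (chartDeriv_injective (S.immersion u hu))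
  set p := S.toFun u with hp
  set A := chartDeriv (d := d) S.toFun u with hA
  set ℓ := leviCivitaLeft (S.partialDeriv u) with hℓ
  have hℓA : ∀ x, ℓ (A x) = 0 := fun x => leviCivita_image_eq_zero A x
  have hPA' : ∀ x, P (A x) = x := fun x => DFunLike.congr_fun hPA x
  obtain ⟨w, hw⟩ := S.exists_leviCivita_pos hu
  -- `P` detects the tangential part and `ℓ` the normal part. On the kernel of `P`, where the defect
  -- `q x` lies, the norm is therefore bounded by a multiple of `|ℓ|`.
  have hinj : Function.Injective (P.prod ℓ) := by
    rw [← ContinuousLinearMap.coe_coe, ← LinearMap.ker_eq_bot, LinearMap.ker_eq_bot']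
    intro k hk
    obtain ⟨hk1, hk2⟩ := Prod.ext_iff.1 hk
    obtain ⟨a, x, rfl⟩ := exists_eq_smul_add_of_leviCivita_ne_zero (A := A) hw.ne' k
    have ha : a = 0 := by
      have : ℓ (a • w + A x) = 0 := hk2
      rw [map_add, map_smul, hℓA, add_zero, smul_eq_mul] at this
      exact (mul_eq_zero.1 this).resolve_right hw.ne'
    subst ha
    have : P (0 • w + A x) = 0 := by simpa using hk1
    rw [zero_smul, zero_add, hPA'] at this
    simp [this]
  obtain ⟨K, hK, hanti⟩ := (P.prod ℓ : Model d →ₗ[ℝ] (Fin d → ℝ) × ℝ).exists_antilipschitzWith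
    (LinearMap.ker_eq_bot.2 hinj)
  have hbound : ∀ k, P k = 0 → ‖k‖ ≤ K * |ℓ k| := by
    intro k hk
    have := hanti.le_mul_dist k 0
    simp only [dist_zero_right, map_zero] at this
    refine this.trans (le_of_eq ?_)
    simp [Prod.norm_def, hk]
  have hru : r p = u := hrS.self_of_nhds
  have hrt : Tendsto r (𝓝 p) (𝓝 u) := by
    have := hr.continuousAt.tendsto
    rwa [hru] at this
  have hSr : Tendsto (fun x => S.toFun (r x)) (𝓝 p) (𝓝 p) :=
    (S.analytic u hu).continuousAt.tendsto.comp hrt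
  have hext : Tendsto (extChartAt (𝓡 (d + 1)) p) (𝓝 p) (𝓝 (extChartAt (𝓡 (d + 1)) p p)) :=
    continuousAt_extChartAt p
  have hsrc : (extChartAt (𝓡 (d + 1)) p).source ∈ 𝓝 p := extChartAt_source_mem_nhds p
  have hqzero : ∀ᶠ x in 𝓝 p, leviCivita (q x) (S.partialDeriv u) = 0 → q x = 0 := by
    filter_upwards [hPq] with x hx h0
    have := hbound (q x) hx
    rw [show ℓ (q x) = 0 from h0] at this
    simpa using this
  refine ⟨r, q, hr, hrS, ?_, ?_, ?_⟩
  · filter_upwards [hqzero, hq0] with x h1 h2 h3 using h2 (h1 h3)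
  · have hφ : ContMDiffAt (𝓡 (d + 1)) 𝓘(ℝ, ℝ) ω
        (fun x => leviCivita (q x) (S.partialDeriv u)) p :=
      ContMDiffAt.comp (g := ℓ) (f := q) p ℓ.contDiff.contDiffAt.contMDiffAt hq
    refine ⟨hφ, ?_, w, hw, ?_⟩
    · filter_upwards [hqS] with v hv
      rw [hv]
      exact map_zero ℓ
    · have h1 := hasFDerivAt_comp_extChartAt_symm (hφ.mdifferentiableAt (by simp))
      have hr1 : DifferentiableAt ℝ (fun z => r ((extChartAt (𝓡 (d + 1)) p).symm z))
          (extChartAt (𝓡 (d + 1)) p p) :=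
        (contDiffAt_comp_extChartAt_symm hr).differentiableAt (by simp)
      have hF : HasFDerivAt (fun v => extChartAt (𝓡 (d + 1)) p (S.toFun v)) A
          (r ((extChartAt (𝓡 (d + 1)) p).symm (extChartAt (𝓡 (d + 1)) p p))) := by
        rw [extChartAt_to_inv, hru]
        have := hasFDerivAt_extChartAt_comp (S.mdifferentiableAt hu)
          (mem_chart_source (Model d) (S.toFun u))
        rwa [tangentCoordChange_self_eq_id, ContinuousLinearMap.id_comp] at this
      -- The derivative of `ℓ ∘ q` at `p` is `ℓ` itself: the term coming from the retraction is
      -- tangential and is killed by `ℓ`.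
      have h2 := ℓ.hasFDerivAt.comp (extChartAt (𝓡 (d + 1)) p p)
        ((hasFDerivAt_id (extChartAt (𝓡 (d + 1)) p p)).sub
          (hF.comp (extChartAt (𝓡 (d + 1)) p p) hr1.hasFDerivAt))
      have h3 : (fun z => leviCivita (q ((extChartAt (𝓡 (d + 1)) p).symm z)) (S.partialDeriv u))
          =ᶠ[𝓝 (extChartAt (𝓡 (d + 1)) p p)] (ℓ ∘ (id -
            (fun v => extChartAt (𝓡 (d + 1)) p (S.toFun v)) ∘
              fun z => r ((extChartAt (𝓡 (d + 1)) p).symm z))) := by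
        filter_upwards [extChartAt_target_mem_nhds (I := 𝓡 (d + 1)) p] with z hz
        simp only [Function.comp_apply, Pi.sub_apply, id]
        rw [hqe, (extChartAt (𝓡 (d + 1)) p).right_inv hz]
        rfl
      have h4 := (h2.congr_of_eventuallyEq h3).unique h1
      have h5 := DFunLike.congr_fun h4 w
      simp only [ContinuousLinearMap.comp_apply, sub_apply,
        ContinuousLinearMap.id_apply, map_sub, hℓA, sub_zero] at h5
      change 0 < chartCodiff (fun x => leviCivita (q x) (S.partialDeriv u)) p w
      rw [← h5]
      exact hw
  · intro φ hφ
    obtain ⟨c, hc, hcℓ⟩ := hφ.exists_codiff_eq hu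
    -- Strict differentiability compares `φ` at `x` and at `S (r x)`, where `φ` vanishes. So `φ x`
    -- equals `c * ℓ (q x)` up to `o(‖q x‖)`.
    have hst : HasStrictFDerivAt (fun z => φ ((extChartAt (𝓡 (d + 1)) p).symm z))
        (chartCodiff φ p) (extChartAt (𝓡 (d + 1)) p p) :=
      (contDiffAt_comp_extChartAt_symm hφ.1).hasStrictFDerivAt'
        (hasFDerivAt_comp_extChartAt_symm (hφ.1.mdifferentiableAt (by simp))) (by simp)
    -- With `‖q x‖ ≤ K * |ℓ (q x)|` this constant keeps the error below half of the main term, which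
    -- fixes the sign.
    have hε : 0 < c / (2 * (K + 1)) := by positivity
    have hlim : Tendsto (fun x => (extChartAt (𝓡 (d + 1)) p x,
        extChartAt (𝓡 (d + 1)) p (S.toFun (r x)))) (𝓝 p)
        (𝓝 (extChartAt (𝓡 (d + 1)) p p, extChartAt (𝓡 (d + 1)) p p)) :=
      hext.prodMk_nhds (hext.comp hSr)
    have hb := hlim.eventually (hst.isLittleO.bound hε)
    filter_upwards [hb, hPq, hsrc, hSr hsrc, hrt.eventually hφ.2.1] with x hx hPx hxs hxs' hx0
    simp only [(extChartAt (𝓡 (d + 1)) p).left_inv hxs,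
      (extChartAt (𝓡 (d + 1)) p).left_inv hxs', hx0, sub_zero, ← hqe x] at hx
    rw [hcℓ] at hx
    set a := leviCivita (q x) (S.partialDeriv u) with ha
    have h1 : ‖q x‖ ≤ K * |a| := hbound _ hPx
    have h2 : |φ x - c * a| ≤ c / 2 * |a| := by
      refine hx.trans ?_
      calc c / (2 * (K + 1)) * ‖q x‖ ≤ c / (2 * (K + 1)) * (K * |a|) := by gcongr
        _ = c / 2 * |a| * (K / (K + 1)) := by field_simp
        _ ≤ c / 2 * |a| * 1 := by
          gcongr
          rw [div_le_one (by positivity)]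
          simp
        _ = c / 2 * |a| := mul_one _
    rw [abs_le] at h2
    rcases lt_trichotomy a 0 with h | h | h
    · rw [abs_of_neg h] at h2
      rw [sign_neg h, sign_neg]
      nlinarith
    · rw [h, abs_zero] at h2
      have : φ x = 0 := by linarith [h2.1, h2.2]
      rw [this, h]
    · rw [abs_of_pos h] at h2
      rw [sign_pos h, sign_pos]
      nlinarith

theorem Surface.exists_isDefiningFunction (S : Surface d M) (hu : u ∈ cube d) :
    ∃ φ, S.IsDefiningFunction u φ := by
  obtain ⟨r, q, -, -, -, h, -⟩ := S.exists_retraction hu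
  exact ⟨_, h⟩

/-- Both signs are that of the normal component of the defect of one retraction. This makes the side
independent of the defining function. -/
theorem Surface.IsDefiningFunction.eventually_sign_eq (hu : u ∈ cube d) {φ ψ : M → ℝ}
    (hφ : S.IsDefiningFunction u φ) (hψ : S.IsDefiningFunction u ψ) :
    ∀ᶠ x in 𝓝 (S.toFun u), SignType.sign (φ x) = SignType.sign (ψ x) := by
  obtain ⟨r, q, -, -, -, -, h⟩ := S.exists_retraction hu
  filter_upwards [h φ hφ, h ψ hψ] with x h1 h2
  rw [h1, h2]

open Classical in
/-- The side of the hypersurface `φ = 0` on which the curve `γ` starts. -/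
noncomputable def sideOf (φ : M → ℝ) (γ : ℝ → M) : ℝ :=
  if ∀ᶠ s in 𝓝[>] (0 : ℝ), 0 < φ (γ s) then 1
  else if ∀ᶠ s in 𝓝[>] (0 : ℝ), φ (γ s) < 0 then -1
  else 0

theorem sideOf_neg (φ : M → ℝ) (γ : ℝ → M) : sideOf (-φ) γ = - sideOf φ γ := by
  have hex : (∀ᶠ s in 𝓝[>] (0 : ℝ), 0 < φ (γ s)) → ¬ ∀ᶠ s in 𝓝[>] (0 : ℝ), φ (γ s) < 0 := by
    intro h1 h2
    obtain ⟨s, hs1, hs2⟩ := (h1.and h2).exists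
    exact lt_asymm hs1 hs2
  by_cases h1 : ∀ᶠ s in 𝓝[>] (0 : ℝ), 0 < φ (γ s)
  · simp [sideOf, h1, hex h1]
  · by_cases h2 : ∀ᶠ s in 𝓝[>] (0 : ℝ), φ (γ s) < 0
    · simp [sideOf, h1, h2]
    · simp [sideOf, h1, h2]

theorem sideOf_eq_of_eventually_sign {φ : M → ℝ} {γ : ℝ → M} {σ : SignType}
    (h : ∀ᶠ s in 𝓝[>] (0 : ℝ), SignType.sign (φ (γ s)) = σ) : sideOf φ γ = σ := by
  have h1 : (∀ᶠ s in 𝓝[>] (0 : ℝ), 0 < φ (γ s)) ↔ σ = 1 := by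
    constructor
    · intro h2
      obtain ⟨s, hs1, hs2⟩ := (h.and h2).exists
      rw [← hs1, sign_pos hs2]
    · rintro rfl
      filter_upwards [h] with s hs using sign_eq_one_iff.1 hs
  have h2 : (∀ᶠ s in 𝓝[>] (0 : ℝ), φ (γ s) < 0) ↔ σ = -1 := by
    constructor
    · intro h2
      obtain ⟨s, hs1, hs2⟩ := (h.and h2).exists
      rw [← hs1, sign_neg hs2]
    · rintro rfl
      filter_upwards [h] with s hs using sign_eq_neg_one_iff.1 hs
  rw [sideOf, h1, h2]
  cases σ <;> simp

/-- The side of a surface can be computed with any defining function. -/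
theorem Surface.side_eq_sideOf (hu : u ∈ cube d) {φ : M → ℝ} (hφ : S.IsDefiningFunction u φ)
    {γ : ℝ → M} (hγ : Tendsto γ (𝓝[>] 0) (𝓝 (S.toFun u))) : S.side u γ = sideOf φ γ := by
  have h1 : (∃ ψ, S.IsDefiningFunction u ψ ∧ ∀ᶠ s in 𝓝[>] (0 : ℝ), 0 < ψ (γ s)) ↔
      ∀ᶠ s in 𝓝[>] (0 : ℝ), 0 < φ (γ s) := by
    refine ⟨?_, fun h => ⟨φ, hφ, h⟩⟩
    rintro ⟨ψ, hψ, h⟩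
    filter_upwards [h, hγ.eventually (hφ.eventually_sign_eq hu hψ)] with s hs hsg
    rwa [← sign_eq_one_iff, hsg, sign_eq_one_iff]
  have h2 : (∃ ψ, S.IsDefiningFunction u ψ ∧ ∀ᶠ s in 𝓝[>] (0 : ℝ), ψ (γ s) < 0) ↔
      ∀ᶠ s in 𝓝[>] (0 : ℝ), φ (γ s) < 0 := by
    refine ⟨?_, fun h => ⟨φ, hφ, h⟩⟩
    rintro ⟨ψ, hψ, h⟩
    filter_upwards [h, hγ.eventually (hφ.eventually_sign_eq hu hψ)] with s hs hsg
    rwa [← sign_eq_neg_one_iff, hsg, sign_eq_neg_one_iff]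
  rw [Surface.side, sideOf, h1, h2]

end DefiningFunction

/-! ### Test one-forms and continuity of their pairing with edges -/

section TestForms

variable {d : ℕ} {M : Type*} [TopologicalSpace M] [ChartedSpace (Model d) M]
  [IsManifold (𝓡 (d + 1)) ω M]

theorem contMDiff_smul_mfderiv {k G : M → ℝ} (hk : ContMDiff (𝓡 (d + 1)) 𝓘(ℝ, ℝ) ∞ k)
    (hG : ContMDiff (𝓡 (d + 1)) 𝓘(ℝ, ℝ) ∞ G) :
    ContMDiff (𝓡 (d + 1)) ((𝓡 (d + 1)).prod 𝓘(ℝ, Model d →L[ℝ] ℝ)) ∞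
      (fun x => Bundle.TotalSpace.mk' (Model d →L[ℝ] ℝ)
        (E := fun x : M => TangentSpace (𝓡 (d + 1)) x →L[ℝ] ℝ) x
        (k x • (chartCodiff G x : TangentSpace (𝓡 (d + 1)) x →L[ℝ] ℝ))) := by
  have : IsManifold (𝓡 (d + 1)) ∞ M := isManifold_of_le_omega M ∞
  intro x₀
  rw [contMDiffAt_hom_bundle]
  refine ⟨contMDiffAt_id, ?_⟩
  have h1 : ContMDiffAt (𝓡 (d + 1)) 𝓘(ℝ, Model d →L[ℝ] ℝ) ∞
    (inTangentCoordinates (𝓡 (d + 1)) 𝓘(ℝ, ℝ) id G (mfderiv (𝓡 (d + 1)) 𝓘(ℝ, ℝ) G) x₀) x₀ :=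
    (hG x₀).mfderiv_const (by simp)
  have h2 := (hk x₀).smul h1
  refine h2.congr_of_eventuallyEq (Eventually.of_forall fun x => ?_)
  have h3 : inTangentCoordinates (𝓡 (d + 1)) 𝓘(ℝ, ℝ) id G (mfderiv (𝓡 (d + 1)) 𝓘(ℝ, ℝ) G) x₀ x =
      (chartCodiff G x : TangentSpace (𝓡 (d + 1)) x →L[ℝ] ℝ).comp
        ((trivializationAt (Model d) (TangentSpace (𝓡 (d + 1))) x₀).symmL ℝ x) := by
    ext v
    change (trivializationAt ℝ (TangentSpace 𝓘(ℝ, ℝ)) (G x₀)).continuousLinearMapAt ℝ (G x)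
      (chartCodiff G x ((trivializationAt (Model d) (TangentSpace (𝓡 (d + 1))) x₀).symmL ℝ x v)) = _
    rw [TangentBundle.continuousLinearMapAt_model_space]
    rfl
  simp only [ContinuousLinearMap.inCoordinates]
  ext v
  simp
  exact congrArg (fun L : Model d →L[ℝ] ℝ => k x • L v) h3.symm

/-- The test one-form `k dG`. -/
noncomputable def TestOneForm.smulDifferential {k G : M → ℝ}
    (hk : ContMDiff (𝓡 (d + 1)) 𝓘(ℝ, ℝ) ∞ k) (hG : ContMDiff (𝓡 (d + 1)) 𝓘(ℝ, ℝ) ∞ G)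
    (hc : HasCompactSupport k) : TestOneForm d M where
  toFun x := k x • (chartCodiff G x : TangentSpace (𝓡 (d + 1)) x →L[ℝ] ℝ)
  smooth := contMDiff_smul_mfderiv hk hG
  compactSupport := by
    refine hc.of_isClosed_subset isClosed_closure (closure_mono fun x hx hk0 => hx ?_)
    rw [hk0]
    exact zero_smul ℝ _

/-- Form and velocity are continuous sections along `e` of dual bundles, and bundle evaluation is
continuous. This supplies the integrability needed later. -/
theorem Edge.continuousAt_pairing (e : Edge d M) (A : TestOneForm d M) {t₀ : ℝ}
    (ht : t₀ ∈ Icc (0 : ℝ) 1) :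
    ContinuousAt (fun t => A.toFun (e.toFun t) (e.velocity t)) t₀ := by
  have : IsManifold (𝓡 (d + 1)) 1 M := isManifold_of_le_omega M 1
  have h1 : ContMDiffAt 𝓘(ℝ, ℝ) ((𝓡 (d + 1)).prod 𝓘(ℝ, Model d →L[ℝ] ℝ)) 0
      (fun t => Bundle.TotalSpace.mk' (Model d →L[ℝ] ℝ)
        (E := fun x : M => TangentSpace (𝓡 (d + 1)) x →L[ℝ] ℝ) (e.toFun t)
        (A.toFun (e.toFun t))) t₀ :=
    ContMDiffAt.comp (g := fun x => Bundle.TotalSpace.mk' (Model d →L[ℝ] ℝ)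
        (E := fun x : M => TangentSpace (𝓡 (d + 1)) x →L[ℝ] ℝ) x (A.toFun x)) (f := e.toFun) t₀
      ((A.smooth _).of_le (by simp)) ((e.analytic t₀ ht).of_le (by simp))
  have h2 : ContMDiffAt 𝓘(ℝ, ℝ) ((𝓡 (d + 1)).prod 𝓘(ℝ, Model d)) 0
      (fun t => Bundle.TotalSpace.mk' (Model d)
        (E := fun x : M => TangentSpace (𝓡 (d + 1)) x) (e.toFun t) (e.velocity t)) t₀ := by
    rw [Bundle.contMDiffAt_totalSpace]
    refine ⟨(e.analytic t₀ ht).of_le (by simp), ?_⟩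
    have h4 : ContDiffAt ℝ ω (fun v => extChartAt (𝓡 (d + 1)) (e.toFun t₀) (e.toFun v)) t₀ :=
      contDiffAt_extChartAt_comp (e.analytic t₀ ht) (mem_chart_source _ _)
    have h5 : ContDiffAt ℝ 0
        (fun t => fderiv ℝ (fun v => extChartAt (𝓡 (d + 1)) (e.toFun t₀) (e.toFun v)) t 1) t₀ :=
      ((h4.fderiv_right (m := 0) (by simp)).clm_apply contDiffAt_const)
    refine h5.contMDiffAt.congr_of_eventuallyEq ?_
    have h6 : ∀ᶠ t in 𝓝 t₀, ContMDiffAt 𝓘(ℝ, ℝ) (𝓡 (d + 1)) ω e.toFun t :=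
      (contMDiffAt_iff_contMDiffAt_nhds (by simp)).1 (e.analytic t₀ ht)
    filter_upwards [h6, (e.analytic t₀ ht).continuousAt.eventually
      (chart_source_mem_nhds (Model d) (e.toFun t₀))] with t ht1 ht2
    rw [(hasFDerivAt_extChartAt_comp (ht1.mdifferentiableAt (by simp)) ht2).fderiv]
    rw [TangentBundle.trivializationAt_apply]
    rfl
  have h3 := h1.clm_bundle_apply (F₂ := ℝ) (E₂ := fun _ => ℝ) h2
  rw [Bundle.contMDiffAt_totalSpace] at h3
  exact h3.2.continuousAt

end TestForms

/-! ### Intersection numbers as finite sums over points -/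

section LocalIntersection

/-- An analytic function has a constant sign immediately after a point. -/
theorem exists_sign_eventually_nhdsGT {g : ℝ → ℝ} {t₀ : ℝ} (hg : AnalyticAt ℝ g t₀) :
    ∃ σ : SignType, ∀ᶠ t in 𝓝[>] t₀, SignType.sign (g t) = σ := by
  rcases hg.eventually_eq_zero_or_eventually_ne_zero with h | h
  · refine ⟨0, ?_⟩
    filter_upwards [mem_nhdsWithin_of_mem_nhds h] with t ht
    rw [ht, sign_zero]
  · have h1 : ∀ᶠ t in 𝓝[>] t₀, AnalyticAt ℝ g t ∧ g t ≠ 0 :=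
      (hg.eventually_analyticAt.filter_mono nhdsWithin_le_nhds).and
        (h.filter_mono (nhdsWithin_mono t₀ fun t ht => ne_of_gt ht))
    obtain ⟨b, hb, hsub⟩ := (mem_nhdsGT_iff_exists_Ioo_subset).1 h1
    have hb' : t₀ < b := hb
    refine ⟨SignType.sign (g ((t₀ + b) / 2)), ?_⟩
    filter_upwards [Ioo_mem_nhdsGT hb'] with t ht
    -- The function is continuous without zeros on `Ioo t₀ b`, so its sign is locally constant on a
    -- connected set.
    refine isPreconnected_Ioo.constant (f := fun t => SignType.sign (g t)) (s := Ioo t₀ b)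
      ?_ ht ⟨by linarith, by linarith⟩
    intro s hs
    exact ((continuousAt_sign_of_ne_zero (hsub hs).2).comp
      (hsub hs).1.continuousAt).continuousWithinAt

variable {d : ℕ} {M : Type*} [TopologicalSpace M] [ChartedSpace (Model d) M]
  [IsManifold (𝓡 (d + 1)) ω M]

theorem Edge.continuousOn (e : Edge d M) : ContinuousOn e.toFun (Icc 0 1) :=
  fun t ht => (e.analytic t ht).continuousAt.continuousWithinAt

theorem Surface.continuousOn (S : Surface d M) : ContinuousOn S.toFun (cube d) :=
  fun u hu => (S.analytic u hu).continuousAt.continuousWithinAt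

theorem isCompact_cube : IsCompact (cube d) := isCompact_Icc

theorem Edge.tendsto_outgoing (e : Edge d M) {t : ℝ} (ht : t ∈ Icc (0 : ℝ) 1) :
    Tendsto (fun s => e.toFun (t + s)) (𝓝[>] 0) (𝓝 (e.toFun t)) := by
  have h1 : ContinuousAt (fun s => e.toFun (t + s)) 0 := by
    refine ContinuousAt.comp (g := e.toFun) ?_ (by fun_prop)
    rw [add_zero]
    exact (e.analytic t ht).continuousAt
  have := h1.tendsto.mono_left (nhdsWithin_le_nhds (s := Ioi 0))
  simpa using this

theorem Edge.tendsto_incoming (e : Edge d M) {t : ℝ} (ht : t ∈ Icc (0 : ℝ) 1) :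
    Tendsto (fun s => e.toFun (t - s)) (𝓝[>] 0) (𝓝 (e.toFun t)) := by
  have h1 : ContinuousAt (fun s => e.toFun (t - s)) 0 := by
    refine ContinuousAt.comp (g := e.toFun) ?_ (by fun_prop)
    rw [sub_zero]
    exact (e.analytic t ht).continuousAt
  have := h1.tendsto.mono_left (nhdsWithin_le_nhds (s := Ioi 0))
  simpa using this

theorem Edge.analyticAt_comp (e : Edge d M) {t : ℝ} (ht : t ∈ Icc (0 : ℝ) 1) {φ : M → ℝ}
    (hφ : ContMDiffAt (𝓡 (d + 1)) 𝓘(ℝ, ℝ) ω φ (e.toFun t)) :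
    AnalyticAt ℝ (fun s => φ (e.toFun s)) t := by
  have : ContDiffAt ℝ ω (fun s => φ (e.toFun s)) t :=
    (ContMDiffAt.comp (g := φ) (f := e.toFun) t hφ (e.analytic t ht)).contDiffAt
  exact this.analyticAt

theorem Edge.exists_sign_outgoing (e : Edge d M) {t : ℝ} (ht : t ∈ Icc (0 : ℝ) 1) {φ : M → ℝ}
    (hφ : ContMDiffAt (𝓡 (d + 1)) 𝓘(ℝ, ℝ) ω φ (e.toFun t)) :
    ∃ σ : SignType, ∀ᶠ s in 𝓝[>] (0 : ℝ), SignType.sign (φ (e.toFun (t + s))) = σ := by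
  have h1 : AnalyticAt ℝ (fun s => φ (e.toFun (t + s))) 0 := by
    refine AnalyticAt.comp (g := fun s => φ (e.toFun s)) (f := fun s => t + s) ?_
      (analyticAt_const.add analyticAt_id)
    rw [add_zero]
    exact e.analyticAt_comp ht hφ
  exact exists_sign_eventually_nhdsGT h1

theorem Edge.exists_sign_incoming (e : Edge d M) {t : ℝ} (ht : t ∈ Icc (0 : ℝ) 1) {φ : M → ℝ}
    (hφ : ContMDiffAt (𝓡 (d + 1)) 𝓘(ℝ, ℝ) ω φ (e.toFun t)) :
    ∃ σ : SignType, ∀ᶠ s in 𝓝[>] (0 : ℝ), SignType.sign (φ (e.toFun (t - s))) = σ := by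
  have h1 : AnalyticAt ℝ (fun s => φ (e.toFun (t - s))) 0 := by
    refine AnalyticAt.comp (g := fun s => φ (e.toFun s)) (f := fun s => t - s) ?_
      (analyticAt_const.sub analyticAt_id)
    rw [sub_zero]
    exact e.analyticAt_comp ht hφ
  exact exists_sign_eventually_nhdsGT h1

variable (g : Bundle.RiemannianMetric (fun x : M => TangentSpace (𝓡 (d + 1)) x))

/-- The intersection points of `e` and `S`, as pairs of parameters. -/
def intersectionSet (e : Edge d M) (S : Surface d M) : Set (ℝ × (Fin d → ℝ)) :=
  {p | p.1 ∈ Icc (0 : ℝ) 1 ∧ p.2 ∈ cube d ∧ e.toFun p.1 = S.toFun p.2}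

/-- The contribution of the point `p` to the intersection number of `e` and `S`. -/
noncomputable def intersectionAt (e : Edge d M) (S : Surface d M) (p : M) : ℝ :=
  ∑ᶠ x ∈ {x | x ∈ intersectionSet e S ∧ e.toFun x.1 = p}, localIntersection g e S x.1 x.2

theorem intersectionAt_eq (e : Edge d M) (S : Surface d M) {p : M} {t : ℝ} {u : Fin d → ℝ}
    (ht : t ∈ Icc (0 : ℝ) 1) (hu : u ∈ cube d) (het : e.toFun t = p) (hSu : S.toFun u = p) :
    intersectionAt g e S p = localIntersection g e S t u := by
  have : {x | x ∈ intersectionSet e S ∧ e.toFun x.1 = p} = {(t, u)} := by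
    ext x
    simp only [mem_ofPred_eq, mem_singleton_iff]
    constructor
    · rintro ⟨⟨h1, h2, h3⟩, h4⟩
      exact Prod.ext (e.injOn h1 ht (h4.trans het.symm))
        (S.injOn h2 hu (h3.symm.trans (h4.trans hSu.symm)))
    · rintro rfl
      exact ⟨⟨ht, hu, het.trans hSu.symm⟩, het⟩
  rw [intersectionAt, this, finsum_mem_singleton]

theorem exists_of_intersectionAt_ne_zero {e : Edge d M} {S : Surface d M} {p : M}
    (h : intersectionAt g e S p ≠ 0) : ∃ t ∈ Icc (0 : ℝ) 1, ∃ u ∈ cube d,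
      e.toFun t = p ∧ S.toFun u = p ∧ localIntersection g e S t u ≠ 0 := by
  have hne : {x | x ∈ intersectionSet e S ∧ e.toFun x.1 = p}.Nonempty := by
    by_contra hcon
    rw [not_nonempty_iff_eq_empty] at hcon
    apply h
    rw [intersectionAt, hcon, finsum_mem_empty]
  obtain ⟨⟨t, u⟩, ⟨ht, hu, htu⟩, hp⟩ := hne
  have hSu : S.toFun u = p := htu.symm.trans hp
  rw [intersectionAt_eq g e S ht hu hp hSu] at h
  exact ⟨t, ht, u, hu, hp, hSu, h⟩

/-- Indexing by the points of `M` makes the index set independent of `e` and `S`, so that linear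
combinations can be treated point by point. -/
theorem orientedIntersection_eq_finsum (e : Edge d M) (S : Surface d M) :
    orientedIntersection g e S = ∑ᶠ p, intersectionAt g e S p := by
  have hinj : InjOn (fun x : ℝ × (Fin d → ℝ) => e.toFun x.1) (intersectionSet e S) := by
    rintro ⟨t, u⟩ ⟨h1, h2, h3⟩ ⟨t', u'⟩ ⟨h1', h2', h3'⟩ h
    exact Prod.ext (e.injOn h1 h1' h) (S.injOn h2 h2' (h3.symm.trans (h.trans h3')))
  have h1 : ∑ᶠ p ∈ (fun x : ℝ × (Fin d → ℝ) => e.toFun x.1) '' intersectionSet e S,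
      intersectionAt g e S p = ∑ᶠ x ∈ intersectionSet e S, localIntersection g e S x.1 x.2 := by
    rw [finsum_mem_image hinj]
    exact finsum_mem_congr rfl fun x hx => intersectionAt_eq g e S hx.1 hx.2.1 rfl hx.2.2.symm
  have h2 : ∑ᶠ p ∈ (fun x : ℝ × (Fin d → ℝ) => e.toFun x.1) '' intersectionSet e S,
      intersectionAt g e S p = ∑ᶠ p, intersectionAt g e S p := by
    rw [← finsum_mem_univ (f := fun p => intersectionAt g e S p)]
    refine finsum_mem_inter_support_eq' _ _ _ fun p hp => ?_
    obtain ⟨t, ht, u, hu, het, hSu, -⟩ := exists_of_intersectionAt_ne_zero g hp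
    exact ⟨fun _ => mem_univ _, fun _ => ⟨(t, u), ⟨ht, hu, het.trans hSu.symm⟩, het⟩⟩
  rw [← h2, h1]
  rfl

variable [T2Space M]

/-- Contributing parameters of `e` cannot accumulate in `[0,1]`. Near a common point the analytic
function `φ ∘ e` either has an isolated zero, or vanishes identically; in the latter case `e` runs
inside the extended hypersurface and both sides are `0`. -/
theorem finite_support_intersectionAt (e : Edge d M) (S : Surface d M) :
    (Function.support (intersectionAt g e S)).Finite := by
  set A : Set ℝ := {t | t ∈ Icc (0 : ℝ) 1 ∧ ∃ u ∈ cube d, e.toFun t = S.toFun u ∧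
    localIntersection g e S t u ≠ 0} with hA
  suffices hfin : A.Finite by
    refine (hfin.image e.toFun).subset fun p hp => ?_
    obtain ⟨t, ht, u, hu, het, hSu, hl⟩ := exists_of_intersectionAt_ne_zero g hp
    exact ⟨t, ⟨ht, u, hu, het.trans hSu.symm, hl⟩, het⟩
  refine finite_of_forall_eventually_notMem isCompact_Icc (fun t ht => ht.1) fun t₀ ht₀ => ?_
  have hec := (e.analytic t₀ ht₀).continuousAt
  by_cases hex : ∃ u₀ ∈ cube d, S.toFun u₀ = e.toFun t₀
  swap
  · have h1 : ∀ᶠ x in 𝓝 (e.toFun t₀), ∀ u ∈ cube d, S.toFun u = x → u ∈ (∅ : Set (Fin d → ℝ)) :=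
      eventually_forall_mem_of_isCompact isCompact_cube S.continuousOn
        fun u hu hup => absurd ⟨u, hu, hup⟩ hex
    filter_upwards [nhdsWithin_le_nhds (hec.eventually h1)] with t ht hcon
    obtain ⟨-, u, hu, h2, -⟩ := hcon
    exact ht u hu h2.symm
  obtain ⟨u₀, hu₀, hSu⟩ := hex
  obtain ⟨r, q, hr, hrS, hrx, hdef, hsign⟩ := S.exists_retraction hu₀
  set φ : M → ℝ := fun x => leviCivita (q x) (S.partialDeriv u₀) with hφ
  have hφe := e.analyticAt_comp ht₀ (hSu ▸ hdef.1)
  rw [hSu] at hr hrx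
  rcases hφe.eventually_eq_zero_or_eventually_ne_zero with hz | hz
  · have hev : ∀ᶠ t in 𝓝 t₀, S.toFun (r (e.toFun t)) = e.toFun t ∧ ContMDiffAt (𝓡 (d + 1))
        𝓘(ℝ, Fin d → ℝ) ω r (e.toFun t) := by
      filter_upwards [hz, hec.eventually hrx,
        hec.eventually ((contMDiffAt_iff_contMDiffAt_nhds (by simp)).1 hr)] with t h1 h2 h3
      exact ⟨h2 h1, h3⟩
    have hcl : ∀ᶠ t in 𝓝 t₀, ∀ u ∈ cube d, S.toFun u = e.toFun t → r (S.toFun u) = u := by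
      refine hec.eventually (eventually_forall_mem_of_isCompact isCompact_cube S.continuousOn
        (N := {u | r (S.toFun u) = u}) fun u hu hup => ?_)
      rw [S.injOn hu hu₀ (hup.trans hSu.symm)]
      exact hrS
    filter_upwards [nhdsWithin_le_nhds hev.eventually_nhds, nhdsWithin_le_nhds hcl]
      with t hevt ht hcon
    obtain ⟨htI, u, hu, heu, hl⟩ := hcon
    apply hl
    have hru : r (e.toFun t) = u := by rw [heu]; exact ht u hu heu.symm
    obtain ⟨ψ, hψ⟩ := S.exists_isDefiningFunction hu
    -- The side at `u` is computed with a defining function `ψ` at `u`, not with `φ`. It vanishes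
    -- along `e` because `e s = S (r (e s))`.
    have hψ0 : ∀ᶠ s in 𝓝 t, ψ (e.toFun s) = 0 := by
      have hrt : Tendsto (fun s => r (e.toFun s)) (𝓝 t) (𝓝 u) := by
        have h1 : ContinuousAt (fun s => r (e.toFun s)) t :=
          ContinuousAt.comp (g := r) hevt.self_of_nhds.2.continuousAt
            (e.analytic t htI).continuousAt
        have := h1.tendsto
        rwa [hru] at this
      filter_upwards [hevt, hrt.eventually hψ.2.1] with s hs1 hs2
      rwa [hs1.1] at hs2
    have hout : S.side u (fun s => e.toFun (t + s)) = 0 := by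
      rw [Surface.side_eq_sideOf hu hψ (heu ▸ e.tendsto_outgoing htI)]
      have : Tendsto (fun s : ℝ => t + s) (𝓝[>] 0) (𝓝 t) := by
        have : Tendsto (fun s : ℝ => t + s) (𝓝 0) (𝓝 (t + 0)) := by
          exact (continuous_const.add continuous_id).tendsto 0
        rw [add_zero] at this
        exact this.mono_left nhdsWithin_le_nhds
      have h2 := sideOf_eq_of_eventually_sign (φ := ψ) (γ := fun s => e.toFun (t + s)) (σ := 0)
        ((this.eventually hψ0).mono fun s hs => by simp [hs])
      simpa using h2
    have hin : S.side u (fun s => e.toFun (t - s)) = 0 := by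
      rw [Surface.side_eq_sideOf hu hψ (heu ▸ e.tendsto_incoming htI)]
      have : Tendsto (fun s : ℝ => t - s) (𝓝[>] 0) (𝓝 t) := by
        have : Tendsto (fun s : ℝ => t - s) (𝓝 0) (𝓝 (t - 0)) := by
          exact (continuous_const.sub continuous_id).tendsto 0
        rw [sub_zero] at this
        exact this.mono_left nhdsWithin_le_nhds
      have h2 := sideOf_eq_of_eventually_sign (φ := ψ) (γ := fun s => e.toFun (t - s)) (σ := 0)
        ((this.eventually hψ0).mono fun s hs => by simp [hs])
      simpa using h2
    simp [localIntersection, hout, hin]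
  · have hcl : ∀ᶠ t in 𝓝 t₀, ∀ u ∈ cube d, S.toFun u = e.toFun t → φ (S.toFun u) = 0 := by
      refine hec.eventually (eventually_forall_mem_of_isCompact isCompact_cube S.continuousOn
        (N := {u | φ (S.toFun u) = 0}) fun u hu hup => ?_)
      rw [S.injOn hu hu₀ (hup.trans hSu.symm)]
      exact hdef.2.1
    filter_upwards [hz, nhdsWithin_le_nhds hcl] with t h1 h2 hcon
    obtain ⟨-, u, hu, heu, -⟩ := hcon
    apply h1
    rw [heu]
    exact h2 u hu heu.symm

end LocalIntersection

/-! ### Overlaps of embedded analytic patches -/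

section Overlap

variable {d : ℕ} {M : Type*} [TopologicalSpace M] [ChartedSpace (Model d) M]
  {E : Type*} [NormedAddCommGroup E] [NormedSpace ℝ E]

variable (d) in
/-- Embedded analytic patches, parametrized by the set `K`. -/
structure IsPatch (K : Set E) (f : E → M) : Prop where
  analytic : ∀ u ∈ K, ContMDiffAt 𝓘(ℝ, E) (𝓡 (d + 1)) ω f u
  injOn : InjOn f K
  immersion : ∀ u ∈ K, Function.Injective (chartDeriv (d := d) f u)

theorem IsPatch.continuousOn {K : Set E} {f : E → M} (hf : IsPatch d K f) : ContinuousOn f K :=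
  fun u hu => (hf.analytic u hu).continuousAt.continuousWithinAt

/-- The patch `f` runs inside the interior of the patch `g` near `f u`. -/
def Overlap (K : Set E) (f g : E → M) (u : E) : Prop :=
  u ∈ interior K ∧ ∃ h : E → E, ContDiffAt ℝ ω h u ∧ h u ∈ interior K ∧
    ∀ᶠ v in 𝓝 u, f v = g (h v)

/-- The change of parameters from `f` to `g`. -/
noncomputable def transition (K : Set E) (f g : E → M) (u : E) : E :=
  haveI : Nonempty E := ⟨0⟩
  Function.invFunOn g K (f u)

theorem isOpen_overlap (K : Set E) (f g : E → M) : IsOpen {u | Overlap K f g u} := by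
  rw [isOpen_iff_mem_nhds]
  rintro u ⟨hu, h, hh, hhu, hev⟩
  have h1 : ∀ᶠ v in 𝓝 u, ContDiffAt ℝ ω h v := hh.eventually (by simp)
  filter_upwards [isOpen_interior.mem_nhds hu, h1,
    hh.continuousAt.eventually (isOpen_interior.mem_nhds hhu), eventually_eventually_nhds.2 hev]
    with v hv1 hv2 hv3 hv4
  exact ⟨hv1, h, hv2, hv3, hv4⟩

theorem overlap_refl {K : Set E} (f : E → M) {u : E} (hu : u ∈ interior K) : Overlap K f f u :=
  ⟨hu, id, contDiffAt_id, hu, Eventually.of_forall fun _ => rfl⟩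

/-- `transition` is chosen pointwise and has no regularity by construction. Injectivity of `g` on
`K` forces it to agree with any analytic change of parameters, which is how it inherits smoothness.
-/
theorem transition_eventuallyEq {K : Set E} {f g : E → M} (hg : InjOn g K) {u : E} {h : E → E}
    (hh : ContinuousAt h u) (hhu : h u ∈ interior K) (hev : ∀ᶠ v in 𝓝 u, f v = g (h v)) :
    transition K f g =ᶠ[𝓝 u] h := by
  filter_upwards [hev, hh.eventually (isOpen_interior.mem_nhds hhu)] with v hv hv2
  have hex : ∃ a ∈ K, g a = f v := ⟨h v, interior_subset hv2, hv.symm⟩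
  have : Nonempty E := ⟨0⟩
  exact hg (Function.invFunOn_mem hex) (interior_subset hv2)
    ((Function.invFunOn_eq hex).trans hv)

theorem Overlap.transition_spec {K : Set E} {f g : E → M} (hg : InjOn g K) {u : E}
    (h : Overlap K f g u) : ContDiffAt ℝ ω (transition K f g) u ∧
      transition K f g u ∈ interior K ∧ ∀ᶠ v in 𝓝 u, f v = g (transition K f g v) := by
  obtain ⟨hu, τ, hτ, hτu, hev⟩ := h
  have h1 := transition_eventuallyEq hg hτ.continuousAt hτu hev
  refine ⟨hτ.congr_of_eventuallyEq h1, ?_, ?_⟩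
  · rw [h1.self_of_nhds]; exact hτu
  · filter_upwards [hev, h1] with v h2 h3
    rw [h2, h3]

theorem chartDeriv_comp {f g : E → M} {h : E → E} {u : E} (hh : DifferentiableAt ℝ h u)
    (hg : MDifferentiableAt 𝓘(ℝ, E) (𝓡 (d + 1)) g (h u)) (hev : ∀ᶠ v in 𝓝 u, f v = g (h v)) :
    chartDeriv (d := d) f u = (chartDeriv (d := d) g (h u)).comp (fderiv ℝ h u) := by
  have h1 := hg.hasMFDerivAt.comp u hh.hasFDerivAt.hasMFDerivAt
  have h2 := h1.congr_of_eventuallyEq hev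
  exact h2.mfderiv

/-- The injective derivative of `f` factors through that of the transition. -/
theorem Overlap.det_ne_zero {K : Set E} {f g : E → M} (hf : IsPatch d K f)
    (hg : IsPatch d K g) [FiniteDimensional ℝ E] {u : E} (h : Overlap K f g u) :
    (fderiv ℝ (transition K f g) u).det ≠ 0 := by
  obtain ⟨h1, h2, h3⟩ := h.transition_spec hg.injOn
  have h4 := chartDeriv_comp (h1.differentiableAt (by simp))
    ((hg.analytic _ (interior_subset h2)).mdifferentiableAt (by simp)) h3
  have h5 := hf.immersion u (interior_subset h.1)
  rw [h4] at h5
  have h6 : Function.Injective (fderiv ℝ (transition K f g) u) :=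
    Function.Injective.of_comp (f := chartDeriv (d := d) g (transition K f g u)) h5
  intro hdet
  have := LinearMap.bot_lt_ker_of_det_eq_zero hdet
  rw [LinearMap.ker_eq_bot.2 h6] at this
  exact lt_irrefl _ this

variable [FiniteDimensional ℝ E]

/-- The inverse function theorem inverts the transition analytically, and by
`transition_eventuallyEq` this local inverse is the reverse transition. -/
theorem Overlap.symm {K : Set E} {f g : E → M} (hf : IsPatch d K f)
    (hg : IsPatch d K g) {u : E} (h : Overlap K f g u) :
    Overlap K g f (transition K f g u) ∧ transition K g f (transition K f g u) = u ∧
      (fderiv ℝ (transition K g f) (transition K f g u)).comp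
        (fderiv ℝ (transition K f g) u) = ContinuousLinearMap.id ℝ E := by
  obtain ⟨h1, h2, h3⟩ := h.transition_spec hg.injOn
  have hdet := h.det_ne_zero hf hg
  have hcs : CompleteSpace E := FiniteDimensional.complete ℝ E
  have hω : (ω : WithTop ℕ∞) ≠ 0 := by simp
  set T := transition K f g with hT
  let L : E ≃L[ℝ] E := (fderiv ℝ T u).toContinuousLinearEquivOfDetNeZero hdet
  have hd : HasFDerivAt T (L : E →L[ℝ] E) u := by
    have : (L : E →L[ℝ] E) = fderiv ℝ T u := by ext x; rfl
    rw [this]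
    exact (h1.differentiableAt hω).hasFDerivAt
  have hs := h1.hasStrictFDerivAt' hd hω
  set τ := h1.localInverse hd hω
  have hτ : ContDiffAt ℝ ω τ (T u) := h1.to_localInverse hd hω
  have hτu : τ (T u) = u := h1.localInverse_apply_image hd hω
  have hright : ∀ᶠ w in 𝓝 (T u), T (τ w) = w := hs.eventually_right_inverse
  have hleft : ∀ᶠ v in 𝓝 u, τ (T v) = v := hs.eventually_left_inverse
  have hev : ∀ᶠ w in 𝓝 (T u), g w = f (τ w) := by
    have ht : Tendsto τ (𝓝 (T u)) (𝓝 u) := by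
      have := hτ.continuousAt.tendsto
      rwa [hτu] at this
    filter_upwards [hright, ht.eventually h3] with w hw1 hw2
    rw [hw2, hw1]
  have hτK : τ (T u) ∈ interior K := by rw [hτu]; exact h.1
  have heq := transition_eventuallyEq hf.injOn hτ.continuousAt hτK hev
  refine ⟨⟨h2, τ, hτ, hτK, hev⟩, ?_, ?_⟩
  · rw [heq.self_of_nhds, hτu]
  · rw [heq.fderiv_eq]
    have h5 := (hτ.differentiableAt hω).hasFDerivAt.comp u (h1.differentiableAt hω).hasFDerivAt
    have h6 : HasFDerivAt (τ ∘ T) (ContinuousLinearMap.id ℝ E) u :=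
      (hasFDerivAt_id u).congr_of_eventuallyEq hleft
    exact h5.unique h6

theorem Overlap.trans {K : Set E} {f g l : E → M} (hg : InjOn g K) {u : E}
    (h : Overlap K f g u) (h' : Overlap K g l (transition K f g u)) : Overlap K f l u := by
  obtain ⟨h1, h2, h3⟩ := h.transition_spec hg
  obtain ⟨-, τ, hτ, hτu, hev⟩ := h'
  refine ⟨h.1, τ ∘ transition K f g, hτ.comp u h1, hτu, ?_⟩
  filter_upwards [h3, h1.continuousAt.eventually hev] with v hv1 hv2
  rw [hv1, hv2]
  rfl

variable [IsManifold (𝓡 (d + 1)) ω M] [T2Space M] [MeasurableSpace E] [BorelSpace E]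

/-- Two embedded analytic patches overlap at almost all of their common points. -/
theorem ae_overlap (μ : Measure E) [μ.IsAddHaarMeasure] {K : Set E} (hK : IsCompact K)
    (hK0 : μ (K \ interior K) = 0) {f g : E → M} (hf : IsPatch d K f) (hg : IsPatch d K g) :
    μ {u ∈ K | f u ∈ g '' K ∧ ¬ Overlap K f g u} = 0 := by
  have hcs : CompleteSpace E := FiniteDimensional.complete ℝ E
  have hω : (ω : WithTop ℕ∞) ≠ 0 := by simp
  set B := {u ∈ K | f u ∈ g '' K ∧ ¬ Overlap K f g u}
  have hsub : B ⊆ (K \ interior K) ∪ (B ∩ interior K) := by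
    intro u hu
    by_cases h : u ∈ interior K
    · exact Or.inr ⟨hu, h⟩
    · exact Or.inl ⟨hu.1, h⟩
  refine measure_mono_null hsub (measure_union_null hK0 ?_)
  refine measure_null_of_locally_null _ fun u₀ hu₀ => ?_
  obtain ⟨v₀, hv₀, hgv⟩ := hu₀.1.2.1
  have hu₀K := hu₀.1.1
  suffices h : ∃ N ∈ 𝓝 u₀, μ (B ∩ interior K ∩ N) = 0 by
    obtain ⟨N, hN, hN0⟩ := h
    exact ⟨B ∩ interior K ∩ N, inter_mem self_mem_nhdsWithin (mem_nhdsWithin_of_mem_nhds hN), hN0⟩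
  obtain ⟨r, q, P, hr, hq, hrg, hqg, hq0, -, -, -⟩ :=
    exists_analytic_retraction_manifold (hg.analytic v₀ hv₀) (hg.immersion v₀ hv₀)
  rw [hgv] at hr hq hq0
  have hfu := hf.analytic u₀ hu₀K
  have hqf : ContDiffAt ℝ ω (fun u => q (f u)) u₀ :=
    (ContMDiffAt.comp (g := q) (f := f) u₀ hq hfu).contDiffAt
  have hrf : ContDiffAt ℝ ω (fun u => r (f u)) u₀ :=
    (ContMDiffAt.comp (g := r) (f := f) u₀ hr hfu).contDiffAt
  -- By compactness and injectivity, common points near `f u₀` come from parameters of `g` near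
  -- `v₀`, where `r` inverts `g` and `q` vanishes.
  have hclose : ∀ᶠ u in 𝓝 u₀, ∀ v ∈ K, g v = f u → r (f u) = v ∧ q (f u) = 0 := by
    have h1 : ∀ᶠ x in 𝓝 (f u₀), ∀ v ∈ K, g v = x → v ∈ {v | r (g v) = v ∧ q (g v) = 0} := by
      refine eventually_forall_mem_of_isCompact hK hg.continuousOn fun v hv hvp => ?_
      have : v = v₀ := hg.injOn hv hv₀ (hvp.trans hgv.symm)
      rw [this]
      exact hrg.and hqg
    filter_upwards [hfu.continuousAt.eventually h1] with u hu v hv hvu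
    have := hu v hv hvu
    simp only [hvu] at this
    exact this
  -- If `q ∘ f` vanishes near `u₀`, then `f = g ∘ T` with a local diffeomorphism `T`, and overlap
  -- fails only where `T` hits the null set `K \ interior K`; its image under the inverse of `T` is
  -- null. Otherwise some component of `q ∘ f` is a nonzero analytic germ, and the common points lie
  -- in its null zero set.
  by_cases hcase : ∀ᶠ u in 𝓝 u₀, q (f u) = 0
  · have hev : ∀ᶠ u in 𝓝 u₀, f u = g (r (f u)) := by
      filter_upwards [hcase, hfu.continuousAt.eventually hq0] with u h1 h2 using (h2 h1).symm
    have hru₀ : r (f u₀) = v₀ := by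
      have := hrg.self_of_nhds
      rwa [hgv] at this
    set T := fun u => r (f u) with hT
    have hTu₀ : T u₀ = v₀ := hru₀
    have hinj : Function.Injective (fderiv ℝ T u₀) := by
      have h4 := chartDeriv_comp (d := d) (hrf.differentiableAt hω)
        (by rw [hTu₀]; exact (hg.analytic _ hv₀).mdifferentiableAt (by simp)) hev
      have h5 := hf.immersion u₀ hu₀K
      rw [h4] at h5
      exact Function.Injective.of_comp (f := chartDeriv (d := d) g (r (f u₀))) h5
    have hdet : (fderiv ℝ T u₀).det ≠ 0 := by
      intro hdet
      have := LinearMap.bot_lt_ker_of_det_eq_zero hdet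
      rw [LinearMap.ker_eq_bot.2 hinj] at this
      exact lt_irrefl _ this
    let L : E ≃L[ℝ] E := (fderiv ℝ T u₀).toContinuousLinearEquivOfDetNeZero hdet
    have hd : HasFDerivAt T (L : E →L[ℝ] E) u₀ := by
      have : (L : E →L[ℝ] E) = fderiv ℝ T u₀ := by ext x; rfl
      rw [this]
      exact (hrf.differentiableAt hω).hasFDerivAt
    have hs := hrf.hasStrictFDerivAt' hd hω
    have hτ : ContDiffAt ℝ ω (hrf.localInverse hd hω) (T u₀) := hrf.to_localInverse hd hω
    have hleft : ∀ᶠ v in 𝓝 u₀, hrf.localInverse hd hω (T v) = v := hs.eventually_left_inverse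
    have hdiff : ∀ᶠ w in 𝓝 (T u₀), ContDiffAt ℝ ω (hrf.localInverse hd hω) w :=
      hτ.eventually (by simp)
    obtain ⟨N, hN, hNp⟩ := (hev.eventually_nhds.and (hclose.and (hleft.and
      ((hrf.eventually (by simp)).and (hrf.continuousAt.eventually hdiff))))).exists_mem
    refine ⟨N, hN, ?_⟩
    set D := {w ∈ K \ interior K | DifferentiableAt ℝ (hrf.localInverse hd hω) w}
    have hD : μ D = 0 := measure_mono_null (fun w hw => hw.1) hK0
    have himg : μ (hrf.localInverse hd hω '' D) = 0 :=
      addHaar_image_eq_zero_of_differentiableOn_of_addHaar_eq_zero μ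
        (fun w hw => hw.2.differentiableWithinAt) hD
    refine measure_mono_null ?_ himg
    rintro u ⟨⟨hu, huK⟩, huN⟩
    obtain ⟨h1, h2, h3, h4, h5⟩ := hNp u huN
    obtain ⟨v, hv, hvu⟩ := hu.2.1
    have hTv : T u = v := (h2 v hv hvu).1
    refine ⟨T u, ⟨⟨by rw [hTv]; exact hv, fun hint => ?_⟩, h5.differentiableAt hω⟩, h3⟩
    exact hu.2.2 ⟨huK, T, h4, hint, h1⟩
  · obtain ⟨i, hi⟩ : ∃ i, ¬ ∀ᶠ u in 𝓝 u₀, q (f u) i = 0 := by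
      by_contra! hcon
      apply hcase
      filter_upwards [eventually_all.2 hcon] with u hu
      ext i
      exact hu i
    have han : AnalyticAt ℝ (fun u => q (f u) i) u₀ := by
      have : ContDiffAt ℝ ω (fun u => q (f u) i) u₀ :=
        (EuclideanSpace.proj (𝕜 := ℝ) i).contDiff.contDiffAt.comp u₀ hqf
      exact this.analyticAt
    obtain ⟨N, hN, hN0⟩ := exists_nhds_measure_zeros_eq_zero μ han hi
    refine ⟨N ∩ {u | ∀ v ∈ K, g v = f u → r (f u) = v ∧ q (f u) = 0}, inter_mem hN hclose, ?_⟩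
    refine measure_mono_null ?_ hN0
    rintro u ⟨⟨hu, -⟩, huN, hcl⟩
    obtain ⟨v, hv, hvu⟩ := hu.2.1
    refine ⟨huN, ?_⟩
    simp only [mem_ofPred_eq]
    rw [(hcl v hv hvu).2]
    rfl

end Overlap

/-! ### Cancellation of integrals over overlapping patches -/

section OverlapSum

variable {d : ℕ} {M : Type*} [TopologicalSpace M] [ChartedSpace (Model d) M]
  {E : Type*} [NormedAddCommGroup E] [NormedSpace ℝ E] [FiniteDimensional ℝ E]
  [IsManifold (𝓡 (d + 1)) ω M] [T2Space M] [MeasurableSpace E] [BorelSpace E]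

/-- The relative orientation of two overlapping patches. -/
noncomputable def transitionSign (K : Set E) (f g : E → M) (u : E) : ℝ :=
  (SignType.sign (fderiv ℝ (transition K f g) u).det : ℝ)

theorem measurable_transitionSign (K : Set E) (f g : E → M) :
    Measurable (transitionSign K f g) := by
  have hcs : CompleteSpace E := FiniteDimensional.complete ℝ E
  have h1 : Measurable fun u => (fderiv ℝ (transition K f g) u).det :=
    ContinuousLinearMap.continuous_det.measurable.comp (measurable_fderiv ℝ _)
  -- The sign as a quotient of measurable functions, with `0 / 0 = 0`.
  have h2 : transitionSign K f g = fun u => (fderiv ℝ (transition K f g) u).det /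
      |(fderiv ℝ (transition K f g) u).det| := by
    ext u
    rw [transitionSign]
    rcases lt_trichotomy (fderiv ℝ (transition K f g) u).det 0 with h | h | h
    · rw [sign_neg h, abs_of_neg h, div_neg, div_self h.ne]; simp
    · simp [h]
    · rw [sign_pos h, abs_of_pos h, div_self h.ne']; simp
  rw [h2]
  exact h1.div h1.abs

theorem abs_transitionSign_le (K : Set E) (f g : E → M) (u : E) :
    |transitionSign K f g u| ≤ 1 := by
  rw [transitionSign]
  cases SignType.sign (fderiv ℝ (transition K f g) u).det <;> simp

/-- The two transitions have inverse determinants, hence equal signs. In the change of variables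
this turns `|det|` into `det`. -/
theorem Overlap.abs_det_mul_transitionSign {K : Set E} {f g : E → M} (hf : IsPatch d K f)
    (hg : IsPatch d K g) {u : E} (h : Overlap K f g u) :
    |(fderiv ℝ (transition K f g) u).det| * transitionSign K g f (transition K f g u) =
      (fderiv ℝ (transition K f g) u).det := by
  have h1 := (h.symm hf hg).2.2
  have h2 : (fderiv ℝ (transition K g f) (transition K f g u)).det *
      (fderiv ℝ (transition K f g) u).det = 1 := by
    have := congrArg ContinuousLinearMap.det h1
    rw [ContinuousLinearMap.det, ContinuousLinearMap.toLinearMap_comp, LinearMap.det_comp] at this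
    rw [ContinuousLinearMap.det, ContinuousLinearMap.det, this]
    simp [ContinuousLinearMap.det]
  rw [transitionSign]
  set a := (fderiv ℝ (transition K g f) (transition K f g u)).det
  set b := (fderiv ℝ (transition K f g) u).det
  rcases lt_trichotomy b 0 with hb | hb | hb
  · have ha : a < 0 := by
      by_contra! hcon
      nlinarith
    rw [sign_neg ha, abs_of_neg hb]; simp
  · rw [hb] at h2; simp at h2
  · have ha : 0 < a := by
      by_contra! hcon
      nlinarith
    rw [sign_pos ha, abs_of_pos hb]; simp

open Classical in
/-- A linear combination of integrals over embedded analytic patches vanishes if at almost every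
point the coefficients of the overlapping patches cancel. -/
theorem sum_integral_eq_zero_of_overlap {ι : Type*} [Fintype ι]
    (μ : Measure E) [μ.IsAddHaarMeasure] {K : Set E} (hK : IsCompact K)
    (hK0 : μ (K \ interior K) = 0) {f : ι → E → M} (hf : ∀ i, IsPatch d K (f i))
    {w : ι → E → ℝ} (hw : ∀ i, IntegrableOn (w i) K μ) (c : ι → ℝ)
    (hcov : ∀ j k u, Overlap K (f j) (f k) u →
      w j u = (fderiv ℝ (transition K (f j) (f k)) u).det * w k (transition K (f j) (f k) u))
    (hz : ∀ j, ∀ u ∈ interior K, (∀ k, f j u ∈ f k '' K → Overlap K (f j) (f k) u) →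
      ∑ k, (if Overlap K (f j) (f k) u then c k * transitionSign K (f j) (f k) u else 0) = 0) :
    ∑ k, c k * ∫ u in K, w k u ∂μ = 0 := by
  let Ov : ι → ι → E → Prop := fun j k u => Overlap K (f j) (f k) u
  -- The generic parameters: every patch that passes through the point overlaps there. By
  -- `ae_overlap` they fill `K` up to a null set.
  let G : ι → Set E := fun j => {u | u ∈ interior K ∧ ∀ k, f j u ∈ f k '' K → Ov j k u}
  let O : ι → ι → Set E := fun j k => {u | u ∈ G j ∧ Ov j k u}
  -- The number of patches overlapping at the point. It is at least `1` in the interior, and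
  -- transitions preserve it because overlap is transitive.
  let N : ι → E → ℝ := fun j u => ∑ k, if Ov j k u then 1 else 0
  have hOvm : ∀ j k, MeasurableSet {u | Ov j k u} := fun j k => (isOpen_overlap _ _ _).measurableSet
  have hGm : ∀ j, MeasurableSet (G j) := by
    intro j
    have hcl : ∀ k, IsClosed (K ∩ f j ⁻¹' (f k '' K)) := fun k =>
      (hf j).continuousOn.preimage_isClosed_of_isClosed hK.isClosed
        (hK.image_of_continuousOn (hf k).continuousOn).isClosed
    have : G j = interior K ∩ ⋂ k, ((K ∩ f j ⁻¹' (f k '' K))ᶜ ∪ {u | Ov j k u}) := by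
      ext u
      simp only [G, mem_ofPred_eq, mem_inter_iff, mem_iInter, mem_union, mem_compl_iff,
        mem_preimage, not_and]
      refine and_congr_right fun hu => forall_congr' fun k => ?_
      have := interior_subset hu
      tauto
    rw [this]
    exact isOpen_interior.measurableSet.inter
      (MeasurableSet.iInter fun k => (hcl k).measurableSet.compl.union (hOvm j k))
  have hOm : ∀ j k, MeasurableSet (O j k) := fun j k => (hGm j).inter (hOvm j k)
  have hGK : ∀ j, G j ⊆ K := fun j u hu => interior_subset hu.1
  have hKG : ∀ j, G j =ᵐ[μ] K := by
    intro j
    refine (hGK j).eventuallyLE.antisymm ?_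
    rw [ae_le_set]
    have : K \ G j ⊆ (K \ interior K) ∪ ⋃ k, {u ∈ K | f j u ∈ f k '' K ∧ ¬ Ov j k u} := by
      intro u hu
      by_cases h : u ∈ interior K
      · right
        have h2 : ¬ ∀ k, f j u ∈ f k '' K → Ov j k u := fun h3 => hu.2 ⟨h, h3⟩
        push Not at h2
        obtain ⟨k, hk⟩ := h2
        exact mem_iUnion.2 ⟨k, hu.1, hk⟩
      · exact Or.inl ⟨hu.1, h⟩
    exact measure_mono_null this (measure_union_null hK0
      (measure_iUnion_null fun k => ae_overlap μ hK hK0 (hf j) (hf k)))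
  have hNm : ∀ j, Measurable (N j) := fun j =>
    Finset.measurable_sum _ fun k _ => Measurable.ite (hOvm j k) measurable_const measurable_const
  have hN1 : ∀ j, ∀ u ∈ interior K, 1 ≤ N j u := by
    intro j u hu
    have h1 : (if Ov j j u then (1 : ℝ) else 0) ≤ N j u :=
      Finset.single_le_sum (f := fun k => if Ov j k u then (1 : ℝ) else 0)
        (fun k _ => by positivity) (Finset.mem_univ j)
    rwa [if_pos (show Ov j j u from overlap_refl _ hu)] at h1
  have htr : ∀ j k u, Ov j k u → ∀ l, Ov j l u ↔ Ov k l (transition K (f j) (f k) u) := by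
    intro j k u h l
    refine ⟨fun h' => ?_, fun h' => h.trans (hf k).injOn h'⟩
    obtain ⟨h1, h2, -⟩ := h.symm (hf j) (hf k)
    exact h1.trans (hf j).injOn (by rw [h2]; exact h')
  have hNtr : ∀ j k u, Ov j k u → N j u = N k (transition K (f j) (f k) u) := by
    intro j k u h
    exact Finset.sum_congr rfl fun l _ => by simp only [htr j k u h l]
  have hfeq : ∀ j k u, Ov j k u → f j u = f k (transition K (f j) (f k) u) :=
    fun j k u h => (h.transition_spec (hf k).injOn).2.2.self_of_nhds
  have hOtr : ∀ j k, ∀ u ∈ O j k, transition K (f j) (f k) u ∈ O k j := by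
    intro j k u hu
    refine ⟨⟨(hu.2.transition_spec (hf k).injOn).2.1, fun l hl => ?_⟩,
      (hu.2.symm (hf j) (hf k)).1⟩
    rw [← hfeq j k u hu.2] at hl
    exact (htr j k u hu.2 l).1 (hu.1.2 l hl)
  have himg : ∀ j k, transition K (f j) (f k) '' O j k = O k j := by
    intro j k
    apply Subset.antisymm
    · rintro _ ⟨u, hu, rfl⟩
      exact hOtr j k u hu
    · intro v hv
      exact ⟨_, hOtr k j v hv, (hv.2.symm (hf k) (hf j)).2.1⟩
  -- Each share `w / N` is moved from patch `j` to patch `k` on their overlap. The determinant from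
  -- the covariance of `w` is absorbed by the Jacobian up to the relative orientation.
  have hchange : ∀ j k, ∫ v in O k j, transitionSign K (f k) (f j) v * (w k v / N k v) ∂μ =
      ∫ u in O j k, w j u / N j u ∂μ := by
    intro j k
    rw [← himg j k, integral_image_eq_integral_abs_det_fderiv_smul μ (hOm j k)
      (f' := fun u => fderiv ℝ (transition K (f j) (f k)) u)]
    · refine setIntegral_congr_fun (hOm j k) fun u hu => ?_
      simp only [smul_eq_mul]
      rw [← mul_assoc, hu.2.abs_det_mul_transitionSign (hf j) (hf k), ← hNtr j k u hu.2,
        hcov j k u hu.2, mul_div_assoc]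
    · intro u hu
      exact (((hu.2.transition_spec (hf k).injOn).1.differentiableAt
        (by simp)).hasFDerivAt).hasFDerivWithinAt
    · intro u hu v hv huv
      rw [← (hu.2.symm (hf j) (hf k)).2.1, ← (hv.2.symm (hf j) (hf k)).2.1, huv]
  have hwN : ∀ j, IntegrableOn (fun u => w j u / N j u) (G j) μ := by
    intro j
    have h1 : IntegrableOn (w j) (G j) μ := (hw j).mono_set (hGK j)
    refine Integrable.mono h1 (h1.aemeasurable.div (hNm j).aemeasurable).aestronglyMeasurable ?_
    refine (ae_restrict_iff' (hGm j)).2 (Eventually.of_forall fun u hu => ?_)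
    have := hN1 j u hu.1
    rw [norm_div]
    refine div_le_self (norm_nonneg _) ?_
    rw [Real.norm_of_nonneg (by linarith)]
    exact this
  -- At a generic point the `N` overlapping patches receive the share `w / N` each, which adds up to
  -- `w`.
  have hstep1 : ∀ j, ∫ u in K, w j u ∂μ = ∑ k, ∫ u in O j k, w j u / N j u ∂μ := by
    intro j
    rw [← setIntegral_congr_set (hKG j)]
    have h2 : ∀ k, ∫ u in O j k, w j u / N j u ∂μ =
        ∫ u in G j, {u | Ov j k u}.indicator (fun u => w j u / N j u) u ∂μ := by
      intro k
      rw [setIntegral_indicator (hOvm j k)]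
      rfl
    simp only [h2]
    rw [← integral_finsetSum _ fun k _ => (hwN j).indicator (hOvm j k)]
    refine setIntegral_congr_fun (hGm j) fun u hu => ?_
    have hN := hN1 j u hu.1
    have h3 : ∀ k, {u | Ov j k u}.indicator (fun u => w j u / N j u) u =
        (w j u / N j u) * (if Ov j k u then 1 else 0) := by
      intro k
      by_cases h : Ov j k u <;> simp [indicator, h]
    simp only [h3]
    rw [← Finset.mul_sum]
    change w j u = w j u / N j u * N j u
    rw [div_mul_cancel₀]
    linarith
  have hint : ∀ j k, IntegrableOn
      (fun v => {v | Ov k j v}.indicator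
        (fun v => transitionSign K (f k) (f j) v * (w k v / N k v)) v) (G k) μ := by
    intro j k
    refine Integrable.indicator ?_ (hOvm k j)
    refine (hwN k).bdd_mul (c := 1) (measurable_transitionSign _ _ _).aestronglyMeasurable ?_
    exact Eventually.of_forall fun v => abs_transitionSign_le _ _ _ _
  -- After redistributing the shares and exchanging the two sums, the integrand on patch `k` is `w k
  -- / N k` times the signed coefficient sum, which vanishes by `hz`.
  calc ∑ j, c j * ∫ u in K, w j u ∂μ
      = ∑ j, ∑ k, c j * ∫ v in O k j, transitionSign K (f k) (f j) v * (w k v / N k v) ∂μ := by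
        refine Finset.sum_congr rfl fun j _ => ?_
        rw [hstep1, Finset.mul_sum]
        refine Finset.sum_congr rfl fun k _ => ?_
        rw [hchange]
    _ = ∑ k, ∑ j, c j * ∫ v in G k, {v | Ov k j v}.indicator
          (fun v => transitionSign K (f k) (f j) v * (w k v / N k v)) v ∂μ := by
        rw [Finset.sum_comm]
        refine Finset.sum_congr rfl fun k _ => Finset.sum_congr rfl fun j _ => ?_
        rw [setIntegral_indicator (hOvm k j)]
        rfl
    _ = ∑ k, ∫ v in G k, 0 ∂μ := by
        refine Finset.sum_congr rfl fun k _ => ?_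
        simp only [← integral_const_mul]
        rw [← integral_finsetSum _ fun j _ => (hint j k).const_mul (c j)]
        refine setIntegral_congr_fun (hGm k) fun v hv => ?_
        have h0 := hz k v hv.1 hv.2
        calc ∑ j, c j * {v | Ov k j v}.indicator
              (fun v => transitionSign K (f k) (f j) v * (w k v / N k v)) v
            = ∑ j, (w k v / N k v) * (if Overlap K (f k) (f j) v then
                c j * transitionSign K (f k) (f j) v else 0) := by
              refine Finset.sum_congr rfl fun j _ => ?_
              by_cases h : Ov k j v
              · have h' : Overlap K (f k) (f j) v := h
                rw [indicator_of_mem (show v ∈ {v | Ov k j v} from h), if_pos h']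
                ring
              · have h' : ¬ Overlap K (f k) (f j) v := h
                rw [indicator_of_notMem (show v ∉ {v | Ov k j v} from h), if_neg h']
                ring
          _ = 0 := by rw [← Finset.mul_sum, h0, mul_zero]
    _ = 0 := by simp

end OverlapSum

/-! ### Smooth step functions -/

section Step

/-- A smooth odd step of width `ε`, with values `-1/2` below `-ε` and `1/2` above `ε`. -/
noncomputable def smoothStep (ε x : ℝ) : ℝ := Real.smoothTransition ((x / ε + 1) / 2) - 1 / 2

theorem contDiff_smoothStep (ε : ℝ) : ContDiff ℝ ∞ (smoothStep ε) := by
  have h1 : ContDiff ℝ ∞ (fun x : ℝ => (x / ε + 1) / 2) :=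
    ((contDiff_id.div_const ε).add contDiff_const).div_const 2
  exact ((Real.smoothTransition.contDiff (n := ⊤)).comp h1).sub contDiff_const

/-- The symmetric value at `0` is what gives an end point of an edge on the surface the weight
`1/2`. -/
theorem smoothStep_zero (ε : ℝ) : smoothStep ε 0 = 0 := by
  have h : Real.smoothTransition (1 / 2) = 1 / 2 := by
    have hp : 0 < expNegInvGlue (1 / 2) := expNegInvGlue.pos_of_pos (by norm_num)
    rw [Real.smoothTransition, show (1 : ℝ) - 1 / 2 = 1 / 2 by norm_num]
    field_simp
    norm_num
  simp only [smoothStep, zero_div, zero_add, h, sub_self]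

theorem smoothStep_of_le {ε x : ℝ} (hε : 0 < ε) (h : ε ≤ x) : smoothStep ε x = 1 / 2 := by
  have : 1 ≤ x / ε := (one_le_div hε).2 h
  rw [smoothStep, Real.smoothTransition.one_of_one_le (by linarith)]
  norm_num

theorem smoothStep_of_le_neg {ε x : ℝ} (hε : 0 < ε) (h : x ≤ -ε) :
    smoothStep ε x = -(1 / 2) := by
  have : x / ε ≤ -1 := by rw [div_le_iff₀ hε]; linarith
  rw [smoothStep, Real.smoothTransition.zero_of_nonpos (by linarith)]
  norm_num

theorem smoothStep_of_abs_le {ε x : ℝ} (hε : 0 < ε) (h : ε ≤ |x|) :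
    smoothStep ε x = (SignType.sign x : ℝ) / 2 := by
  rcases lt_trichotomy x 0 with hx | hx | hx
  · rw [abs_of_neg hx] at h
    rw [smoothStep_of_le_neg hε (by linarith), sign_neg hx]
    norm_num
  · rw [hx, abs_zero] at h
    linarith
  · rw [abs_of_pos hx] at h
    rw [smoothStep_of_le hε h, sign_pos hx]
    norm_num

/-- On a compact set where `g` has constant sign, narrow steps of `g` are constant. -/
theorem eventually_smoothStep_eq {X : Type*} [TopologicalSpace X] {C : Set X} (hC : IsCompact C)
    {g : X → ℝ} (hg : ContinuousOn g C) {σ : SignType} (hσ : ∀ t ∈ C, SignType.sign (g t) = σ) :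
    ∀ᶠ ε in 𝓝[>] (0 : ℝ), ∀ t ∈ C, smoothStep ε (g t) = (σ : ℝ) / 2 := by
  by_cases h0 : σ = 0
  · refine Eventually.of_forall fun ε t ht => ?_
    have := hσ t ht
    rw [h0, sign_eq_zero_iff] at this
    rw [this, smoothStep_zero, h0]
    simp
  · rcases C.eq_empty_or_nonempty with rfl | hne
    · simp
    obtain ⟨t₁, ht₁, hmin⟩ := hC.exists_isMinOn hne hg.abs
    have hpos : 0 < |g t₁| := by
      rw [abs_pos]
      intro h
      have := hσ t₁ ht₁
      rw [h, sign_zero] at this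
      exact h0 this.symm
    filter_upwards [Ioo_mem_nhdsGT hpos] with ε hε t ht
    rw [smoothStep_of_abs_le hε.1 (hε.2.le.trans (hmin ht)), hσ t ht]

end Step

/-! ### Step forms compute the local contribution of an edge -/

section EdgeLimit

variable {d : ℕ} {M : Type*} [TopologicalSpace M] [ChartedSpace (Model d) M]
  [IsManifold (𝓡 (d + 1)) ω M]

theorem Edge.hasDerivAt_comp (e : Edge d M) {t : ℝ} (ht : t ∈ Icc (0 : ℝ) 1) {G : M → ℝ}
    (hG : ContMDiff (𝓡 (d + 1)) 𝓘(ℝ, ℝ) ∞ G) :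
    HasDerivAt (fun s => G (e.toFun s)) (chartCodiff G (e.toFun t) (e.velocity t)) t :=
  (hasFDerivAt_comp_of_mdifferentiableAt ((hG _).mdifferentiableAt (by simp))
    ((e.analytic t ht).mdifferentiableAt (by simp))).hasDerivAt

theorem Edge.formFactor_eq_setIntegral (e : Edge d M) (A : TestOneForm d M) :
    e.formFactor A = ∫ t in Icc (0 : ℝ) 1, A.toFun (e.toFun t) (e.velocity t) := by
  rw [Edge.formFactor, intervalIntegral.integral_of_le zero_le_one, integral_Icc_eq_integral_Ioc]

theorem Edge.continuousOn_pairing (e : Edge d M) (A : TestOneForm d M) :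
    ContinuousOn (fun t => A.toFun (e.toFun t) (e.velocity t)) (Icc 0 1) :=
  fun _ ht => (e.continuousAt_pairing A ht).continuousWithinAt

theorem contMDiff_mul_deriv_smoothStep {χ G : M → ℝ} (hχ : ContMDiff (𝓡 (d + 1)) 𝓘(ℝ, ℝ) ∞ χ)
    (hG : ContMDiff (𝓡 (d + 1)) 𝓘(ℝ, ℝ) ∞ G) (ε : ℝ) :
    ContMDiff (𝓡 (d + 1)) 𝓘(ℝ, ℝ) ∞ (fun x => χ x * deriv (smoothStep ε) (G x)) := by
  have h1 : ContDiff ℝ ∞ (deriv (smoothStep ε)) :=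
    (contDiff_infty_iff_deriv.1 (contDiff_smoothStep ε)).2
  exact hχ.mul (ContMDiff.comp (g := deriv (smoothStep ε)) h1.contMDiff hG)

/-- The test one-form `χ d(smoothStep ε ∘ G)`. -/
noncomputable def stepForm {χ G : M → ℝ} (hχ : ContMDiff (𝓡 (d + 1)) 𝓘(ℝ, ℝ) ∞ χ)
    (hG : ContMDiff (𝓡 (d + 1)) 𝓘(ℝ, ℝ) ∞ G) (hc : HasCompactSupport χ) (ε : ℝ) :
    TestOneForm d M :=
  TestOneForm.smulDifferential (contMDiff_mul_deriv_smoothStep hχ hG ε) hG hc.mul_right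

theorem Edge.formFactor_stepForm (e : Edge d M) {χ G : M → ℝ}
    (hχ : ContMDiff (𝓡 (d + 1)) 𝓘(ℝ, ℝ) ∞ χ) (hG : ContMDiff (𝓡 (d + 1)) 𝓘(ℝ, ℝ) ∞ G)
    (hc : HasCompactSupport χ) (ε : ℝ) {t : ℝ} (ht : t ∈ Icc (0 : ℝ) 1) :
    (stepForm hχ hG hc ε).toFun (e.toFun t) (e.velocity t) =
      χ (e.toFun t) * deriv (fun s => smoothStep ε (G (e.toFun s))) t := by
  have h1 : HasDerivAt (fun s => smoothStep ε (G (e.toFun s)))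
      (deriv (smoothStep ε) (G (e.toFun t)) * chartCodiff G (e.toFun t) (e.velocity t)) t :=
    HasDerivAt.comp t (h₂ := smoothStep ε)
      (((contDiff_smoothStep ε).differentiable (by simp)) _).hasDerivAt (e.hasDerivAt_comp ht hG)
  rw [h1.deriv, ← mul_assoc]
  rfl

/-- If `e` misses `p`, then so do the step forms supported close to `p`. -/
theorem Edge.formFactor_stepForm_eq_zero (e : Edge d M) {χ G : M → ℝ}
    (hχ : ContMDiff (𝓡 (d + 1)) 𝓘(ℝ, ℝ) ∞ χ) (hG : ContMDiff (𝓡 (d + 1)) 𝓘(ℝ, ℝ) ∞ G)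
    (hc : HasCompactSupport χ) (ε : ℝ) (h0 : ∀ t ∈ Icc (0 : ℝ) 1, χ (e.toFun t) = 0) :
    e.formFactor (stepForm hχ hG hc ε) = 0 := by
  rw [Edge.formFactor_eq_setIntegral]
  refine setIntegral_eq_zero_of_forall_eq_zero fun t ht => ?_
  rw [e.formFactor_stepForm hχ hG hc ε ht, h0 t ht, zero_mul]

/-- Narrow step forms compute the local contribution of an edge at a point of the hypersurface
`G = 0`. -/
theorem Edge.eventually_formFactor_stepForm (e : Edge d M) {χ G : M → ℝ}
    (hχ : ContMDiff (𝓡 (d + 1)) 𝓘(ℝ, ℝ) ∞ χ) (hG : ContMDiff (𝓡 (d + 1)) 𝓘(ℝ, ℝ) ∞ G)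
    (hc : HasCompactSupport χ) {t₀ δ : ℝ} (ht₀ : t₀ ∈ Icc (0 : ℝ) 1) (hδ : 0 < δ)
    {σ τ : SignType} (hσ : ∀ t ∈ Ioc t₀ (t₀ + δ), SignType.sign (G (e.toFun t)) = σ)
    (hτ : ∀ t ∈ Ico (t₀ - δ) t₀, SignType.sign (G (e.toFun t)) = τ) (hG0 : G (e.toFun t₀) = 0)
    (hχ0 : ∀ t ∈ Icc (0 : ℝ) 1, t ∉ Ioo (t₀ - δ) (t₀ + δ) → χ (e.toFun t) = 0)
    (hχ1 : χ =ᶠ[𝓝 (e.toFun t₀)] 1) :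
    ∀ᶠ ε in 𝓝[>] (0 : ℝ), e.formFactor (stepForm hχ hG hc ε) =
      1 / 2 * ((if t₀ < 1 then (σ : ℝ) else 0) - (if 0 < t₀ then (τ : ℝ) else 0)) := by
  obtain ⟨δ₁, hδ₁, hball⟩ := Metric.eventually_nhds_iff.1
    ((e.analytic t₀ ht₀).continuousAt.eventually hχ1)
  -- Within `δ'` of `t₀` the bump is identically `1` along `e`; beyond `δ` it vanishes. In between,
  -- only the constancy of the step can be used.
  obtain ⟨δ', hδ', hδ'1⟩ : ∃ δ', 0 < δ' ∧ δ' < min δ δ₁ := exists_between (lt_min hδ hδ₁)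
  have hδ'δ : δ' < δ := hδ'1.trans_le (min_le_left _ _)
  have hone : ∀ t, |t - t₀| ≤ δ' → χ (e.toFun t) = 1 := fun t ht =>
    hball (by rw [Real.dist_eq]; exact ht.trans_lt (hδ'1.trans_le (min_le_right _ _)))
  set a := max 0 (t₀ - δ') with ha
  set b := min 1 (t₀ + δ') with hb
  have ha0 : 0 ≤ a := le_max_left _ _
  have hb1 : b ≤ 1 := min_le_left _ _
  have hat : a ≤ t₀ := max_le ht₀.1 (by linarith)
  have htb : t₀ ≤ b := le_min ht₀.2 (by linarith)
  have hcont : ContinuousOn (fun t => G (e.toFun t)) (Icc 0 1) := fun t ht =>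
    (e.hasDerivAt_comp ht hG).continuousAt.continuousWithinAt
  -- The condition `t₀ < 1` empties the set when there is no outgoing branch: then `b = t₀`, where
  -- `G` vanishes and need not have sign `σ`. `C₂` is the analogue for the incoming branch.
  set C₁ := Icc b (t₀ + δ) ∩ Icc 0 1 ∩ {t | t₀ < 1} with hC₁
  set C₂ := Icc (t₀ - δ) a ∩ Icc 0 1 ∩ {t | 0 < t₀} with hC₂
  have hC₁σ : ∀ t ∈ C₁, SignType.sign (G (e.toFun t)) = σ := by
    intro t ht
    refine hσ t ⟨?_, ht.1.1.2⟩
    have h1 : t₀ < 1 := ht.2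
    have : t₀ < b := lt_min h1 (by linarith)
    exact this.trans_le ht.1.1.1
  have hC₂τ : ∀ t ∈ C₂, SignType.sign (G (e.toFun t)) = τ := by
    intro t ht
    refine hτ t ⟨ht.1.1.1, ?_⟩
    have h1 : 0 < t₀ := ht.2
    have : a < t₀ := max_lt h1 (by linarith)
    exact ht.1.1.2.trans_lt this
  have hC₁c : IsCompact C₁ := by
    by_cases h : t₀ < 1
    · have : C₁ = Icc b (t₀ + δ) ∩ Icc 0 1 := by simp [hC₁, h]
      rw [this]; exact isCompact_Icc.inter isCompact_Icc
    · have : C₁ = ∅ := by simp [hC₁, h]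
      rw [this]; exact isCompact_empty
  have hC₂c : IsCompact C₂ := by
    by_cases h : 0 < t₀
    · have : C₂ = Icc (t₀ - δ) a ∩ Icc 0 1 := by simp [hC₂, h]
      rw [this]; exact isCompact_Icc.inter isCompact_Icc
    · have : C₂ = ∅ := by simp [hC₂, h]
      rw [this]; exact isCompact_empty
  filter_upwards [eventually_smoothStep_eq hC₁c (hcont.mono fun t ht => ht.1.2) hC₁σ,
    eventually_smoothStep_eq hC₂c (hcont.mono fun t ht => ht.1.2) hC₂τ] with ε hε₁ hε₂
  set A := stepForm hχ hG hc ε with hA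
  have hAc : ContinuousOn (fun t => A.toFun (e.toFun t) (e.velocity t)) (Icc 0 1) :=
    e.continuousOn_pairing A
  have hii : ∀ s t, s ∈ Icc (0 : ℝ) 1 → t ∈ Icc (0 : ℝ) 1 → IntervalIntegrable
      (fun t => A.toFun (e.toFun t) (e.velocity t)) volume s t := fun s t hs ht =>
    (hAc.mono (uIcc_subset_Icc hs ht)).intervalIntegrable
  have ha1 : a ∈ Icc (0 : ℝ) 1 := ⟨ha0, hat.trans ht₀.2⟩
  have hb0 : b ∈ Icc (0 : ℝ) 1 := ⟨ht₀.1.trans htb, hb1⟩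
  -- Where the step is locally constant along `e`, the step form pairs to zero whatever the bump
  -- does.
  have hzero : ∀ t ∈ Icc (0 : ℝ) 1, (∃ U, IsOpen U ∧ t ∈ U ∧ ∃ c, ∀ s ∈ U,
      smoothStep ε (G (e.toFun s)) = c) → A.toFun (e.toFun t) (e.velocity t) = 0 := by
    rintro t ht ⟨U, hU, htU, c, hc'⟩
    rw [hA, e.formFactor_stepForm hχ hG hc ε ht]
    have : (fun s => smoothStep ε (G (e.toFun s))) =ᶠ[𝓝 t] fun _ => c := by
      filter_upwards [hU.mem_nhds htU] with s hs using hc' s hs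
    rw [this.deriv_eq, deriv_const, mul_zero]
  have hright : ∫ t in b..1, A.toFun (e.toFun t) (e.velocity t) = 0 := by
    rw [intervalIntegral.integral_of_le hb1, integral_Ioc_eq_integral_Ioo]
    refine setIntegral_eq_zero_of_forall_eq_zero fun t ht => ?_
    have htI : t ∈ Icc (0 : ℝ) 1 := ⟨hb0.1.trans ht.1.le, ht.2.le⟩
    by_cases htδ : t < t₀ + δ
    · refine hzero t htI ⟨Ioo b 1 ∩ Iio (t₀ + δ), isOpen_Ioo.inter isOpen_Iio, ⟨ht, htδ⟩,
        (σ : ℝ) / 2, fun s hs => hε₁ s ⟨⟨⟨hs.1.1.le, le_of_lt hs.2⟩,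
          ⟨hb0.1.trans hs.1.1.le, hs.1.2.le⟩⟩, ?_⟩⟩
      have : b < 1 := ht.1.trans ht.2
      exact htb.trans_lt this
    · rw [hA, e.formFactor_stepForm hχ hG hc ε htI, hχ0 t htI (fun h => htδ h.2), zero_mul]
  have hleft : ∫ t in (0 : ℝ)..a, A.toFun (e.toFun t) (e.velocity t) = 0 := by
    rw [intervalIntegral.integral_of_le ha0, integral_Ioc_eq_integral_Ioo]
    refine setIntegral_eq_zero_of_forall_eq_zero fun t ht => ?_
    have htI : t ∈ Icc (0 : ℝ) 1 := ⟨ht.1.le, ht.2.le.trans ha1.2⟩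
    by_cases htδ : t₀ - δ < t
    · refine hzero t htI ⟨Ioo 0 a ∩ Ioi (t₀ - δ), isOpen_Ioo.inter isOpen_Ioi, ⟨ht, htδ⟩,
        (τ : ℝ) / 2, fun s hs => hε₂ s ⟨⟨⟨le_of_lt hs.2, hs.1.2.le⟩,
          ⟨hs.1.1.le, hs.1.2.le.trans ha1.2⟩⟩, ?_⟩⟩
      have : 0 < a := ht.1.trans ht.2
      exact this.trans_le hat
    · rw [hA, e.formFactor_stepForm hχ hG hc ε htI, hχ0 t htI (fun h => htδ h.1), zero_mul]
  -- Here the bump is `1`, so the integrand is an exact derivative.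
  have hmid : ∫ t in a..b, A.toFun (e.toFun t) (e.velocity t) =
      smoothStep ε (G (e.toFun b)) - smoothStep ε (G (e.toFun a)) := by
    have hsub : uIcc a b ⊆ Icc 0 1 := uIcc_subset_Icc ha1 hb0
    refine intervalIntegral.integral_eq_sub_of_hasDerivAt
      (f := fun s => smoothStep ε (G (e.toFun s))) (fun t ht => ?_) (hii a b ha1 hb0)
    have htI := hsub ht
    rw [uIcc_of_le (hat.trans htb)] at ht
    have h1 : |t - t₀| ≤ δ' := by
      rw [abs_le]
      have h2 : t₀ - δ' ≤ a := le_max_right _ _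
      have h3 : b ≤ t₀ + δ' := min_le_right _ _
      constructor <;> linarith [ht.1, ht.2]
    rw [hA, e.formFactor_stepForm hχ hG hc ε htI, hone t h1, one_mul]
    have h4 : DifferentiableAt ℝ (fun s => smoothStep ε (G (e.toFun s))) t :=
      DifferentiableAt.comp (g := smoothStep ε) t
        (((contDiff_smoothStep ε).differentiable (by simp)) _)
        (e.hasDerivAt_comp htI hG).differentiableAt
    exact h4.hasDerivAt
  have hvb : smoothStep ε (G (e.toFun b)) = (if t₀ < 1 then (σ : ℝ) else 0) / 2 := by
    split_ifs with h
    · exact hε₁ b ⟨⟨⟨le_rfl, (min_le_right _ _).trans (by linarith)⟩, hb0⟩, h⟩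
    · have : b = t₀ := le_antisymm (hb1.trans (not_lt.1 h)) htb
      rw [this, hG0, smoothStep_zero, zero_div]
  have hva : smoothStep ε (G (e.toFun a)) = (if 0 < t₀ then (τ : ℝ) else 0) / 2 := by
    split_ifs with h
    · exact hε₂ a ⟨⟨⟨le_trans (by linarith) (le_max_right _ _), le_rfl⟩, ha1⟩, h⟩
    · have : a = t₀ := le_antisymm hat ((not_lt.1 h).trans ha0)
      rw [this, hG0, smoothStep_zero, zero_div]
  rw [Edge.formFactor, ← intervalIntegral.integral_add_adjacent_intervals
    (hii 0 b (by simp) hb0) (hii b 1 hb0 (by simp)), hright, add_zero,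
    ← intervalIntegral.integral_add_adjacent_intervals (hii 0 a (by simp) ha1) (hii a b ha1 hb0),
    hleft, zero_add, hmid, hvb, hva]
  ring

end EdgeLimit

/-! ### Linear relations between edges -/

section EdgeSum

variable {d : ℕ} {M : Type*} [TopologicalSpace M] [ChartedSpace (Model d) M]
  [IsManifold (𝓡 (d + 1)) ω M] [T2Space M]

theorem exists_smooth_bump {p : M} {U : Set M} (hU : U ∈ 𝓝 p) :
    ∃ χ : M → ℝ, ContMDiff (𝓡 (d + 1)) 𝓘(ℝ, ℝ) ∞ χ ∧ HasCompactSupport χ ∧ tsupport χ ⊆ U ∧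
      χ =ᶠ[𝓝 p] 1 := by
  have : IsManifold (𝓡 (d + 1)) ∞ M := isManifold_of_le_omega M ∞
  obtain ⟨f, -, hf⟩ := (SmoothBumpFunction.nhds_basis_tsupport (I := 𝓡 (d + 1)) p).mem_iff.1 hU
  exact ⟨f, f.contMDiff, f.hasCompactSupport, hf, f.eventuallyEq_one⟩

/-- An analytic germ has a global smooth representative. -/
theorem exists_contMDiff_eventuallyEq {φ : M → ℝ} {p : M}
    (hφ : ContMDiffAt (𝓡 (d + 1)) 𝓘(ℝ, ℝ) ω φ p) :
    ∃ G : M → ℝ, ContMDiff (𝓡 (d + 1)) 𝓘(ℝ, ℝ) ∞ G ∧ G =ᶠ[𝓝 p] φ := by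
  obtain ⟨χ, hχ, -, hsub, h1⟩ := exists_smooth_bump (d := d)
    ((contMDiffAt_iff_contMDiffAt_nhds (n := ω) (by simp)).1 hφ)
  refine ⟨fun x => χ x * φ x, contMDiff_of_tsupport fun x hx => ?_, ?_⟩
  · have hx' : x ∈ tsupport χ := tsupport_mul_subset_left hx
    exact (hχ x).mul ((hsub hx').of_le (by simp))
  · filter_upwards [h1] with x hx
    rw [hx, Pi.one_apply, one_mul]

variable (g : Bundle.RiemannianMetric (fun x : M => TangentSpace (𝓡 (d + 1)) x))

/-- The number `a` is the contribution of the point without the weight of `S`. The neighbourhood `U`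
excludes distant stretches of `e` and is fixed before the bump `χ`, so that one bump can serve
several edges. -/
theorem Edge.exists_formFactor_stepForm_eq (e : Edge d M) (S : Surface d M) {u : Fin d → ℝ}
    (hu : u ∈ cube d) {φ : M → ℝ} (hφ : S.IsDefiningFunction u φ) {G : M → ℝ}
    (hG : ContMDiff (𝓡 (d + 1)) 𝓘(ℝ, ℝ) ∞ G) (hGφ : G =ᶠ[𝓝 (S.toFun u)] φ) :
    ∃ a : ℝ, intersectionAt g e S (S.toFun u) = S.density g u * a ∧
      ∃ U ∈ 𝓝 (S.toFun u), ∀ (χ : M → ℝ) (hχ : ContMDiff (𝓡 (d + 1)) 𝓘(ℝ, ℝ) ∞ χ)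
        (hc : HasCompactSupport χ), tsupport χ ⊆ U → χ =ᶠ[𝓝 (S.toFun u)] 1 →
        ∀ᶠ ε in 𝓝[>] (0 : ℝ), e.formFactor (stepForm hχ hG hc ε) = a := by
  by_cases hex : ∃ t ∈ Icc (0 : ℝ) 1, e.toFun t = S.toFun u
  · obtain ⟨t, ht, het⟩ := hex
    have hφe : ContMDiffAt (𝓡 (d + 1)) 𝓘(ℝ, ℝ) ω φ (e.toFun t) := het ▸ hφ.1
    obtain ⟨σ, hσ⟩ := e.exists_sign_outgoing ht hφe
    obtain ⟨τ, hτ⟩ := e.exists_sign_incoming ht hφe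
    have hside1 : S.side u (fun s => e.toFun (t + s)) = σ := by
      rw [Surface.side_eq_sideOf hu hφ (het ▸ e.tendsto_outgoing ht)]
      exact sideOf_eq_of_eventually_sign hσ
    have hside2 : S.side u (fun s => e.toFun (t - s)) = τ := by
      rw [Surface.side_eq_sideOf hu hφ (het ▸ e.tendsto_incoming ht)]
      exact sideOf_eq_of_eventually_sign hτ
    refine ⟨1 / 2 * ((if t < 1 then (σ : ℝ) else 0) - (if 0 < t then (τ : ℝ) else 0)), ?_, ?_⟩
    · rw [intersectionAt_eq g e S ht hu het rfl, localIntersection, hside1, hside2, mul_assoc]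
    · rw [← het] at hGφ
      have h1 : ∀ᶠ s in 𝓝[>] (0 : ℝ), SignType.sign (G (e.toFun (t + s))) = σ := by
        filter_upwards [hσ, (e.tendsto_outgoing ht).eventually hGφ] with s hs1 hs2
        rw [hs2, hs1]
      have h2 : ∀ᶠ s in 𝓝[>] (0 : ℝ), SignType.sign (G (e.toFun (t - s))) = τ := by
        filter_upwards [hτ, (e.tendsto_incoming ht).eventually hGφ] with s hs1 hs2
        rw [hs2, hs1]
      obtain ⟨b, hb, hsub⟩ := mem_nhdsGT_iff_exists_Ioc_subset.1 (h1.and h2)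
      have hb' : 0 < b := hb
      have hU : ∀ᶠ x in 𝓝 (S.toFun u), ∀ s ∈ Icc (0 : ℝ) 1, e.toFun s = x →
          s ∈ Ioo (t - b) (t + b) := by
        refine eventually_forall_mem_of_isCompact isCompact_Icc e.continuousOn fun s hs hsp => ?_
        rw [e.injOn hs ht (hsp.trans het.symm)]
        exact Ioo_mem_nhds (by linarith) (by linarith)
      refine ⟨_, hU, fun χ hχ hc hsupp hone => ?_⟩
      refine e.eventually_formFactor_stepForm hχ hG hc ht hb' (fun s hs => ?_) (fun s hs => ?_)
        ?_ (fun s hs hsn => ?_) (het ▸ hone)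
      · have := (hsub (show s - t ∈ Ioc 0 b from ⟨by linarith [hs.1], by linarith [hs.2]⟩)).1
        rwa [add_sub_cancel] at this
      · have := (hsub (show t - s ∈ Ioc 0 b from ⟨by linarith [hs.2], by linarith [hs.1]⟩)).2
        rwa [sub_sub_cancel] at this
      · rw [hGφ.self_of_nhds, het]
        exact hφ.2.1.self_of_nhds
      · by_contra hne
        exact hsn (hsupp (subset_tsupport _ hne) s hs rfl)
  · refine ⟨0, ?_, ?_⟩
    · rw [mul_zero]
      by_contra hne
      obtain ⟨t, ht, v, hv, het, -, -⟩ := exists_of_intersectionAt_ne_zero g hne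
      exact hex ⟨t, ht, het⟩
    · have hU : ∀ᶠ x in 𝓝 (S.toFun u), ∀ s ∈ Icc (0 : ℝ) 1, e.toFun s = x →
          s ∈ (∅ : Set ℝ) :=
        eventually_forall_mem_of_isCompact isCompact_Icc e.continuousOn
          fun s hs hsp => absurd ⟨s, hs, hsp⟩ hex
      refine ⟨_, hU, fun χ hχ hc hsupp hone => Eventually.of_forall fun ε => ?_⟩
      refine e.formFactor_stepForm_eq_zero hχ hG hc ε fun t ht => ?_
      by_contra hne
      exact hsupp (subset_tsupport _ hne) t ht rfl

/-- Linear relations between form factors of edges hold for the local intersection numbers. -/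
theorem sum_intersectionAt_edge_eq_zero (c : Edge d M →₀ ℝ)
    (h : (c.sum fun e a => a • e.formFactor) = 0) (S : Surface d M) (p : M) :
    (c.sum fun e a => a * intersectionAt g e S p) = 0 := by
  by_cases hex : ∃ u ∈ cube d, S.toFun u = p
  swap
  · refine Finset.sum_eq_zero fun e _ => mul_eq_zero_of_right _ ?_
    by_contra hne
    obtain ⟨t, ht, v, hv, -, hSv, -⟩ := exists_of_intersectionAt_ne_zero g hne
    exact hex ⟨v, hv, hSv⟩
  obtain ⟨u, hu, rfl⟩ := hex
  obtain ⟨φ, hφ⟩ := S.exists_isDefiningFunction hu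
  obtain ⟨G, hG, hGφ⟩ := exists_contMDiff_eventuallyEq hφ.1
  -- Only finitely many edges occur, so one bump in the intersection of the neighbourhoods and one
  -- small `ε` work for all of them.
  choose a ha U hU hlim using fun e : Edge d M =>
    e.exists_formFactor_stepForm_eq g S hu hφ hG hGφ
  obtain ⟨χ, hχ, hc, hsupp, hone⟩ := exists_smooth_bump (d := d)
    ((Filter.biInter_finset_mem c.support).2 fun e _ => hU e)
  have hev : ∀ᶠ ε in 𝓝[>] (0 : ℝ), ∀ e ∈ c.support,
      e.formFactor (stepForm hχ hG hc ε) = a e :=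
    (Filter.eventually_all_finset c.support).2 fun e he =>
      hlim e χ hχ hc (hsupp.trans (biInter_subset_of_mem he)) hone
  obtain ⟨ε, hε⟩ := hev.exists
  have h1 := congrFun h (stepForm hχ hG hc ε)
  rw [Finsupp.sum, Finset.sum_apply] at h1
  calc (c.sum fun e a => a * intersectionAt g e S (S.toFun u))
      = S.density g u * ∑ e ∈ c.support, (c e • e.formFactor) (stepForm hχ hG hc ε) := by
        rw [Finsupp.sum, Finset.mul_sum]
        refine Finset.sum_congr rfl fun e he => ?_
        rw [ha, Pi.smul_apply, hε e he, smul_eq_mul]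
        ring
    _ = 0 := by rw [h1]; simp

theorem finsum_mul_intersectionAt (c : ℝ) (e : Edge d M) (S : Surface d M) :
    c * orientedIntersection g e S = ∑ᶠ p, c * intersectionAt g e S p := by
  rw [orientedIntersection_eq_finsum]
  exact smul_finsum c _

theorem sum_orientedIntersection_edge_eq_zero (c : Edge d M →₀ ℝ)
    (h : (c.sum fun e a => a • e.formFactor) = 0) (S : Surface d M) :
    (c.sum fun e a => a * orientedIntersection g e S) = 0 := by
  simp only [Finsupp.sum, finsum_mul_intersectionAt]
  rw [← finsum_sum_comm]
  · rw [← finsum_zero (α := M)]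
    exact finsum_congr fun p => sum_intersectionAt_edge_eq_zero g c h S p
  · intro e _
    exact (finite_support_intersectionAt g e S).subset
      (Function.support_mul_subset_right _ _)

end EdgeSum

/-! ### Smoothness of the Levi-Civita symbol and of the determinant -/

section LeviCivitaSmooth

variable {d : ℕ}

theorem contDiff_leviCivita {n : WithTop ℕ∞} :
    ContDiff ℝ n (fun p : Model d × (Fin d → Model d) => leviCivita p.1 p.2) := by
  have h : ∀ i j : Fin (d + 1), ContDiff ℝ n (fun p : Model d × (Fin d → Model d) =>
      (Fin.cons p.1 p.2 : Fin (d + 1) → Model d) i j) := by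
    intro i j
    refine Fin.cases ?_ (fun k => ?_) i
    · simp only [Fin.cons_zero]
      exact (EuclideanSpace.proj (𝕜 := ℝ) j).contDiff.comp contDiff_fst
    · simp only [Fin.cons_succ]
      exact (EuclideanSpace.proj (𝕜 := ℝ) j).contDiff.comp (contDiff_pi.1 contDiff_snd k)
  simp only [leviCivita, Matrix.det_apply', Matrix.of_apply]
  refine ContDiff.sum fun σ _ => contDiff_const.mul ?_
  exact contDiff_prod fun i _ => h (σ i) i

/-- By `leviCivita_map`, the determinant is a quotient of Levi-Civita values with fixed nonzero
denominator, hence as smooth as the symbol itself. -/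
theorem contDiff_det {n : WithTop ℕ∞} :
    ContDiff ℝ n (fun A : Model d →L[ℝ] Model d => A.det) := by
  obtain ⟨w, hw⟩ := exists_leviCivita_ne_zero_of_ne_zero
    (v := (EuclideanSpace.single 0 1 : Model d)) (by simp)
  have h : (fun A : Model d →L[ℝ] Model d => A.det) = fun A =>
      leviCivita (A (EuclideanSpace.single 0 1)) (fun i => A (w i)) /
        leviCivita (EuclideanSpace.single 0 1) w := by
    ext A
    rw [leviCivita_map, mul_div_cancel_right₀ _ hw]
  rw [h]
  have h2 : ContDiff ℝ n (fun A : Model d →L[ℝ] Model d =>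
      (A (EuclideanSpace.single 0 1), fun i => A (w i))) := by
    refine ContDiff.prodMk ?_ (contDiff_pi.2 fun i => ?_)
    · exact contDiff_id.clm_apply contDiff_const
    · exact contDiff_id.clm_apply contDiff_const
  exact (contDiff_leviCivita.comp h2).div_const _

end LeviCivitaSmooth

/-! ### Vector densities and localization of surface relations -/

section Density

variable {d : ℕ} {M : Type*} [TopologicalSpace M] [ChartedSpace (Model d) M]
  [IsManifold (𝓡 (d + 1)) ω M]

/-- The coordinate tangent vectors of a surface in the chart at `x₀`. -/
noncomputable def Surface.frame (S : Surface d M) (x₀ : M) (u : Fin d → ℝ) (i : Fin d) : Model d :=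
  fderiv ℝ (fun v => extChartAt (𝓡 (d + 1)) x₀ (S.toFun v)) u (Pi.single i 1)

theorem Surface.frame_eq (S : Surface d M) {u : Fin d → ℝ} (hu : u ∈ cube d) {x₀ : M}
    (hx : S.toFun u ∈ (chartAt (Model d) x₀).source) :
    S.frame x₀ u = fun i => tangentCoordChange (𝓡 (d + 1)) (S.toFun u) x₀ (S.toFun u)
      (S.partialDeriv u i) := by
  ext1 i
  rw [Surface.frame, (hasFDerivAt_extChartAt_comp (S.mdifferentiableAt hu) hx).fderiv]
  rfl

theorem Surface.continuousAt_frame (S : Surface d M) {u : Fin d → ℝ} (hu : u ∈ cube d) {x₀ : M}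
    (hx : S.toFun u ∈ (chartAt (Model d) x₀).source) : ContinuousAt (S.frame x₀) u := by
  have h4 : ContDiffAt ℝ ω (fun v => extChartAt (𝓡 (d + 1)) x₀ (S.toFun v)) u :=
    contDiffAt_extChartAt_comp (S.analytic u hu) hx
  refine continuousAt_pi.2 fun i => ?_
  exact ((h4.fderiv_right (m := 0) (by simp)).clm_apply contDiffAt_const).continuousAt

/-- The surface element of `S`, contracted with a vector density, in the chart at `x₀`. -/
theorem Surface.leviCivita_eq (hM : IsOrientedAtlas d M) (S : Surface d M) {u : Fin d → ℝ}
    (hu : u ∈ cube d) {x₀ : M} (hx : S.toFun u ∈ (chartAt (Model d) x₀).source) (a : Model d) :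
    leviCivita a (S.partialDeriv u) =
      leviCivita (|(tangentCoordChange (𝓡 (d + 1)) (S.toFun u) x₀ (S.toFun u)).det|⁻¹ •
        tangentCoordChange (𝓡 (d + 1)) (S.toFun u) x₀ (S.toFun u) a) (S.frame x₀ u) := by
  -- The surface element scales by the determinant and the density by the inverse of its absolute
  -- value. They cancel because the atlas is oriented.
  have hpos := hM.det_tangentCoordChange_pos (mem_chart_source (Model d) (S.toFun u)) hx
  rw [← leviCivitaLeft_apply (S.frame x₀ u), map_smul, leviCivitaLeft_apply, S.frame_eq hu hx]
  have := leviCivita_map (tangentCoordChange (𝓡 (d + 1)) (S.toFun u) x₀ (S.toFun u)) a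
    (S.partialDeriv u)
  rw [smul_eq_mul]
  refine Eq.trans ?_ (congrArg _ this.symm)
  rw [abs_of_pos hpos, inv_mul_cancel_left₀ hpos.ne']

/-- The components at `S u` refer to the chart at `S u`, which varies with `u` without any
continuity. Passing to the fixed chart at `S u₀` makes both factors continuous. -/
theorem Surface.continuousOn_pairing (hM : IsOrientedAtlas d M) (S : Surface d M)
    (E : TestVectorDensity d M) :
    ContinuousOn (fun u => leviCivita (E.toFun (S.toFun u)) (S.partialDeriv u)) (cube d) := by
  intro u₀ hu₀
  obtain ⟨D, hD⟩ : ∃ D : M → Model d, D = fun x =>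
      |(tangentCoordChange (𝓡 (d + 1)) x (S.toFun u₀) x).det|⁻¹ •
        tangentCoordChange (𝓡 (d + 1)) x (S.toFun u₀) x (E.toFun x) := ⟨_, rfl⟩
  have hsrc : ∀ᶠ u in 𝓝 u₀, S.toFun u ∈ (chartAt (Model d) (S.toFun u₀)).source :=
    (S.analytic u₀ hu₀).continuousAt.eventually (chart_source_mem_nhds _ _)
  have h1 : ContinuousAt D (S.toFun u₀) := by
    rw [hD]
    exact (E.smooth (S.toFun u₀)).continuousOn.continuousAt (chart_source_mem_nhds _ _)
  have h2 : ContinuousAt (fun u => leviCivita (D (S.toFun u)) (S.frame (S.toFun u₀) u)) u₀ := by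
    have h3 : ContinuousAt (fun u => (D (S.toFun u), S.frame (S.toFun u₀) u)) u₀ :=
      (ContinuousAt.comp (f := S.toFun) h1 (S.analytic u₀ hu₀).continuousAt).prodMk
        (S.continuousAt_frame hu₀ (mem_chart_source (Model d) _))
    exact ((contDiff_leviCivita (n := 0)).continuous.tendsto _).comp h3
  have h4 : ∀ u ∈ cube d, S.toFun u ∈ (chartAt (Model d) (S.toFun u₀)).source →
      leviCivita (E.toFun (S.toFun u)) (S.partialDeriv u) =
        leviCivita (D (S.toFun u)) (S.frame (S.toFun u₀) u) := fun u hu hs => by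
    rw [hD]
    exact S.leviCivita_eq hM hu hs _
  refine h2.continuousWithinAt.congr_of_eventuallyEq ?_ (h4 u₀ hu₀ (mem_chart_source _ _))
  filter_upwards [nhdsWithin_le_nhds hsrc, self_mem_nhdsWithin] with u hu huc
  exact h4 u huc hu

theorem det_tangentCoordChange_mul {x y z w : M} (hx : w ∈ (chartAt (Model d) x).source)
    (hy : w ∈ (chartAt (Model d) y).source) (hz : w ∈ (chartAt (Model d) z).source) :
    (tangentCoordChange (𝓡 (d + 1)) y z w).det * (tangentCoordChange (𝓡 (d + 1)) x y w).det =
      (tangentCoordChange (𝓡 (d + 1)) x z w).det := by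
  have : IsManifold (𝓡 (d + 1)) 1 M := isManifold_of_le_omega M 1
  have h1 : (tangentCoordChange (𝓡 (d + 1)) y z w).comp (tangentCoordChange (𝓡 (d + 1)) x y w) =
      tangentCoordChange (𝓡 (d + 1)) x z w := by
    ext1 v
    exact tangentCoordChange_comp (by simp only [extChartAt_source]; exact ⟨⟨hx, hy⟩, hz⟩)
  rw [← h1]
  exact (LinearMap.det_comp _ _).symm

theorem contMDiffAt_tangentCoordChange {x y z : M} (hx : z ∈ (chartAt (Model d) x).source)
    (hy : z ∈ (chartAt (Model d) y).source) :
    ContMDiffAt (𝓡 (d + 1)) 𝓘(ℝ, Model d →L[ℝ] Model d) ∞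
      (fun w => tangentCoordChange (𝓡 (d + 1)) x y w) z := by
  have : IsManifold (𝓡 (d + 1)) ∞ M := isManifold_of_le_omega M ∞
  have h' : extChartAt (𝓡 (d + 1)) x z ∈
      ((extChartAt (𝓡 (d + 1)) x).symm ≫ (extChartAt (𝓡 (d + 1)) y)).source := by
    rw [PartialEquiv.trans_source'', PartialEquiv.symm_symm, PartialEquiv.symm_target]
    exact mem_image_of_mem _ (by simp only [extChartAt_source]; exact ⟨hx, hy⟩)
  have h1 := contDiffWithinAt_ext_coord_change (I := 𝓡 (d + 1)) (n := ω) y x h'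
  rw [ModelWithCorners.range_eq_univ, contDiffWithinAt_univ] at h1
  have h2 : ContDiffAt ℝ ∞ (fderiv ℝ (extChartAt (𝓡 (d + 1)) y ∘ (extChartAt (𝓡 (d + 1)) x).symm))
      (extChartAt (𝓡 (d + 1)) x z) := h1.fderiv_right (by simp)
  have h3 : ContMDiffAt (𝓡 (d + 1)) 𝓘(ℝ, Model d) ∞ (extChartAt (𝓡 (d + 1)) x) z :=
    contMDiffAt_extChartAt' hx
  have h4 := ContMDiffAt.comp (g := fderiv ℝ (extChartAt (𝓡 (d + 1)) y ∘
    (extChartAt (𝓡 (d + 1)) x).symm)) (f := extChartAt (𝓡 (d + 1)) x) z h2.contMDiffAt h3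
  refine h4.congr_of_eventuallyEq (Eventually.of_forall fun w => ?_)
  simp only [tangentCoordChange_def, ModelWithCorners.range_eq_univ, fderivWithin_univ]
  rfl

open Classical in
/-- The components of the vector density that is `f v` in the chart at `x₀`. -/
noncomputable def chartDensity (x₀ : M) (f : Model d → ℝ) (v : Model d) (x : M) : Model d :=
  if x ∈ (chartAt (Model d) x₀).source then
    |(tangentCoordChange (𝓡 (d + 1)) x x₀ x).det| •
      tangentCoordChange (𝓡 (d + 1)) x₀ x x (f (extChartAt (𝓡 (d + 1)) x₀ x) • v)
  else 0

/-- The cocycle identity for determinants removes the chart at the moving point `x`. What remains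
depends smoothly on `x`, which is the smoothness required of a test density. -/
theorem chartDensity_component (hM : IsOrientedAtlas d M) {x₀ x₁ x : M} (f : Model d → ℝ)
    (v : Model d) (hx₀ : x ∈ (chartAt (Model d) x₀).source)
    (hx₁ : x ∈ (chartAt (Model d) x₁).source) :
    |(tangentCoordChange (𝓡 (d + 1)) x x₁ x).det|⁻¹ •
        tangentCoordChange (𝓡 (d + 1)) x x₁ x (chartDensity x₀ f v x) =
      (tangentCoordChange (𝓡 (d + 1)) x₀ x₁ x).det⁻¹ •
        tangentCoordChange (𝓡 (d + 1)) x₀ x₁ x (f (extChartAt (𝓡 (d + 1)) x₀ x) • v) := by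
  have : IsManifold (𝓡 (d + 1)) 1 M := isManifold_of_le_omega M 1
  have hx := mem_chart_source (Model d) x
  have h1 := hM.det_tangentCoordChange_pos hx hx₁
  have h2 := hM.det_tangentCoordChange_pos hx hx₀
  have h3 := hM.det_tangentCoordChange_pos hx₀ hx₁
  have h4 := det_tangentCoordChange_mul hx hx₀ hx₁
  rw [chartDensity, if_pos hx₀, map_smul, tangentCoordChange_comp
    (by simp only [extChartAt_source]; exact ⟨⟨hx₀, hx⟩, hx₁⟩), smul_smul, abs_of_pos h1,
    abs_of_pos h2, ← h4]
  congr 1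
  field_simp

variable [T2Space M]

/-- The test vector density that is `f v` in the chart at `x₀`. -/
noncomputable def TestVectorDensity.ofChart (hM : IsOrientedAtlas d M) (x₀ : M) {f : Model d → ℝ}
    (hf : ContDiff ℝ ∞ f) (hc : HasCompactSupport f)
    (hsub : tsupport f ⊆ (extChartAt (𝓡 (d + 1)) x₀).target) (v : Model d) :
    TestVectorDensity d M := by
  have hK : IsCompact ((extChartAt (𝓡 (d + 1)) x₀).symm '' tsupport f) :=
    IsCompact.image_of_continuousOn hc ((continuousOn_extChartAt_symm x₀).mono hsub)
  -- Vanishing off this compact, hence closed, set gives smoothness away from the chart domain as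
  -- well as compact support.
  have hzero : ∀ x ∉ (extChartAt (𝓡 (d + 1)) x₀).symm '' tsupport f,
      chartDensity x₀ f v x = 0 := by
    intro x hx
    by_cases hxs : x ∈ (chartAt (Model d) x₀).source
    · have hx' : x ∈ (extChartAt (𝓡 (d + 1)) x₀).source := by rwa [extChartAt_source]
      have : f (extChartAt (𝓡 (d + 1)) x₀ x) = 0 := by
        by_contra hne
        exact hx ⟨_, subset_tsupport _ hne, (extChartAt (𝓡 (d + 1)) x₀).left_inv hx'⟩
      rw [chartDensity, if_pos hxs, this, zero_smul, map_zero, smul_zero]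
    · rw [chartDensity, if_neg hxs]
  refine ⟨chartDensity x₀ f v, fun x₁ x hx => ContMDiffAt.contMDiffWithinAt ?_, ?_⟩
  · by_cases hxs : x ∈ (chartAt (Model d) x₀).source
    · have h1 := contMDiffAt_tangentCoordChange (z := x) hxs hx
      have h2 : ContMDiffAt (𝓡 (d + 1)) 𝓘(ℝ, ℝ) ∞
          (fun x => (tangentCoordChange (𝓡 (d + 1)) x₀ x₁ x).det⁻¹) x := by
        have h3 : ContDiffAt ℝ ∞ (fun A : Model d →L[ℝ] Model d => A.det⁻¹)
            (tangentCoordChange (𝓡 (d + 1)) x₀ x₁ x) :=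
          contDiff_det.contDiffAt.inv (hM.det_tangentCoordChange_pos hxs hx).ne'
        exact ContMDiffAt.comp (g := fun A : Model d →L[ℝ] Model d => A.det⁻¹) x
          h3.contMDiffAt h1
      have h4 : ContMDiffAt (𝓡 (d + 1)) 𝓘(ℝ, Model d) ∞
          (fun x => f (extChartAt (𝓡 (d + 1)) x₀ x) • v) x := by
        have : IsManifold (𝓡 (d + 1)) ∞ M := isManifold_of_le_omega M ∞
        have h5 : ContDiff ℝ ∞ (fun z => f z • v) := hf.smul contDiff_const
        exact ContMDiffAt.comp (g := fun z => f z • v) x h5.contDiffAt.contMDiffAt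
          (contMDiffAt_extChartAt' hxs)
      refine (h2.smul (h1.clm_apply h4)).congr_of_eventuallyEq ?_
      filter_upwards [(chartAt (Model d) x₀).open_source.mem_nhds hxs,
        (chartAt (Model d) x₁).open_source.mem_nhds hx] with y hy₀ hy₁
      exact chartDensity_component hM f v hy₀ hy₁
    · have hxK : x ∉ (extChartAt (𝓡 (d + 1)) x₀).symm '' tsupport f := by
        rintro ⟨z, hz, rfl⟩
        apply hxs
        have := (extChartAt (𝓡 (d + 1)) x₀).map_target (hsub hz)
        rwa [extChartAt_source] at this
      refine (contMDiffAt_const (c := (0 : Model d))).congr_of_eventuallyEq ?_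
      filter_upwards [hK.isClosed.isOpen_compl.mem_nhds hxK] with y hy
      rw [hzero y hy]
      simp
  · refine hK.of_isClosed_subset isClosed_closure (closure_minimal (fun x hx => ?_) hK.isClosed)
    by_contra hcon
    exact hx (hzero x hcon)

open Classical in
theorem Surface.pairing_ofChart (hM : IsOrientedAtlas d M) (S : Surface d M) (x₀ : M)
    {f : Model d → ℝ} (hf : ContDiff ℝ ∞ f) (hc : HasCompactSupport f)
    (hsub : tsupport f ⊆ (extChartAt (𝓡 (d + 1)) x₀).target) (v : Model d) {u : Fin d → ℝ}
    (hu : u ∈ cube d) :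
    leviCivita ((TestVectorDensity.ofChart hM x₀ hf hc hsub v).toFun (S.toFun u))
      (S.partialDeriv u) = if S.toFun u ∈ (chartAt (Model d) x₀).source then
        f (extChartAt (𝓡 (d + 1)) x₀ (S.toFun u)) * leviCivita v (S.frame x₀ u) else 0 := by
  change leviCivita (chartDensity x₀ f v (S.toFun u)) (S.partialDeriv u) = _
  split_ifs with h
  · have h1 : tangentCoordChange (𝓡 (d + 1)) x₀ x₀ (S.toFun u) =
        ContinuousLinearMap.id ℝ (Model d) := by
      have : IsManifold (𝓡 (d + 1)) 1 M := isManifold_of_le_omega M 1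
      ext1 v
      exact tangentCoordChange_self (by rwa [extChartAt_source])
    rw [S.leviCivita_eq hM hu h, chartDensity_component hM f v h h, h1]
    rw [← leviCivitaLeft_apply (S.frame x₀ u)]
    simp [ContinuousLinearMap.det]
  · rw [chartDensity, if_neg h]
    exact map_zero (leviCivitaLeft (S.partialDeriv u))

theorem Surface.integrableOn_pairing (hM : IsOrientedAtlas d M) (S : Surface d M)
    (E : TestVectorDensity d M) :
    IntegrableOn (fun u => leviCivita (E.toFun (S.toFun u)) (S.partialDeriv u)) (cube d) :=
  (S.continuousOn_pairing hM E).integrableOn_compact isCompact_cube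

theorem Surface.isClosed_cube_inter_preimage (S : Surface d M) {Z : Set M} (hZ : IsClosed Z) :
    IsClosed (cube d ∩ S.toFun ⁻¹' Z) :=
  S.continuousOn.preimage_isClosed_of_isClosed isCompact_cube.isClosed hZ

/-- A linear relation between form factors of surfaces holds for the parts of the surfaces in
every compact subset of a chart domain. -/
theorem sum_setIntegral_surface_eq_zero (hM : IsOrientedAtlas d M) (c : Surface d M →₀ ℝ)
    (h : (c.sum fun S a => a • S.formFactor) = 0) (x₀ : M) {Z : Set M} (hZ : IsCompact Z)
    (hZs : Z ⊆ (chartAt (Model d) x₀).source) (v : Model d) :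
    (c.sum fun S a => a * ∫ u in cube d ∩ S.toFun ⁻¹' Z, leviCivita v (S.frame x₀ u)) = 0 := by
  classical
  have hZs' : Z ⊆ (extChartAt (𝓡 (d + 1)) x₀).source := by rwa [extChartAt_source]
  set Y := extChartAt (𝓡 (d + 1)) x₀ '' Z with hY
  have hYc : IsCompact Y := hZ.image_of_continuousOn ((continuousOn_extChartAt x₀).mono hZs')
  have hYt : Y ⊆ (extChartAt (𝓡 (d + 1)) x₀).target := by
    rintro _ ⟨x, hx, rfl⟩
    exact (extChartAt (𝓡 (d + 1)) x₀).map_source (hZs' hx)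
  -- The cutoff `f` below has values in `[0,1]`, equals `1` exactly on `Y` and vanishes exactly off
  -- `W`.
  obtain ⟨W, hWo, hYW, hWt, hWc⟩ := exists_open_between_and_isCompact_closure hYc
    (isOpen_extChartAt_target x₀) hYt
  obtain ⟨f, hf, hfr, hf0, hf1⟩ := exists_contMDiff_zero_iff_one_iff_of_isClosed (𝓘(ℝ, Model d))
    (n := (⊤ : ℕ∞)) hWo.isClosed_compl hYc.isClosed
    (disjoint_compl_left_iff_subset.2 hYW)
  have hfs : ContDiff ℝ ∞ f := hf.contDiff
  have hsupp : ∀ n : ℕ, tsupport (fun z => f z ^ (n + 1)) ⊆ closure W := by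
    intro n
    refine closure_mono fun z hz => ?_
    by_contra hzW
    apply hz
    simp [(hf0 z).1 hzW]
  have hcs : ∀ n : ℕ, HasCompactSupport (fun z => f z ^ (n + 1)) := fun n =>
    hWc.of_isClosed_subset isClosed_closure (hsupp n)
  -- The powers of `f` decrease to the indicator of `Y`, and the first one dominates. The exponent
  -- `n + 1` avoids `f ^ 0 = 1`, which would not be supported in the chart.
  let E : ℕ → TestVectorDensity d M := fun n =>
    TestVectorDensity.ofChart hM x₀ (hfs.pow (n + 1)) (hcs n) ((hsupp n).trans hWt) v
  have hE : ∀ (S : Surface d M) (n : ℕ), ∀ u ∈ cube d,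
      leviCivita ((E n).toFun (S.toFun u)) (S.partialDeriv u) =
        if S.toFun u ∈ (chartAt (Model d) x₀).source then
        f (extChartAt (𝓡 (d + 1)) x₀ (S.toFun u)) ^ (n + 1) * leviCivita v (S.frame x₀ u) else 0 :=
    fun S n u hu => S.pairing_ofChart hM x₀ _ _ _ v hu
  have hfI : ∀ z, 0 ≤ f z ∧ f z ≤ 1 := fun z => hfr (mem_range_self z)
  have hlim : ∀ S : Surface d M, Tendsto (fun n => S.formFactor (E n)) atTop
      (𝓝 (∫ u in cube d ∩ S.toFun ⁻¹' Z, leviCivita v (S.frame x₀ u))) := by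
    intro S
    have hmeas := (S.isClosed_cube_inter_preimage hZ.isClosed).measurableSet
    have hcm : MeasurableSet (cube d) := isCompact_cube.isClosed.measurableSet
    have hrw : ∫ u in cube d ∩ S.toFun ⁻¹' Z, leviCivita v (S.frame x₀ u) =
        ∫ u in cube d, (cube d ∩ S.toFun ⁻¹' Z).indicator
          (fun u => leviCivita v (S.frame x₀ u)) u := by
      rw [setIntegral_indicator hmeas, ← inter_assoc, inter_self]
    rw [hrw]
    refine tendsto_integral_of_dominated_convergence
      (fun u => ‖leviCivita ((E 0).toFun (S.toFun u)) (S.partialDeriv u)‖)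
      (fun n => (S.integrableOn_pairing hM (E n)).aestronglyMeasurable)
      (S.integrableOn_pairing hM (E 0)).norm (fun n => ?_) ?_
    · refine (ae_restrict_iff' hcm).2 (Eventually.of_forall fun u hu => ?_)
      rw [hE S n u hu, hE S 0 u hu]
      split_ifs with hs
      · rw [norm_mul, norm_mul]
        refine mul_le_mul_of_nonneg_right ?_ (norm_nonneg _)
        obtain ⟨h0, h1⟩ := hfI (extChartAt (𝓡 (d + 1)) x₀ (S.toFun u))
        rw [Real.norm_of_nonneg (by positivity), Real.norm_of_nonneg (by positivity)]
        exact pow_le_pow_of_le_one h0 h1 (by omega)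
      · simp
    · refine (ae_restrict_iff' hcm).2 (Eventually.of_forall fun u hu => ?_)
      simp only [hE S _ u hu]
      by_cases hs : S.toFun u ∈ (chartAt (Model d) x₀).source
      · simp only [if_pos hs]
        by_cases hz : S.toFun u ∈ Z
        · rw [indicator_of_mem (show u ∈ cube d ∩ S.toFun ⁻¹' Z from ⟨hu, hz⟩)]
          have : f (extChartAt (𝓡 (d + 1)) x₀ (S.toFun u)) = 1 :=
            (hf1 _).1 (mem_image_of_mem _ hz)
          simp only [this, one_pow, one_mul]
          exact tendsto_const_nhds
        · rw [indicator_of_notMem (show u ∉ cube d ∩ S.toFun ⁻¹' Z from fun h => hz h.2)]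
          have hne : f (extChartAt (𝓡 (d + 1)) x₀ (S.toFun u)) ≠ 1 := by
            intro h1
            obtain ⟨x, hx, hxe⟩ := (hf1 _).2 h1
            have hs' : S.toFun u ∈ (extChartAt (𝓡 (d + 1)) x₀).source := by
              rwa [extChartAt_source]
            rw [(extChartAt (𝓡 (d + 1)) x₀).injOn (hZs' hx) hs' hxe] at hx
            exact hz hx
          obtain ⟨h0, h1⟩ := hfI (extChartAt (𝓡 (d + 1)) x₀ (S.toFun u))
          have h2 := (tendsto_pow_atTop_nhds_zero_of_lt_one h0 (lt_of_le_of_ne h1 hne)).comp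
            (tendsto_add_atTop_nat 1)
          simpa using h2.mul_const (leviCivita v (S.frame x₀ u))
      · simp only [if_neg hs]
        rw [indicator_of_notMem (show u ∉ cube d ∩ S.toFun ⁻¹' Z from fun h => hs (hZs h.2))]
        exact tendsto_const_nhds
  have h1 : Tendsto (fun n => ∑ S ∈ c.support, c S * S.formFactor (E n)) atTop
      (𝓝 (∑ S ∈ c.support, c S * ∫ u in cube d ∩ S.toFun ⁻¹' Z, leviCivita v (S.frame x₀ u))) :=
    tendsto_finsetSum _ fun S _ => (hlim S).const_mul _
  have h2 : ∀ n, ∑ S ∈ c.support, c S * S.formFactor (E n) = 0 := by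
    intro n
    have := congrFun h (E n)
    rw [Finsupp.sum, Finset.sum_apply] at this
    simpa using this
  simp only [h2] at h1
  exact tendsto_nhds_unique tendsto_const_nhds h1 |>.symm

end Density

/-! ### Rescaled integrals over shrinking sets -/

section BlowUp

variable {V : Type*} [NormedAddCommGroup V] [NormedSpace ℝ V] [FiniteDimensional ℝ V]
  [MeasurableSpace V] [BorelSpace V] (μ : Measure V) [μ.IsAddHaarMeasure]

theorem setIntegral_rescale (A : Set V) (hA : MeasurableSet A) (b : V → ℝ) (u₀ : V) {r : ℝ}
    (hr : 0 < r) : (r ^ Module.finrank ℝ V)⁻¹ * ∫ u in A, b u ∂μ =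
      ∫ x, A.indicator b (u₀ + r • x) ∂μ := by
  have h1 := Measure.integral_comp_smul μ (fun y => A.indicator b (u₀ + y)) r
  rw [h1, integral_add_left_eq_self (fun u => A.indicator b u) u₀, integral_indicator hA,
    abs_of_pos (by positivity), smul_eq_mul]

/-- If the sets `A r` shrink to `u₀` and their rescalings converge almost everywhere to `D`, then
the rescaled integrals over them converge. -/
theorem tendsto_rescaled_setIntegral {A : ℝ → Set V} {b : V → ℝ} {u₀ : V} {D : Set V} {R : ℝ}
    (hA : ∀ᶠ r in 𝓝[>] (0 : ℝ), MeasurableSet (A r))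
    (hbA : ∀ᶠ r in 𝓝[>] (0 : ℝ), ContinuousOn b (A r)) (hb : ContinuousAt b u₀)
    (hR : ∀ᶠ r in 𝓝[>] (0 : ℝ), ∀ u ∈ A r, ‖u - u₀‖ ≤ r * R) (hD : MeasurableSet D)
    (hAD : ∀ᵐ x ∂μ, ∀ᶠ r in 𝓝[>] (0 : ℝ), (u₀ + r • x ∈ A r ↔ x ∈ D)) :
    Tendsto (fun r : ℝ => (r ^ Module.finrank ℝ V)⁻¹ * ∫ u in A r, b u ∂μ) (𝓝[>] 0)
      (𝓝 (b u₀ * μ.real D)) := by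
  have hpos : ∀ᶠ r : ℝ in 𝓝[>] 0, 0 < r := self_mem_nhdsWithin
  have hlim : b u₀ * μ.real D = ∫ x, D.indicator (fun _ => b u₀) x ∂μ := by
    rw [integral_indicator hD, setIntegral_const, smul_eq_mul, mul_comm]
  rw [hlim]
  have hcongr : ∀ᶠ r : ℝ in 𝓝[>] 0, ∫ x, (A r).indicator b (u₀ + r • x) ∂μ =
      (r ^ Module.finrank ℝ V)⁻¹ * ∫ u in A r, b u ∂μ := by
    filter_upwards [hpos, hA] with r hr hAr using (setIntegral_rescale μ _ hAr b u₀ hr).symm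
  refine Tendsto.congr' hcongr ?_
  have hcont : ∀ r : ℝ, Continuous (fun x : V => u₀ + r • x) := fun r => by fun_prop
  have hbound : ∀ᶠ u in 𝓝 u₀, ‖b u‖ ≤ ‖b u₀‖ + 1 := by
    filter_upwards [hb.norm.eventually (gt_mem_nhds (lt_add_one ‖b u₀‖))] with u hu using hu.le
  obtain ⟨δ, hδ, hball⟩ := Metric.eventually_nhds_iff_ball.1 hbound
  have hsmall : ∀ᶠ r : ℝ in 𝓝[>] 0, r * R < δ := by
    have : Tendsto (fun r : ℝ => r * R) (𝓝 0) (𝓝 (0 * R)) :=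
      (continuous_id.mul continuous_const).tendsto 0
    rw [zero_mul] at this
    exact (this.mono_left nhdsWithin_le_nhds).eventually (gt_mem_nhds hδ)
  -- The rescaled integrands vanish outside the ball of radius `R`. Inside, they are bounded because
  -- `b` is continuous at `u₀`.
  refine tendsto_integral_filter_of_dominated_convergence
    ((Metric.closedBall (0 : V) R).indicator fun _ => ‖b u₀‖ + 1) ?_ ?_ ?_ ?_
  · filter_upwards [hA, hbA] with r h1 h2
    have h3 : (fun x => (A r).indicator b (u₀ + r • x)) =
        ((fun x => u₀ + r • x) ⁻¹' A r).indicator (fun x => b (u₀ + r • x)) := by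
      ext x; rfl
    have h4 : MeasurableSet ((fun x : V => u₀ + r • x) ⁻¹' A r) := (hcont r).measurable h1
    rw [h3, aestronglyMeasurable_indicator_iff h4]
    exact (h2.comp (hcont r).continuousOn fun x hx => hx).aestronglyMeasurable h4
  · filter_upwards [hpos, hR, hsmall] with r hr h1 h2
    refine Eventually.of_forall fun x => ?_
    by_cases hx : u₀ + r • x ∈ A r
    · have h3 := h1 _ hx
      rw [add_sub_cancel_left, norm_smul, Real.norm_of_nonneg hr.le] at h3
      have h4 : ‖x‖ ≤ R := le_of_mul_le_mul_left h3 hr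
      rw [indicator_of_mem hx, indicator_of_mem (mem_closedBall_zero_iff.2 h4)]
      refine hball _ (mem_ball_iff_norm.2 ?_)
      rw [add_sub_cancel_left, norm_smul, Real.norm_of_nonneg hr.le]
      exact h3.trans_lt h2
    · rw [indicator_of_notMem hx, norm_zero]
      exact indicator_nonneg (fun _ _ => by positivity) _
  · rw [integrable_indicator_iff Metric.isClosed_closedBall.measurableSet]
    exact integrableOn_const (measure_closedBall_lt_top).ne
  · filter_upwards [hAD] with x hx
    have h1 : Tendsto (fun r : ℝ => b (u₀ + r • x)) (𝓝[>] 0) (𝓝 (b u₀)) := by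
      have h2 : Tendsto (fun r : ℝ => u₀ + r • x) (𝓝 0) (𝓝 (u₀ + (0 : ℝ) • x)) :=
        (continuous_const.add (continuous_id.smul continuous_const)).tendsto 0
      rw [zero_smul, add_zero] at h2
      exact hb.tendsto.comp (h2.mono_left nhdsWithin_le_nhds)
    by_cases hxD : x ∈ D
    · rw [indicator_of_mem hxD]
      refine h1.congr' ?_
      filter_upwards [hx] with r hr
      rw [indicator_of_mem (hr.2 hxD)]
    · rw [indicator_of_notMem hxD]
      refine tendsto_const_nhds.congr' ?_
      filter_upwards [hx] with r hr
      rw [indicator_of_notMem (fun h => hxD (hr.1 h))]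

end BlowUp

/-! ### Balls of positive definite quadratic forms -/

section QuadraticForm

variable {E : Type*} [NormedAddCommGroup E] [NormedSpace ℝ E] [FiniteDimensional ℝ E]

/-- The constant is the minimum of the form on the compact unit sphere; homogeneity does the rest.
-/
theorem exists_mul_sq_norm_le (B : E →L[ℝ] E →L[ℝ] ℝ) (hB : ∀ z, z ≠ 0 → 0 < B z z) :
    ∃ c > 0, ∀ z, c * ‖z‖ ^ 2 ≤ B z z := by
  have hcont : Continuous fun z => B z z := by fun_prop
  rcases subsingleton_or_nontrivial E with h | h
  · exact ⟨1, one_pos, fun z => by simp [Subsingleton.elim z 0]⟩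
  · obtain ⟨z₀, hz₀, hmin⟩ := (isCompact_sphere (0 : E) 1).exists_isMinOn
      (NormedSpace.sphere_nonempty.2 zero_le_one) hcont.continuousOn
    have hz₀' : z₀ ≠ 0 := by
      rintro rfl
      simp at hz₀
    refine ⟨B z₀ z₀, hB z₀ hz₀', fun z => ?_⟩
    rcases eq_or_ne z 0 with rfl | hz
    · simp
    · have hn : ‖z‖ ≠ 0 := norm_ne_zero_iff.2 hz
      have h1 : B z₀ z₀ ≤ B (‖z‖⁻¹ • z) (‖z‖⁻¹ • z) :=
        hmin (by simp [norm_smul, hn])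
      have h2 : B z z = ‖z‖ ^ 2 * B (‖z‖⁻¹ • z) (‖z‖⁻¹ • z) := by
        simp only [map_smul, smul_apply, smul_eq_mul]
        field_simp
      rw [h2, mul_comm]
      gcongr

variable {V : Type*} [NormedAddCommGroup V] [NormedSpace ℝ V] [FiniteDimensional ℝ V]
  [MeasurableSpace V] [BorelSpace V] (μ : Measure V) [μ.IsAddHaarMeasure]

/-- The analytic function `B (L x) (L x) - 1` is `-1` at the origin, so it vanishes identically near
no point. Indicators of rescaled balls need not converge on this sphere, so it has to be negligible.
-/
theorem measure_quadratic_eq_one (B : E →L[ℝ] E →L[ℝ] ℝ) (L : V →L[ℝ] E) :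
    μ {x | B (L x) (L x) = 1} = 0 := by
  set f : V → ℝ := fun x => B (L x) (L x) - 1 with hf
  have hC : ContDiff ℝ ω f := by fun_prop
  have ha : AnalyticOnNhd ℝ f univ := fun x _ => hC.contDiffAt.analyticAt
  have hne : ∀ x, ¬ ∀ᶠ y in 𝓝 x, f y = 0 := by
    intro x hx
    have := ha.eqOn_zero_of_preconnected_of_eventuallyEq_zero isPreconnected_univ (mem_univ x) hx
      (mem_univ 0)
    simp [hf] at this
  have hset : {x | B (L x) (L x) = 1} = {x | f x = 0} := by
    ext x
    simp [hf, sub_eq_zero]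
  rw [hset]
  refine measure_null_of_locally_null _ fun x _ => ?_
  obtain ⟨N, hN, h0⟩ := exists_nhds_measure_zeros_eq_zero μ (ha x (mem_univ x)) (hne x)
  exact ⟨N ∩ {x | f x = 0}, inter_comm {x | f x = 0} N ▸ inter_mem_nhdsWithin _ hN, h0⟩

theorem measure_quadratic_ball_lt_top (B : E →L[ℝ] E →L[ℝ] ℝ) (hB : ∀ z, z ≠ 0 → 0 < B z z)
    {L : V →L[ℝ] E} (hL : Function.Injective L) : μ {x | B (L x) (L x) ≤ 1} < ⊤ := by
  obtain ⟨c, hc, hcB⟩ := exists_mul_sq_norm_le ((B.bilinearComp L L)) (fun z hz => by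
    exact hB _ fun h => hz (hL (h.trans (map_zero L).symm)))
  -- The radius avoids a square root: `‖x‖ ^ 2 ≤ c⁻¹` and `2 * ‖x‖ ≤ ‖x‖ ^ 2 + 1`.
  refine (measure_mono fun x hx => ?_).trans_lt (measure_closedBall_lt_top (x := (0 : V))
    (r := c⁻¹ + 1))
  rw [mem_closedBall_zero_iff]
  have h1 : c * ‖x‖ ^ 2 ≤ 1 := (hcB x).trans hx
  have h2 : ‖x‖ ^ 2 ≤ c⁻¹ := by
    rw [← one_div, le_div_iff₀ hc]
    linarith
  nlinarith [sq_nonneg (‖x‖ - 1), norm_nonneg x, inv_pos.2 hc]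

theorem measure_quadratic_ball_pos (B : E →L[ℝ] E →L[ℝ] ℝ) (L : V →L[ℝ] E) :
    0 < μ {x | B (L x) (L x) ≤ 1} := by
  have hcont : Continuous fun x => B (L x) (L x) := by fun_prop
  refine Measure.measure_pos_of_mem_nhds μ (x := (0 : V)) ?_
  filter_upwards [(hcont.tendsto 0).eventually_lt_const
    (show B (L 0) (L 0) < 1 by simp)] with x hx
  exact le_of_lt hx

end QuadraticForm

/-! ### The tangent cone of the cube -/

section Cone

variable {d : ℕ}

/-- Constraints that are inactive at `u` hold for small `r`, while active ones are homogeneous in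
`r`. So for each fixed direction the blow-up of the cube is eventually equal to its cone. -/
theorem eventually_mem_cube_iff {u : Fin d → ℝ} (hu : u ∈ cube d) (x : Fin d → ℝ) :
    ∀ᶠ r in 𝓝[>] (0 : ℝ), (u + r • x ∈ cube d ↔ x ∈ cubeDirections u) := by
  have hpos : ∀ᶠ r : ℝ in 𝓝[>] 0, 0 < r := self_mem_nhdsWithin
  have hlim : ∀ i, Tendsto (fun r : ℝ => u i + r * x i) (𝓝[>] 0) (𝓝 (u i)) := by
    intro i
    have : Tendsto (fun r : ℝ => u i + r * x i) (𝓝 0) (𝓝 (u i + 0 * x i)) :=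
      (continuous_const.add (continuous_id.mul continuous_const)).tendsto 0
    rw [zero_mul, add_zero] at this
    exact this.mono_left nhdsWithin_le_nhds
  have h : ∀ᶠ r in 𝓝[>] (0 : ℝ), ∀ i, (0 ≤ u i + r * x i ∧ u i + r * x i ≤ 1 ↔
      (u i = 0 → 0 ≤ x i) ∧ (u i = 1 → x i ≤ 0)) := by
    refine eventually_all.2 fun i => ?_
    have h0 : 0 ≤ u i := hu.1 i
    have h1 : u i ≤ 1 := hu.2 i
    refine Eventually.and (p := fun r => 0 ≤ u i + r * x i ↔ (u i = 0 → 0 ≤ x i))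
      (q := fun r => u i + r * x i ≤ 1 ↔ (u i = 1 → x i ≤ 0)) ?_ ?_ |>.mono
        fun r hr => and_congr hr.1 hr.2
    · rcases h0.eq_or_lt with h | h
      · filter_upwards [hpos] with r hr
        simp [← h, hr]
      · filter_upwards [(hlim i).eventually (lt_mem_nhds h)] with r hr
        simp [h.ne', hr.le]
    · rcases h1.eq_or_lt with h | h
      · filter_upwards [hpos] with r hr
        simp [h, mul_nonpos_iff, hr.le, hr.not_ge]
      · filter_upwards [(hlim i).eventually (gt_mem_nhds h)] with r hr
        simp [h.ne, hr.le]
  filter_upwards [h] with r hr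
  simp only [cube, cubeDirections, mem_Icc, Pi.le_def, Pi.add_apply, Pi.smul_apply, smul_eq_mul,
    Pi.zero_apply, Pi.one_apply, ← forall_and, mem_ofPred_eq]
  exact forall_congr' hr

theorem isClosed_cubeDirections (u : Fin d → ℝ) : IsClosed (cubeDirections u) := by
  have : cubeDirections u = ⋂ i, ({x | u i = 0 → 0 ≤ x i} ∩ {x | u i = 1 → x i ≤ 0}) := by
    ext x
    simp [cubeDirections]
  rw [this]
  refine isClosed_iInter fun i => IsClosed.inter ?_ ?_
  · by_cases h : u i = 0
    · simpa [h] using isClosed_le continuous_const (continuous_apply i)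
    · simp [h]
  · by_cases h : u i = 1
    · simpa [h] using isClosed_le (continuous_apply i) continuous_const
    · simp [h]

end Cone

/-! ### Blow-up of a surface inside an analytic hypersurface -/

section Zone

variable {E : Type*} [NormedAddCommGroup E] [NormedSpace ℝ E] [FiniteDimensional ℝ E]

theorem eventually_quadratic_ball_subset (B : E →L[ℝ] E →L[ℝ] ℝ) (hB : ∀ z, z ≠ 0 → 0 < B z z)
    {z₀ : E} {W : Set E} (hW : W ∈ 𝓝 z₀) :
    ∀ᶠ r in 𝓝[>] (0 : ℝ), {z | B (z - z₀) (z - z₀) ≤ r ^ 2} ⊆ W := by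
  obtain ⟨c, hc, hcB⟩ := exists_mul_sq_norm_le B hB
  obtain ⟨δ, hδ, hball⟩ := Metric.mem_nhds_iff.1 hW
  have hpos : ∀ᶠ r : ℝ in 𝓝[>] 0, 0 < r := self_mem_nhdsWithin
  have hlim : Tendsto (fun r : ℝ => r ^ 2) (𝓝[>] 0) (𝓝 (0 ^ 2)) :=
    ((continuous_pow 2).tendsto 0).mono_left nhdsWithin_le_nhds
  filter_upwards [hpos, hlim.eventually_lt_const (show (0 : ℝ) ^ 2 < c * δ ^ 2 by simp; positivity)]
    with r hr hr2 z hz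
  refine hball (mem_ball_iff_norm.2 ?_)
  have h1 : c * ‖z - z₀‖ ^ 2 < c * δ ^ 2 := ((hcB _).trans hz).trans_lt hr2
  exact lt_of_pow_lt_pow_left₀ 2 hδ.le (lt_of_mul_lt_mul_left h1 hc.le)

variable {d : ℕ}

/-- `A` and `A'` both parametrize the hyperplane `ψ = 0`, so `A' = A ∘ G`. The surface element is
multiplied by `det G` and the volume of the parameter ball is divided by `|det G|`. The product is
thus a normalization shared by all surfaces tangent to one hyperplane. -/
theorem measureReal_quadratic_ball_mul_abs_leviCivita (B : Model d →L[ℝ] Model d →L[ℝ] ℝ)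
    {A A' : (Fin d → ℝ) →L[ℝ] Model d} {ψ : Model d →L[ℝ] ℝ} {v : Model d} (hv : ψ v ≠ 0)
    (hψ : ∀ x, ψ (A x) = 0) (hψ' : ∀ x, ψ (A' x) = 0)
    (hA : leviCivita v (fun i => A (Pi.single i 1)) ≠ 0)
    (hA' : leviCivita v (fun i => A' (Pi.single i 1)) ≠ 0) :
    volume.real {x | B (A' x) (A' x) ≤ 1} * |leviCivita v (fun i => A' (Pi.single i 1))| =
      volume.real {x | B (A x) (A x) ≤ 1} * |leviCivita v (fun i => A (Pi.single i 1))| := by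
  have hinj : Function.Injective A := by
    rw [← ContinuousLinearMap.coe_coe, ← LinearMap.ker_eq_bot, LinearMap.ker_eq_bot']
    intro x hx
    exact (injective_of_leviCivita_ne_zero hA (a := 0) (x := x) (by simpa using hx.symm)).2
  obtain ⟨P, hP⟩ := exists_continuousLinearMap_leftInverse hinj
  have hG : ∀ x, A (P (A' x)) = A' x := by
    intro x
    obtain ⟨a, y, hy⟩ := exists_eq_smul_add_of_leviCivita_ne_zero hA (A' x)
    have h0 : a = 0 := by
      have := hψ' x
      rw [hy, map_add, map_smul, hψ, add_zero, smul_eq_mul] at this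
      exact (mul_eq_zero.1 this).resolve_right hv
    rw [h0, zero_smul, zero_add] at hy
    have h1 : P (A y) = y := DFunLike.congr_fun hP y
    rw [hy, h1]
  set G : (Fin d → ℝ) →L[ℝ] (Fin d → ℝ) := P.comp A' with hGdef
  have hdet : leviCivita v (fun i => A' (Pi.single i 1)) =
      G.det * leviCivita v (fun i => A (Pi.single i 1)) := by
    rw [← leviCivita_comp_right]
    congr 1
    ext1 i
    exact (hG _).symm
  have hdet0 : G.det ≠ 0 := by
    intro h
    rw [h, zero_mul] at hdet
    exact hA' hdet
  have hball : {x | B (A' x) (A' x) ≤ 1} = G ⁻¹' {x | B (A x) (A x) ≤ 1} := by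
    ext x
    simp only [mem_ofPred_eq, mem_preimage]
    rw [show A (G x) = A' x from hG x]
  rw [hball, Measure.real, Measure.addHaar_preimage_continuousLinearMap volume hdet0,
    ENNReal.toReal_mul, ENNReal.toReal_ofReal (abs_nonneg _), hdet, abs_mul]
  have h2 : |(LinearMap.det (G : (Fin d → ℝ) →ₗ[ℝ] (Fin d → ℝ)))⁻¹| * |G.det| = 1 := by
    rw [← abs_mul]
    change |(G.det)⁻¹ * G.det| = 1
    rw [inv_mul_cancel₀ hdet0, abs_one]
  rw [Measure.real]
  linear_combination ((volume {x | B (A x) (A x) ≤ 1}).toReal *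
    |leviCivita v (fun i => A (Pi.single i 1))|) * h2

variable {M : Type*} [TopologicalSpace M] [ChartedSpace (Model d) M]
  [IsManifold (𝓡 (d + 1)) ω M]

/-- The points of the hypersurface `φ = 0` whose coordinates are within distance `r` of those of
`p`, with respect to the inner product `B`. -/
def zone (B : Model d →L[ℝ] Model d →L[ℝ] ℝ) (φ : M → ℝ) (p : M) (r : ℝ) : Set M :=
  (extChartAt (𝓡 (d + 1)) p).symm '' {z | B (z - extChartAt (𝓡 (d + 1)) p p)
    (z - extChartAt (𝓡 (d + 1)) p p) ≤ r ^ 2 ∧ φ ((extChartAt (𝓡 (d + 1)) p).symm z) = 0}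

variable {B : Model d →L[ℝ] Model d →L[ℝ] ℝ} (hB : ∀ z, z ≠ 0 → 0 < B z z) {φ : M → ℝ} {p : M}
include hB

theorem eventually_zone_subset {N : Set M} (hN : N ∈ 𝓝 p) :
    ∀ᶠ r in 𝓝[>] (0 : ℝ), zone B φ p r ⊆ N := by
  have h1 : (extChartAt (𝓡 (d + 1)) p).symm ⁻¹' N ∈ 𝓝 (extChartAt (𝓡 (d + 1)) p p) := by
    refine (continuousAt_extChartAt_symm p).preimage_mem_nhds ?_
    rwa [extChartAt_to_inv]
  filter_upwards [eventually_quadratic_ball_subset B hB h1] with r hr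
  rintro _ ⟨z, hz, rfl⟩
  exact hr hz.1

/-- For small `r` the quadratic ball lies in the chart target, and only then can membership be read
off in coordinates. -/
theorem eventually_mem_zone_iff : ∀ᶠ r in 𝓝[>] (0 : ℝ), ∀ x ∈ (chartAt (Model d) p).source,
    (x ∈ zone B φ p r ↔ B (extChartAt (𝓡 (d + 1)) p x - extChartAt (𝓡 (d + 1)) p p)
    (extChartAt (𝓡 (d + 1)) p x - extChartAt (𝓡 (d + 1)) p p) ≤ r ^ 2 ∧ φ x = 0) := by
  filter_upwards [eventually_quadratic_ball_subset B hB
    (extChartAt_target_mem_nhds (I := 𝓡 (d + 1)) p)] with r hr x hx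
  have hx' : x ∈ (extChartAt (𝓡 (d + 1)) p).source := by rwa [extChartAt_source]
  constructor
  · rintro ⟨z, hz, rfl⟩
    rw [(extChartAt (𝓡 (d + 1)) p).right_inv (hr hz.1)]
    exact hz
  · intro h
    refine ⟨extChartAt (𝓡 (d + 1)) p x, ⟨h.1, ?_⟩, (extChartAt (𝓡 (d + 1)) p).left_inv hx'⟩
    rw [(extChartAt (𝓡 (d + 1)) p).left_inv hx']
    exact h.2

theorem eventually_isCompact_zone (hφ : ContMDiffAt (𝓡 (d + 1)) 𝓘(ℝ, ℝ) ω φ p) :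
    ∀ᶠ r in 𝓝[>] (0 : ℝ), IsCompact (zone B φ p r) := by
  have h1 : ∀ᶠ z in 𝓝 (extChartAt (𝓡 (d + 1)) p p),
      ContDiffAt ℝ ω (fun z => φ ((extChartAt (𝓡 (d + 1)) p).symm z)) z :=
    (contDiffAt_comp_extChartAt_symm hφ).eventually (by simp)
  filter_upwards [eventually_quadratic_ball_subset B hB h1, eventually_quadratic_ball_subset B hB
    (extChartAt_target_mem_nhds (I := 𝓡 (d + 1)) p), eventually_quadratic_ball_subset B hB
    (Metric.closedBall_mem_nhds (extChartAt (𝓡 (d + 1)) p p) one_pos)] with r hr1 hr2 hr3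
  have hcl : IsClosed {z | B (z - extChartAt (𝓡 (d + 1)) p p)
      (z - extChartAt (𝓡 (d + 1)) p p) ≤ r ^ 2} :=
    isClosed_le (by fun_prop) continuous_const
  have hcont : ContinuousOn (fun z => φ ((extChartAt (𝓡 (d + 1)) p).symm z))
      {z | B (z - extChartAt (𝓡 (d + 1)) p p) (z - extChartAt (𝓡 (d + 1)) p p) ≤ r ^ 2} :=
    fun z hz => (ContDiffAt.continuousAt (show ContDiffAt ℝ ω _ z from hr1 hz)).continuousWithinAt
  refine IsCompact.image_of_continuousOn (((isCompact_closedBall _ _).of_isClosed_subset hcl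
    hr3).of_isClosed_subset (hcont.preimage_isClosed_of_isClosed hcl isClosed_singleton
      (t := {(0 : ℝ)})) inter_subset_left) ?_
  exact (continuousOn_extChartAt_symm p).mono fun z hz => hr2 hz.1

variable [T2Space M]

theorem Surface.eventually_cube_inter_zone_subset (S : Surface d M) {N : Set (Fin d → ℝ)}
    (hN : ∀ u ∈ cube d, S.toFun u = p → N ∈ 𝓝 u) :
    ∀ᶠ r in 𝓝[>] (0 : ℝ), cube d ∩ S.toFun ⁻¹' zone B φ p r ⊆ N := by
  filter_upwards [eventually_zone_subset hB (φ := φ) (eventually_forall_mem_of_isCompact isCompact_cube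
    S.continuousOn hN)] with r hr u hu
  exact hr hu.2 u hu.1 rfl

/-- A surface that does not lie in `φ = 0` near `p` meets it in the zero set of the nontrivial
analytic germ `φ ∘ S`; a surface that misses `p` avoids small zones altogether. -/
theorem Surface.eventually_volume_zone_eq_zero (S : Surface d M)
    (hφ : ContMDiffAt (𝓡 (d + 1)) 𝓘(ℝ, ℝ) ω φ p)
    (hne : ∀ u ∈ cube d, S.toFun u = p → ¬ ∀ᶠ v in 𝓝 u, φ (S.toFun v) = 0) :
    ∀ᶠ r in 𝓝[>] (0 : ℝ), volume (cube d ∩ S.toFun ⁻¹' zone B φ p r) = 0 := by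
  by_cases hex : ∃ u ∈ cube d, S.toFun u = p
  · obtain ⟨u, hu, rfl⟩ := hex
    have han : ContDiffAt ℝ ω (fun v => φ (S.toFun v)) u :=
      (ContMDiffAt.comp (g := φ) (f := S.toFun) u hφ (S.analytic u hu)).contDiffAt
    obtain ⟨N, hN, h0⟩ := exists_nhds_measure_zeros_eq_zero volume han.analyticAt (hne u hu rfl)
    have hsrc : ∀ᶠ v in 𝓝 u, S.toFun v ∈ (chartAt (Model d) (S.toFun u)).source :=
      (S.analytic u hu).continuousAt.eventually (chart_source_mem_nhds _ _)
    filter_upwards [S.eventually_cube_inter_zone_subset hB (φ := φ) (p := S.toFun u) (N := N ∩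
      {v | S.toFun v ∈ (chartAt (Model d) (S.toFun u)).source}) fun v hv hvp => by
        rw [S.injOn hv hu hvp]; exact inter_mem hN hsrc,
      eventually_mem_zone_iff hB (φ := φ) (p := S.toFun u)] with r h1 h2
    refine measure_mono_null (fun v hv => mem_inter (h1 hv).1 ?_) h0
    exact ((h2 _ (h1 hv).2).1 hv.2).2
  · filter_upwards [S.eventually_cube_inter_zone_subset hB (φ := φ) (p := p) (N := ∅)
      fun v hv hvp => absurd ⟨v, hv, hvp⟩ hex] with r h1
    rw [subset_empty_iff.1 h1, measure_empty]

/-- Since `φ` vanishes on the surface, only the distance condition of the zone remains. After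
rescaling, it becomes the unit ball of the inner product pulled back by the derivative, and the cube
becomes its cone of directions. -/
theorem Surface.tendsto_integral_zone (S : Surface d M) {u : Fin d → ℝ} (hu : u ∈ cube d)
    (hSu : S.toFun u = p) (hφ : ContMDiffAt (𝓡 (d + 1)) 𝓘(ℝ, ℝ) ω φ p)
    (h0 : ∀ᶠ w in 𝓝 u, φ (S.toFun w) = 0) (v : Model d) :
    Tendsto (fun r : ℝ => (r ^ Module.finrank ℝ (Fin d → ℝ))⁻¹ *
        ∫ u in cube d ∩ S.toFun ⁻¹' zone B φ p r, leviCivita v (S.frame p u)) (𝓝[>] 0)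
      (𝓝 (leviCivita v (fun i => chartDeriv (d := d) S.toFun u (Pi.single i 1)) *
        volume.real ({x | B (chartDeriv S.toFun u x) (chartDeriv S.toFun u x) ≤ 1} ∩
          cubeDirections u))) := by
  subst hSu
  set p := S.toFun u with hp
  set A : (Fin d → ℝ) →L[ℝ] Model d := chartDeriv S.toFun u with hAdef
  set F : (Fin d → ℝ) → Model d := fun w => extChartAt (𝓡 (d + 1)) p (S.toFun w) with hFdef
  have hF : HasFDerivAt F A u := by
    have := hasFDerivAt_extChartAt_comp (S.mdifferentiableAt hu)
      (mem_chart_source (Model d) (S.toFun u))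
    rwa [tangentCoordChange_self_eq_id, ContinuousLinearMap.id_comp] at this
  have hAinj : Function.Injective A := chartDeriv_injective (S.immersion u hu)
  have hframe : S.frame p u = fun i => A (Pi.single i 1) := by
    ext1 i
    rw [Surface.frame, hF.fderiv]
  have hsrc : ∀ᶠ w in 𝓝 u, S.toFun w ∈ (chartAt (Model d) p).source :=
    (S.analytic u hu).continuousAt.eventually (chart_source_mem_nhds _ _)
  have hsub : ∀ N ∈ 𝓝 u, ∀ᶠ r in 𝓝[>] (0 : ℝ), cube d ∩ S.toFun ⁻¹' zone B φ p r ⊆ N :=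
    fun N hN => S.eventually_cube_inter_zone_subset hB fun w hw hwp => by
      rw [S.injOn hw hu hwp]; exact hN
  obtain ⟨c, hc, hcB⟩ := exists_mul_sq_norm_le B hB
  obtain ⟨P, hP⟩ := exists_continuousLinearMap_leftInverse hAinj
  -- Injectivity of the derivative gives `w - u = O(F w - F u)`, so zones of radius `r` have
  -- parameter diameter `O(r)`.
  have hO : (fun w => w - u) =O[𝓝 u] fun w => A (w - u) := by
    refine Asymptotics.IsBigO.of_bound ‖P‖ (Eventually.of_forall fun w => ?_)
    have h1 : P (A (w - u)) = w - u := DFunLike.congr_fun hP _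
    simpa only [h1] using P.le_opNorm (A (w - u))
  have hO' : (fun w => A (w - u)) =O[𝓝 u] fun w => F w - F u := by
    refine ((hF.isLittleO.trans_isBigO hO).right_isBigO_add').congr_right fun w => ?_
    simp
  obtain ⟨C, hC, hCF⟩ := (hO.trans hO').exists_pos
  have hlc : ∀ w, S.toFun w ∈ (chartAt (Model d) p).source → w ∈ cube d →
      ContinuousAt (fun w => leviCivita v (S.frame p w)) w := fun w h1 h2 => by
    have h3 : ContinuousAt (fun w => (v, S.frame p w)) w :=
      continuousAt_const.prodMk (S.continuousAt_frame h2 h1)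
    exact ((contDiff_leviCivita (n := 0)).continuous.tendsto _).comp h3
  rw [← hframe]
  have hpos : ∀ᶠ r : ℝ in 𝓝[>] 0, 0 < r := self_mem_nhdsWithin
  refine tendsto_rescaled_setIntegral volume (R := C * (Real.sqrt c)⁻¹)
    (b := fun w => leviCivita v (S.frame p w)) ?_ ?_ ?_ ?_ ?_ ?_
  · filter_upwards [eventually_isCompact_zone hB hφ] with r hr
    exact (S.isClosed_cube_inter_preimage hr.isClosed).measurableSet
  · filter_upwards [hsub _ hsrc] with r hr w hw
    exact (hlc w (hr hw) hw.1).continuousWithinAt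
  · exact hlc u (mem_chart_source _ _) hu
  · filter_upwards [hpos, hsub _ hsrc, hsub _ hCF.bound, eventually_mem_zone_iff hB (φ := φ)
      (p := p)] with r hr h1 h2 h3 w hw
    have h4 : c * ‖F w - F u‖ ^ 2 ≤ r ^ 2 := (hcB _).trans ((h3 _ (h1 hw)).1 hw.2).1
    have h5 : ‖w - u‖ ≤ C * ‖F w - F u‖ := h2 hw
    have h6 : Real.sqrt c * ‖F w - F u‖ ≤ r := by
      refine le_of_sq_le_sq ?_ hr.le
      rw [mul_pow, Real.sq_sqrt hc.le]
      exact h4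
    have hsc : 0 < Real.sqrt c := Real.sqrt_pos.2 hc
    calc ‖w - u‖ ≤ C * ‖F w - F u‖ := h5
      _ = (Real.sqrt c * ‖F w - F u‖) * (C * (Real.sqrt c)⁻¹) := by field_simp
      _ ≤ r * (C * (Real.sqrt c)⁻¹) := by gcongr
  · refine MeasurableSet.inter (IsClosed.measurableSet ?_) (isClosed_cubeDirections u).measurableSet
    exact isClosed_le (by fun_prop) continuous_const
  · have hnull : ∀ᵐ x, B (A x) (A x) ≠ 1 :=
      ae_iff.2 (by simpa using measure_quadratic_eq_one (volume : Measure (Fin d → ℝ)) B A)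
    filter_upwards [hnull] with x hx
    have hline : Tendsto (fun r : ℝ => u + r • x) (𝓝[>] 0) (𝓝 u) := by
      have h2 : Tendsto (fun r : ℝ => u + r • x) (𝓝 0) (𝓝 (u + (0 : ℝ) • x)) :=
        (continuous_const.add (continuous_id.smul continuous_const)).tendsto 0
      rw [zero_smul, add_zero] at h2
      exact h2.mono_left nhdsWithin_le_nhds
    have hquot : Tendsto (fun r : ℝ => r⁻¹ • (F (u + r • x) - F u)) (𝓝[>] 0) (𝓝 (A x)) := by
      have := (hF.hasLineDerivAt x).tendsto_slope_zero_right
      exact this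
    have hQ : Tendsto (fun r : ℝ => B (r⁻¹ • (F (u + r • x) - F u))
        (r⁻¹ • (F (u + r • x) - F u))) (𝓝[>] 0) (𝓝 (B (A x) (A x))) := by
      have hcont : Continuous fun z => B z z := by fun_prop
      exact (hcont.tendsto _).comp hquot
    have hQiff : ∀ᶠ r : ℝ in 𝓝[>] 0, (B (r⁻¹ • (F (u + r • x) - F u))
        (r⁻¹ • (F (u + r • x) - F u)) ≤ 1 ↔ B (A x) (A x) ≤ 1) := by
      rcases hx.lt_or_gt with h | h
      · filter_upwards [hQ.eventually_lt_const h] with r hr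
        exact iff_of_true hr.le h.le
      · filter_upwards [hQ.eventually_const_lt h] with r hr
        exact iff_of_false hr.not_ge h.not_ge
    filter_upwards [hpos, hQiff, hline.eventually hsrc, hline.eventually h0,
      eventually_mem_cube_iff hu x, eventually_mem_zone_iff hB (φ := φ) (p := p)]
      with r hr h1 h2 h3 h4 h5
    have h6 : S.toFun (u + r • x) ∈ zone B φ p r ↔ B (A x) (A x) ≤ 1 := by
      rw [h5 _ h2, ← h1]
      simp only [h3, and_true, map_smul, smul_apply, smul_eq_mul]
      rw [← mul_assoc, ← sq, inv_pow, inv_mul_le_iff₀ (by positivity), mul_one]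
    rw [mem_inter_iff, mem_preimage, h6, h4]
    exact and_comm

end Zone

/-! ### Linear relations between surfaces -/

section SurfaceSum

variable {d : ℕ} {M : Type*} [TopologicalSpace M] [ChartedSpace (Model d) M]
  [IsManifold (𝓡 (d + 1)) ω M]

/-- A surface inside the hypersurface `φ = 0` has this hypersurface as its extension, and its
orientation relates its sides to the sign of `φ`. -/
theorem Surface.side_of_eventually_eq_zero (S : Surface d M) {u : Fin d → ℝ} (hu : u ∈ cube d)
    {p : M} (hSu : S.toFun u = p) {φ : M → ℝ} (hφ : ContMDiffAt (𝓡 (d + 1)) 𝓘(ℝ, ℝ) ω φ p)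
    (h0 : ∀ᶠ w in 𝓝 u, φ (S.toFun w) = 0) {v : Model d} (hv : 0 < chartCodiff φ p v)
    {γ : ℝ → M} (hγ : Tendsto γ (𝓝[>] 0) (𝓝 p)) :
    leviCivita v (fun i => chartDeriv (d := d) S.toFun u (Pi.single i 1)) ≠ 0 ∧
    (∀ x, chartCodiff φ p (chartDeriv (d := d) S.toFun u x) = 0) ∧
    S.side u γ * |leviCivita v (fun i => chartDeriv (d := d) S.toFun u (Pi.single i 1))| =
      leviCivita v (fun i => chartDeriv (d := d) S.toFun u (Pi.single i 1)) * sideOf φ γ ∧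
    ∀ ψ, S.IsDefiningFunction u ψ → (fun x => ψ x = 0) =ᶠ[𝓝 p] fun x => φ x = 0 := by
  subst hSu
  have hne : leviCivita v (fun i => chartDeriv (d := d) S.toFun u (Pi.single i 1)) ≠ 0 :=
    Surface.leviCivita_ne_zero_of_codiff_ne_zero hu hφ h0 hv.ne'
  refine ⟨hne, Surface.codiff_chartDeriv_eq_zero hu hφ h0, ?_⟩
  rcases hne.lt_or_gt with h | h
  · have hdef : S.IsDefiningFunction u (-φ) := Surface.isDefiningFunction_neg hφ h0 hv h
    refine ⟨?_, fun ψ hψ => ?_⟩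
    · rw [Surface.side_eq_sideOf hu hdef hγ, sideOf_neg, abs_of_neg h]
      ring
    · filter_upwards [hψ.eventually_sign_eq hu hdef] with x hx
      rw [← sign_eq_zero_iff, hx, sign_eq_zero_iff, Pi.neg_apply, neg_eq_zero]
  · have hdef : S.IsDefiningFunction u φ := ⟨hφ, h0, v, h, hv⟩
    refine ⟨?_, fun ψ hψ => ?_⟩
    · rw [Surface.side_eq_sideOf hu hdef hγ, abs_of_pos h]
      ring
    · filter_upwards [hψ.eventually_sign_eq hu hdef] with x hx
      rw [← sign_eq_zero_iff, hx, sign_eq_zero_iff]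

/-- The inner product of a Riemannian metric, in the chart at the base point. -/
noncomputable def chartInner
    (g : Bundle.RiemannianMetric (fun x : M => TangentSpace (𝓡 (d + 1)) x)) (p : M) :
    Model d →L[ℝ] Model d →L[ℝ] ℝ := g.inner p

variable (g : Bundle.RiemannianMetric (fun x : M => TangentSpace (𝓡 (d + 1)) x))

theorem chartInner_pos (p : M) (z : Model d) (hz : z ≠ 0) : 0 < chartInner g p z z :=
  g.pos p z hz

theorem Surface.density_eq (S : Surface d M) {u : Fin d → ℝ} {p : M} (hSu : S.toFun u = p) :
    S.density g u = volume.real ({x | chartInner g p (chartDeriv S.toFun u x)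
      (chartDeriv S.toFun u x) ≤ 1} ∩ cubeDirections u) / volume.real {x | chartInner g p
      (chartDeriv S.toFun u x) (chartDeriv S.toFun u x) ≤ 1} := by
  subst hSu
  rfl

theorem Surface.measureReal_unitBall_pos (S : Surface d M) {u : Fin d → ℝ} (hu : u ∈ cube d)
    (p : M) : 0 < volume.real {x | chartInner g p (chartDeriv S.toFun u x)
      (chartDeriv S.toFun u x) ≤ 1} :=
  ENNReal.toReal_pos (measure_quadratic_ball_pos volume _ _).ne'
    (measure_quadratic_ball_lt_top volume _ (chartInner_pos g p)
      (chartDeriv_injective (S.immersion u hu))).ne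

variable [T2Space M]

/-- `T` collects the surfaces of the relation that lie in the hypersurface `φ = 0` near `p`. Only
these survive the blow-up, and their limits are proportional to density times orientation, with one
factor for the whole group. The side of `γ` is this orientation times its side of `φ = 0`. -/
theorem sum_density_mul_side_eq_zero_of_group (hM : IsOrientedAtlas d M) (c : Surface d M →₀ ℝ)
    (h : (c.sum fun S a => a • S.formFactor) = 0) {p : M} {γ : ℝ → M}
    (hγ : Tendsto γ (𝓝[>] 0) (𝓝 p)) (U : Surface d M → Fin d → ℝ) (T : Finset (Surface d M))
    (hTc : T ⊆ c.support) (hU : ∀ S ∈ T, U S ∈ cube d ∧ S.toFun (U S) = p)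
    {φ : M → ℝ} (hφ : ContMDiffAt (𝓡 (d + 1)) 𝓘(ℝ, ℝ) ω φ p) (hφ0 : chartCodiff (d := d) φ p ≠ 0)
    (h0 : ∀ S ∈ T, ∀ᶠ w in 𝓝 (U S), φ (S.toFun w) = 0)
    (hT : ∀ S ∈ c.support, S ∉ T → ∀ u ∈ cube d, S.toFun u = p →
      ¬ ∀ᶠ w in 𝓝 u, φ (S.toFun w) = 0) :
    ∑ S ∈ T, c S * (S.density g (U S) * S.side (U S) γ) = 0 := by
  classical
  rcases T.eq_empty_or_nonempty with rfl | ⟨k, hk⟩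
  · exact Finset.sum_empty
  obtain ⟨v, hv⟩ : ∃ v : Model d, 0 < chartCodiff φ p v := by
    by_contra! hcon
    apply hφ0
    ext1 x
    refine le_antisymm (hcon x) ?_
    have := hcon (-x)
    rw [map_neg] at this
    simpa using this
  set B := chartInner g p with hBdef
  have hB : ∀ z, z ≠ 0 → 0 < B z z := chartInner_pos g p
  set L : Surface d M → ℝ := fun S =>
    leviCivita v (fun i => chartDeriv (d := d) S.toFun (U S) (Pi.single i 1)) with hL
  set b : Surface d M → Set (Fin d → ℝ) := fun S =>
    {x | B (chartDeriv S.toFun (U S) x) (chartDeriv S.toFun (U S) x) ≤ 1} with hb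
  have hdata := fun S (hS : S ∈ T) => S.side_of_eventually_eq_zero (hU S hS).1 (hU S hS).2 hφ
    (h0 S hS) hv hγ
  have hsum : ∑ S ∈ T, c S * (L S * volume.real (b S ∩ cubeDirections (U S))) = 0 := by
    set I : Surface d M → ℝ → ℝ := fun S r => (r ^ Module.finrank ℝ (Fin d → ℝ))⁻¹ *
      ∫ u in cube d ∩ S.toFun ⁻¹' zone B φ p r, leviCivita v (S.frame p u) with hI
    have hz : ∀ᶠ r in 𝓝[>] (0 : ℝ), ∑ S ∈ c.support, c S * I S r = 0 := by
      filter_upwards [eventually_isCompact_zone hB hφ,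
        eventually_zone_subset hB (φ := φ) (chart_source_mem_nhds (Model d) p)] with r hr1 hr2
      have := sum_setIntegral_surface_eq_zero hM c h p hr1 hr2 v
      rw [Finsupp.sum] at this
      calc ∑ S ∈ c.support, c S * I S r = (r ^ Module.finrank ℝ (Fin d → ℝ))⁻¹ *
          ∑ S ∈ c.support, c S * ∫ u in cube d ∩ S.toFun ⁻¹' zone B φ p r,
            leviCivita v (S.frame p u) := by
            rw [Finset.mul_sum]
            exact Finset.sum_congr rfl fun S _ => by rw [hI]; ring
        _ = 0 := by rw [this, mul_zero]
    have hlim : ∀ S ∈ c.support, Tendsto (I S) (𝓝[>] 0)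
        (𝓝 (if S ∈ T then L S * volume.real (b S ∩ cubeDirections (U S)) else 0)) := by
      intro S hS
      split_ifs with hST
      · exact S.tendsto_integral_zone hB (hU S hST).1 (hU S hST).2 hφ (h0 S hST) v
      · refine tendsto_const_nhds.congr' ?_
        filter_upwards [S.eventually_volume_zone_eq_zero hB hφ (hT S hS hST)] with r hr
        rw [hI]
        simp only
        rw [setIntegral_measure_zero _ hr, mul_zero]
    have h1 := tendsto_finsetSum c.support fun S hS => (hlim S hS).const_mul (c S)
    have h2 : Tendsto (fun r => ∑ S ∈ c.support, c S * I S r) (𝓝[>] 0) (𝓝 0) :=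
      tendsto_const_nhds.congr' (hz.mono fun r hr => hr.symm)
    have h3 := tendsto_nhds_unique h1 h2
    rw [← h3, ← Finset.sum_subset hTc fun S _ hST => by rw [if_neg hST, mul_zero]]
    exact Finset.sum_congr rfl fun S hS => by rw [if_pos hS]
  -- All surfaces of the group share a tangent hyperplane at `p`, so the normalization agrees with
  -- that of `k`.
  have hκ : ∀ S ∈ T, volume.real (b S) * |L S| = volume.real (b k) * |L k| := fun S hS =>
    measureReal_quadratic_ball_mul_abs_leviCivita B hv.ne' (hdata k hk).2.1 (hdata S hS).2.1
      (hdata k hk).1 (hdata S hS).1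
  have hκ0 : volume.real (b k) * |L k| ≠ 0 :=
    mul_ne_zero (k.measureReal_unitBall_pos g (hU k hk).1 p).ne' (abs_ne_zero.2 (hdata k hk).1)
  calc ∑ S ∈ T, c S * (S.density g (U S) * S.side (U S) γ)
      = (volume.real (b k) * |L k|)⁻¹ * sideOf φ γ *
          ∑ S ∈ T, c S * (L S * volume.real (b S ∩ cubeDirections (U S))) := by
        rw [Finset.mul_sum]
        refine Finset.sum_congr rfl fun S hS => ?_
        rw [S.density_eq g (hU S hS).2, ← hκ S hS]
        have h1 : S.side (U S) γ * |L S| = L S * sideOf φ γ := (hdata S hS).2.2.1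
        have h2 : volume.real (b S) ≠ 0 := (S.measureReal_unitBall_pos g (hU S hS).1 p).ne'
        have h3 : |L S| ≠ 0 := abs_ne_zero.2 (hdata S hS).1
        change c S * (volume.real (b S ∩ cubeDirections (U S)) / volume.real (b S) * _) = _
        rw [← mul_div_cancel_right₀ (S.side (U S) γ) h3, h1]
        field_simp
    _ = 0 := by rw [hsum, mul_zero]

/-- Linear relations between form factors of surfaces hold for the weighted sides of a branch. -/
theorem sum_density_mul_side_eq_zero (hM : IsOrientedAtlas d M) (c : Surface d M →₀ ℝ)
    (h : (c.sum fun S a => a • S.formFactor) = 0) {p : M} {γ : ℝ → M}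
    (hγ : Tendsto γ (𝓝[>] 0) (𝓝 p)) (U : Surface d M → Fin d → ℝ) (T : Finset (Surface d M))
    (hTc : T ⊆ c.support) (hU : ∀ S ∈ T, U S ∈ cube d ∧ S.toFun (U S) = p)
    (hT : ∀ S ∈ c.support, S ∉ T → ∀ u ∈ cube d, S.toFun u ≠ p) :
    ∑ S ∈ T, c S * (S.density g (U S) * S.side (U S) γ) = 0 := by
  classical
  have hex : ∀ S : Surface d M, ∃ φ, S ∈ T → S.IsDefiningFunction (U S) φ := by
    intro S
    by_cases hS : S ∈ T
    · obtain ⟨φ, hφ⟩ := S.exists_isDefiningFunction (hU S hS).1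
      exact ⟨φ, fun _ => hφ⟩
    · exact ⟨0, fun h => absurd h hS⟩
  choose Φ hΦ using hex
  -- Surfaces are grouped by the germ at `p` of the hypersurface that extends them, regardless of
  -- orientation.
  let cl : Surface d M → Germ (𝓝 p) Prop := fun S => ((fun x => Φ S x = 0 : M → Prop) :)
  rw [← Finset.sum_fiberwise_of_maps_to (t := T.image cl)
    (fun S hS => Finset.mem_image_of_mem cl hS)]
  refine Finset.sum_eq_zero fun y hy => ?_
  obtain ⟨k, hk, rfl⟩ := Finset.mem_image.1 hy
  have hφ : ContMDiffAt (𝓡 (d + 1)) 𝓘(ℝ, ℝ) ω (Φ k) p := (hU k hk).2 ▸ (hΦ k hk).1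
  obtain ⟨v, hv⟩ : ∃ v : Model d, 0 < chartCodiff (Φ k) p v := by
    obtain ⟨w, -, hw⟩ := (hΦ k hk).2.2
    rw [← (hU k hk).2]
    exact ⟨w, hw⟩
  refine sum_density_mul_side_eq_zero_of_group g hM c h hγ U (T.filter fun S => cl S = cl k)
    ((Finset.filter_subset _ _).trans hTc) (fun S hS => hU S (Finset.mem_filter.1 hS).1) hφ
    (fun h0 => by simp [h0] at hv) (fun S hS => ?_) (fun S hS hSn u hu hSu h0 => ?_)
  · obtain ⟨hS, hcl⟩ := Finset.mem_filter.1 hS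
    have hev : ∀ᶠ x in 𝓝 p, (Φ S x = 0) = (Φ k x = 0) := Germ.coe_eq.1 hcl
    have hlim : Tendsto S.toFun (𝓝 (U S)) (𝓝 p) := by
      have := (S.analytic _ (hU S hS).1).continuousAt.tendsto
      rwa [(hU S hS).2] at this
    filter_upwards [hlim.eventually hev, (hΦ S hS).2.1] with w h1 h2
    rwa [← h1]
  · have hST : S ∈ T := by
      by_contra hST
      exact hT S hS hST u hu hSu
    have huU : u = U S := S.injOn hu (hU S hST).1 (hSu.trans (hU S hST).2.symm)
    subst huU
    exact hSn (Finset.mem_filter.2 ⟨hST, Germ.coe_eq.2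
      ((S.side_of_eventually_eq_zero hu hSu hφ h0 hv hγ).2.2.2 _ (hΦ S hST))⟩)

/-- The outgoing and the incoming branch of `e` are curves starting at the point, so the relation
for weighted sides applies to each of them separately. -/
theorem sum_intersectionAt_surface_eq_zero (hM : IsOrientedAtlas d M) (c : Surface d M →₀ ℝ)
    (h : (c.sum fun S a => a • S.formFactor) = 0) (e : Edge d M) (p : M) :
    (c.sum fun S a => a * intersectionAt g e S p) = 0 := by
  classical
  by_cases hex : ∃ t ∈ Icc (0 : ℝ) 1, e.toFun t = p
  swap
  · refine Finset.sum_eq_zero fun S _ => mul_eq_zero_of_right _ ?_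
    by_contra hne
    obtain ⟨t, ht, v, hv, het, -, -⟩ := exists_of_intersectionAt_ne_zero g hne
    exact hex ⟨t, ht, het⟩
  obtain ⟨t, ht, rfl⟩ := hex
  set T := c.support.filter fun S => ∃ u ∈ cube d, S.toFun u = e.toFun t with hTdef
  have hexU : ∀ S : Surface d M, ∃ u, S ∈ T → u ∈ cube d ∧ S.toFun u = e.toFun t := by
    intro S
    by_cases hS : S ∈ T
    · obtain ⟨u, hu⟩ := (Finset.mem_filter.1 hS).2
      exact ⟨u, fun _ => hu⟩
    · exact ⟨0, fun h => absurd h hS⟩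
  choose U hU using hexU
  have hT : ∀ S ∈ c.support, S ∉ T → ∀ u ∈ cube d, S.toFun u ≠ e.toFun t :=
    fun S hS hST u hu hSu => hST (Finset.mem_filter.2 ⟨hS, u, hu, hSu⟩)
  have hout := sum_density_mul_side_eq_zero g hM c h (e.tendsto_outgoing ht) U T
    (Finset.filter_subset _ _) hU hT
  have hin := sum_density_mul_side_eq_zero g hM c h (e.tendsto_incoming ht) U T
    (Finset.filter_subset _ _) hU hT
  have hsum : (c.sum fun S a => a * intersectionAt g e S (e.toFun t)) =
      ∑ S ∈ T, c S * localIntersection g e S t (U S) := by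
    rw [Finsupp.sum, ← Finset.sum_subset (Finset.filter_subset _ _ : T ⊆ c.support)
      fun S hS hST => ?_]
    · exact Finset.sum_congr rfl fun S hS => by
        rw [intersectionAt_eq g e S ht (hU S hS).1 rfl (hU S hS).2]
    · refine mul_eq_zero_of_right _ ?_
      by_contra hne
      obtain ⟨s, hs, v, hv, -, hSv, -⟩ := exists_of_intersectionAt_ne_zero g hne
      exact hT S hS hST v hv hSv
  have hsplit : ∑ S ∈ T, c S * localIntersection g e S t (U S) =
      1 / 2 * ((if t < 1 then ∑ S ∈ T, c S * (S.density g (U S) *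
        S.side (U S) fun s => e.toFun (t + s)) else 0) -
        (if 0 < t then ∑ S ∈ T, c S * (S.density g (U S) *
        S.side (U S) fun s => e.toFun (t - s)) else 0)) := by
    simp only [localIntersection]
    split_ifs <;> simp only [← Finset.sum_sub_distrib, Finset.mul_sum, sub_zero, zero_sub,
      mul_zero, Finset.sum_const_zero, ← Finset.sum_neg_distrib] <;>
    exact Finset.sum_congr rfl fun S _ => by ring
  rw [hsum, hsplit, hout, hin]
  simp

theorem sum_orientedIntersection_surface_eq_zero (hM : IsOrientedAtlas d M)
    (c : Surface d M →₀ ℝ) (h : (c.sum fun S a => a • S.formFactor) = 0) (e : Edge d M) :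
    (c.sum fun S a => a * orientedIntersection g e S) = 0 := by
  simp only [Finsupp.sum, finsum_mul_intersectionAt]
  rw [← finsum_sum_comm]
  · rw [← finsum_zero (α := M)]
    exact finsum_congr fun p => sum_intersectionAt_surface_eq_zero g hM c h e p
  · intro S _
    exact (finite_support_intersectionAt g e S).subset
      (Function.support_mul_subset_right _ _)

end SurfaceSum

/-! ### Small affine patches in a chart -/

section AffinePatch

variable {d : ℕ} {M : Type*} [TopologicalSpace M] [ChartedSpace (Model d) M]
  {E V : Type*} [NormedAddCommGroup E] [NormedSpace ℝ E]
  [NormedAddCommGroup V] [NormedSpace ℝ V]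

/-- The map that is affine in the chart at `p`, with linear part `L`, and sends `0` to `p`. -/
noncomputable def affineMap (p : M) (L : V →L[ℝ] Model d) (b : V) : M :=
  (extChartAt (𝓡 (d + 1)) p).symm (extChartAt (𝓡 (d + 1)) p p + L b)

theorem affineMap_zero (p : M) (L : V →L[ℝ] Model d) : affineMap p L 0 = p := by
  rw [affineMap, map_zero, add_zero, extChartAt_to_inv]

theorem tendsto_add_clm (z : Model d) (L : V →L[ℝ] Model d) :
    Tendsto (fun b => z + L b) (𝓝 0) (𝓝 z) := by
  have : Continuous fun b => z + L b := by fun_prop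
  simpa using this.tendsto 0

theorem tendsto_affineMap (p : M) (L : V →L[ℝ] Model d) :
    Tendsto (affineMap p L) (𝓝 0) (𝓝 p) := by
  have h1 := (continuousAt_extChartAt_symm (I := 𝓡 (d + 1)) p).tendsto
  rw [extChartAt_to_inv] at h1
  exact h1.comp (tendsto_add_clm _ L)

theorem eventually_extChartAt_affineMap (p : M) (L : V →L[ℝ] Model d) :
    ∀ᶠ b in 𝓝 (0 : V), affineMap p L b ∈ (chartAt (Model d) p).source ∧
      extChartAt (𝓡 (d + 1)) p (affineMap p L b) = extChartAt (𝓡 (d + 1)) p p + L b := by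
  filter_upwards [(tendsto_add_clm _ L).eventually
    (extChartAt_target_mem_nhds (I := 𝓡 (d + 1)) p)] with b hb
  refine ⟨?_, (extChartAt (𝓡 (d + 1)) p).right_inv hb⟩
  have := (extChartAt (𝓡 (d + 1)) p).map_target hb
  rwa [extChartAt_source] at this

variable [IsManifold (𝓡 (d + 1)) ω M]

theorem eventually_contMDiffAt_affineMap (p : M) (L : V →L[ℝ] Model d) :
    ∀ᶠ b in 𝓝 (0 : V), ContMDiffAt 𝓘(ℝ, V) (𝓡 (d + 1)) ω (affineMap p L) b := by
  filter_upwards [(tendsto_add_clm _ L).eventually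
    (extChartAt_target_mem_nhds (I := 𝓡 (d + 1)) p)] with b hb
  have h1 : ContMDiffAt 𝓘(ℝ, Model d) (𝓡 (d + 1)) ω (extChartAt (𝓡 (d + 1)) p).symm
      (extChartAt (𝓡 (d + 1)) p p + L b) :=
    (contMDiffOn_extChartAt_symm p).contMDiffAt ((isOpen_extChartAt_target p).mem_nhds hb)
  have h2 : ContDiff ℝ ω (fun b => extChartAt (𝓡 (d + 1)) p p + L b) := by fun_prop
  exact ContMDiffAt.comp (g := (extChartAt (𝓡 (d + 1)) p).symm)
    (f := fun b => extChartAt (𝓡 (d + 1)) p p + L b) b h1 h2.contMDiff.contMDiffAt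

/-- A patch that meets a transversal affine patch in its centre does not meet it elsewhere. -/
theorem eventually_ne_affineMap [T2Space M] [FiniteDimensional ℝ E] [FiniteDimensional ℝ V]
    {K : Set E} (hK : IsCompact K) {f : E → M}
    (hf : IsPatch d K f) {p : M} {L : V →L[ℝ] Model d}
    (hL : ∀ u ∈ K, f u = p → ∀ (a : E) (b : V), chartDeriv (d := d) f u a = L b → a = 0 ∧ b = 0) :
    ∀ᶠ b in 𝓝 (0 : V), ∀ u ∈ K, f u = affineMap p L b → f u = p ∧ b = 0 := by
  by_cases hex : ∃ u ∈ K, f u = p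
  · obtain ⟨u₁, hu₁, rfl⟩ := hex
    have hext : ContDiffAt ℝ ω (fun u => extChartAt (𝓡 (d + 1)) (f u₁) (f u)) u₁ :=
      contDiffAt_extChartAt_comp (hf.analytic u₁ hu₁) (mem_chart_source _ _)
    have hd : HasStrictFDerivAt (fun u => extChartAt (𝓡 (d + 1)) (f u₁) (f u))
        (chartDeriv (d := d) f u₁) u₁ := by
      have h1 := hext.hasStrictFDerivAt (by simp)
      rwa [fderiv_extChartAt_comp_self ((hf.analytic u₁ hu₁).mdifferentiableAt (by simp))] at h1
    -- The difference of the two patches in coordinates. Transversality makes its derivative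
    -- injective, so it is locally injective, and the only solution near `(u₁, 0)` is the centre.
    have hF : HasStrictFDerivAt (fun x : E × V => extChartAt (𝓡 (d + 1)) (f u₁) (f x.1) - L x.2)
        ((chartDeriv (d := d) f u₁).comp (ContinuousLinearMap.fst ℝ E V) -
          L.comp (ContinuousLinearMap.snd ℝ E V)) (u₁, 0) :=
      (HasStrictFDerivAt.comp (u₁, (0 : V)) (g := fun u => extChartAt (𝓡 (d + 1)) (f u₁) (f u)) hd
        hasStrictFDerivAt_fst).sub (L.hasStrictFDerivAt.comp _ hasStrictFDerivAt_snd)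
    have hinj : Function.Injective ((chartDeriv (d := d) f u₁).comp
        (ContinuousLinearMap.fst ℝ E V) - L.comp (ContinuousLinearMap.snd ℝ E V)) := by
      rw [← ContinuousLinearMap.coe_coe, ← LinearMap.ker_eq_bot, LinearMap.ker_eq_bot']
      rintro ⟨a, b⟩ hab
      have h1 : chartDeriv (d := d) f u₁ a - L b = 0 := hab
      obtain ⟨ha, hb⟩ := hL u₁ hu₁ rfl a b (sub_eq_zero.1 h1)
      rw [ha, hb]
      rfl
    obtain ⟨N, hN, hNinj⟩ := exists_nhds_injOn_of_hasStrictFDerivAt hF hinj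
    obtain ⟨N₁, hN₁, N₂, hN₂, hsub⟩ := mem_nhds_prod_iff.1 hN
    have h1 : ∀ᶠ x in 𝓝 (f u₁), ∀ u ∈ K, f u = x → u ∈ N₁ :=
      eventually_forall_mem_of_isCompact hK hf.continuousOn fun u hu hup => by
        rw [hf.injOn hu hu₁ hup]; exact hN₁
    filter_upwards [hN₂, (tendsto_affineMap (f u₁) L).eventually h1,
      eventually_extChartAt_affineMap (f u₁) L] with b hb hb1 hb2 u hu hub
    have h2 : (u, b) = (u₁, (0 : V)) := by
      refine hNinj (hsub ⟨hb1 u hu hub, hb⟩) (hsub ⟨mem_of_mem_nhds hN₁, mem_of_mem_nhds hN₂⟩) ?_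
      simp only [map_zero, sub_zero]
      rw [hub, hb2.2, add_sub_cancel_right]
    exact ⟨congrArg f (Prod.ext_iff.1 h2).1, (Prod.ext_iff.1 h2).2⟩
  · have h1 : ∀ᶠ x in 𝓝 p, ∀ u ∈ K, f u = x → u ∈ (∅ : Set E) :=
      eventually_forall_mem_of_isCompact hK hf.continuousOn
        fun u hu hup => absurd ⟨u, hu, hup⟩ hex
    filter_upwards [(tendsto_affineMap p L).eventually h1] with b hb u hu hub
    exact absurd (hb u hu hub) (notMem_empty u)

/-- Arbitrarily small affine patches through `p` with given tangent space. -/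
theorem exists_affine_patch [FiniteDimensional ℝ V] {K : Set V} (hK : IsCompact K) {u₀ : V}
    (p : M) {L : V →L[ℝ] Model d} (hL : Function.Injective L) {P : V → Prop}
    (hP : ∀ᶠ b in 𝓝 (0 : V), P b) :
    ∃ η : ℝ, 0 < η ∧ IsPatch d K (fun u => affineMap p L (η • (u - u₀))) ∧
      (∀ u ∈ K, P (η • (u - u₀))) ∧
      chartDeriv (d := d) (fun u => affineMap p L (η • (u - u₀))) u₀ = η • L := by
  have hall := (((eventually_extChartAt_affineMap p L).eventually_nhds.and
    (eventually_contMDiffAt_affineMap p L)).and hP)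
  obtain ⟨δ, hδ, hball⟩ := Metric.eventually_nhds_iff_ball.1 hall
  obtain ⟨R, hR⟩ := (hK.image (continuous_id.sub continuous_const)
    (f := fun u => u - u₀)).isBounded.exists_norm_le
  have hRpos : 0 < |R| + 1 := by positivity
  -- The scale shrinks `K - u₀` into the ball of radius `δ`. If `K` is empty the bound `R` may be
  -- negative, hence `|R| + 1`.
  set η := δ / (|R| + 1) / 2 with hη
  have hη0 : 0 < η := by positivity
  have hmem : ∀ u ∈ K, η • (u - u₀) ∈ Metric.ball (0 : V) δ := by
    intro u hu
    have h1 := hR _ (mem_image_of_mem _ hu)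
    rw [mem_ball_zero_iff, norm_smul, Real.norm_of_nonneg hη0.le]
    calc η * ‖u - u₀‖ ≤ η * (|R| + 1) := by
          gcongr
          exact h1.trans ((le_abs_self R).trans (by linarith))
      _ = δ / 2 := by rw [hη]; field_simp
      _ < δ := by linarith
  set f : V → M := fun u => affineMap p L (η • (u - u₀)) with hf
  have hsc : ContDiff ℝ ω (fun u : V => η • (u - u₀)) := by fun_prop
  have han : ∀ u, η • (u - u₀) ∈ Metric.ball (0 : V) δ →
      ContMDiffAt 𝓘(ℝ, V) (𝓡 (d + 1)) ω f u := fun u hu =>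
    ContMDiffAt.comp (g := affineMap p L) (f := fun u : V => η • (u - u₀)) u (hball _ hu).1.2
      hsc.contMDiff.contMDiffAt
  have hder : ∀ u, η • (u - u₀) ∈ Metric.ball (0 : V) δ →
      (tangentCoordChange (𝓡 (d + 1)) (f u) p (f u)).comp (chartDeriv f u) = η • L := by
    intro u hu
    have h1 := hasFDerivAt_extChartAt_comp ((han u hu).mdifferentiableAt (by simp))
      (hball _ hu).1.1.self_of_nhds.1
    have h2 : HasFDerivAt (fun u => extChartAt (𝓡 (d + 1)) p p + L (η • (u - u₀))) (η • L) u := by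
      have h3 : HasFDerivAt (fun u => η • (u - u₀)) (η • ContinuousLinearMap.id ℝ V) u :=
        ((hasFDerivAt_id u).sub_const u₀).const_smul η
      have h4 := (L.hasFDerivAt.comp u h3).const_add (extChartAt (𝓡 (d + 1)) p p)
      rw [ContinuousLinearMap.comp_smul, ContinuousLinearMap.comp_id] at h4
      exact h4
    refine h1.unique (h2.congr_of_eventuallyEq ?_)
    filter_upwards [(hsc.continuous.tendsto u).eventually (hball _ hu).1.1] with w hw using hw.2
  have hinjL : Function.Injective (η • L) := by
    intro a b hab
    have : η • L a = η • L b := hab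
    exact hL (smul_right_injective _ hη0.ne' this)
  refine ⟨η, hη0, ⟨fun u hu => han u (hmem u hu), fun u hu w hw huw => ?_, fun u hu => ?_⟩,
    fun u hu => (hball _ (hmem u hu)).2, ?_⟩
  · have h1 := (hball _ (hmem u hu)).1.1.self_of_nhds.2
    have h2 := (hball _ (hmem w hw)).1.1.self_of_nhds.2
    have h3 : affineMap p L (η • (u - u₀)) = affineMap p L (η • (w - u₀)) := huw
    rw [h3, h2] at h1
    have h4 := smul_right_injective _ hη0.ne' (hL (add_left_cancel h1))
    exact (sub_left_injective h4).symm
  · have := hinjL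
    rw [← hder u (hmem u hu)] at this
    exact Function.Injective.of_comp (f := tangentCoordChange (𝓡 (d + 1)) (f u) p (f u)) this
  · have h0 : η • (u₀ - u₀) ∈ Metric.ball (0 : V) δ := by simpa using hδ
    have h1 := hder u₀ h0
    have hp : f u₀ = p := by simp [hf, affineMap_zero]
    rw [hp, tangentCoordChange_self_eq_id, ContinuousLinearMap.id_comp] at h1
    exact h1

end AffinePatch

/-! ### Transversal crossings -/

section Crossing

variable {d : ℕ} {M : Type*} [TopologicalSpace M] [ChartedSpace (Model d) M]
  [IsManifold (𝓡 (d + 1)) ω M]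

theorem eventually_sign_of_hasDerivAt {f : ℝ → ℝ} {m t : ℝ} (hf : HasDerivAt f m t) (h0 : f t = 0)
    (hm : m ≠ 0) : ∀ᶠ s in 𝓝[>] (0 : ℝ), SignType.sign (f (t + s)) = SignType.sign m := by
  have h1 := hf.tendsto_slope_zero_right
  have h2 := ((continuousAt_sign_of_ne_zero hm).tendsto.comp h1).eventually
    (mem_nhds_discrete.2 (mem_singleton (SignType.sign m)))
  have hpos : ∀ᶠ s : ℝ in 𝓝[>] 0, 0 < s := self_mem_nhdsWithin
  filter_upwards [h2, hpos] with s hs hs0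
  have h3 : SignType.sign (s⁻¹ • (f (t + s) - f t)) = SignType.sign m := hs
  rw [h0, sub_zero, smul_eq_mul, sign_mul, sign_pos (inv_pos.2 hs0), one_mul] at h3
  exact h3

theorem Edge.isPatch (e : Edge d M) : IsPatch d (Icc (0 : ℝ) 1) e.toFun :=
  ⟨e.analytic, e.injOn, e.immersion⟩

theorem Surface.isPatch (S : Surface d M) : IsPatch d (cube d) S.toFun :=
  ⟨S.analytic, S.injOn, S.immersion⟩

variable (g : Bundle.RiemannianMetric (fun x : M => TangentSpace (𝓡 (d + 1)) x))

/-- The contribution of a transversal crossing. -/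
theorem localIntersection_of_transversal (e : Edge d M) (S : Surface d M) {t : ℝ}
    (ht : t ∈ Ioo (0 : ℝ) 1) {u : Fin d → ℝ} (hu : u ∈ cube d) (heS : e.toFun t = S.toFun u)
    (hne : leviCivita (chartDeriv (d := d) e.toFun t 1)
      (fun i => chartDeriv (d := d) S.toFun u (Pi.single i 1)) ≠ 0) :
    localIntersection g e S t u = S.density g u *
      (SignType.sign (leviCivita (chartDeriv (d := d) e.toFun t 1)
        (fun i => chartDeriv (d := d) S.toFun u (Pi.single i 1))) : ℝ) := by
  have htI : t ∈ Icc (0 : ℝ) 1 := Ioo_subset_Icc_self ht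
  obtain ⟨φ, hφ⟩ := S.exists_isDefiningFunction hu
  obtain ⟨c, hc, hcℓ⟩ := hφ.exists_codiff_eq hu
  set l := leviCivita (chartDeriv (d := d) e.toFun t 1)
    (fun i => chartDeriv (d := d) S.toFun u (Pi.single i 1)) with hl
  have hder : HasDerivAt (fun s => φ (e.toFun s)) (c * l) t := by
    have h1 := (hasFDerivAt_comp_of_mdifferentiableAt (d := d) (φ := φ) (f := e.toFun) (u := t)
      (by rw [heS]; exact hφ.1.mdifferentiableAt (by simp))
      ((e.analytic t htI).mdifferentiableAt (by simp))).hasDerivAt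
    have h2 : ((chartCodiff φ (e.toFun t)).comp (chartDeriv (d := d) e.toFun t)) 1 = c * l := by
      rw [ContinuousLinearMap.comp_apply, heS]
      exact hcℓ _
    rwa [h2] at h1
  have h0 : φ (e.toFun t) = 0 := by
    rw [heS]
    exact hφ.2.1.self_of_nhds
  have hcl : c * l ≠ 0 := mul_ne_zero hc.ne' hne
  have hsg : SignType.sign (c * l) = SignType.sign l := by
    rw [sign_mul, sign_pos hc, one_mul]
  have hout : S.side u (fun s => e.toFun (t + s)) = SignType.sign l := by
    rw [Surface.side_eq_sideOf hu hφ (heS ▸ e.tendsto_outgoing htI), ← hsg]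
    exact sideOf_eq_of_eventually_sign (eventually_sign_of_hasDerivAt hder h0 hcl)
  have hin : S.side u (fun s => e.toFun (t - s)) = -SignType.sign l := by
    rw [Surface.side_eq_sideOf hu hφ (heS ▸ e.tendsto_incoming htI), ← hsg]
    -- The incoming branch is the outgoing branch at `-t` of the reversed curve.
    have h1 : HasDerivAt (fun s => φ (e.toFun (-s))) (-(c * l)) (-t) := by
      have h2 : HasDerivAt (fun s => φ (e.toFun s)) (c * l) (-(-t)) := by rwa [neg_neg]
      have h3 := HasDerivAt.comp (-t) (h₂ := fun s => φ (e.toFun s)) h2 (hasDerivAt_neg (-t))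
      rw [mul_neg_one] at h3
      exact h3
    have h3 := eventually_sign_of_hasDerivAt h1 (by simpa using h0) (neg_ne_zero.2 hcl)
    have h4 : ∀ᶠ s in 𝓝[>] (0 : ℝ), SignType.sign (φ (e.toFun (t - s))) =
        -SignType.sign (c * l) := by
      filter_upwards [h3] with s hs
      rw [Left.sign_neg, neg_add, neg_neg, ← sub_eq_add_neg] at hs
      exact hs
    rw [sideOf_eq_of_eventually_sign h4]
    simp
  rw [localIntersection, hout, hin, if_pos ht.2, if_pos ht.1]
  ring

/-- No constraint of the cube is active at an interior point, so the cone is the whole space and the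
fraction is a nonzero number divided by itself. -/
theorem Surface.density_eq_one (S : Surface d M) {u : Fin d → ℝ} (hu : u ∈ interior (cube d)) :
    S.density g u = 1 := by
  have hcube := interior_subset hu
  have hdir : cubeDirections u = univ := by
    have hIoo : ∀ i, 0 < u i ∧ u i < 1 := by
      have : cube d = univ.pi fun _ => Icc (0 : ℝ) 1 := by
        rw [cube, ← pi_univ_Icc]; rfl
      rw [this, interior_pi_set finite_univ] at hu
      intro i
      have := hu i (mem_univ i)
      rwa [interior_Icc] at this
    refine eq_univ_of_forall fun x i => ⟨fun h => absurd h (hIoo i).1.ne',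
      fun h => absurd h (hIoo i).2.ne⟩
  rw [S.density_eq g rfl, hdir, inter_univ]
  exact div_self (S.measureReal_unitBall_pos g hcube _).ne'

theorem orientedIntersection_eq_of_unique (e : Edge d M) (S : Surface d M) {p : M}
    (h : ∀ t ∈ Icc (0 : ℝ) 1, ∀ u ∈ cube d, e.toFun t = S.toFun u → e.toFun t = p) :
    orientedIntersection g e S = intersectionAt g e S p := by
  rw [orientedIntersection_eq_finsum]
  refine finsum_eq_single _ _ fun q hq => ?_
  by_contra hne
  obtain ⟨t, ht, u, hu, h1, h2, -⟩ := exists_of_intersectionAt_ne_zero g hne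
  exact hq (h1.symm.trans (h t ht u hu (h1.trans h2.symm)))

end Crossing

/-! ### Intersection numbers determine form factors -/

section Detection

variable {d : ℕ} {M : Type*} [TopologicalSpace M] [ChartedSpace (Model d) M]
  [IsManifold (𝓡 (d + 1)) ω M]
  {E : Type*} [NormedAddCommGroup E] [NormedSpace ℝ E]

theorem Overlap.chartDeriv_eq {K : Set E} {f k : E → M} (hk : IsPatch d K k) {u : E}
    (h : Overlap K f k u) : chartDeriv (d := d) f u =
      (chartDeriv (d := d) k (transition K f k u)).comp (fderiv ℝ (transition K f k) u) := by
  obtain ⟨h1, h2, h3⟩ := h.transition_spec hk.injOn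
  exact chartDeriv_comp (h1.differentiableAt (by simp))
    ((hk.analytic _ (interior_subset h2)).mdifferentiableAt (by simp)) h3

theorem leviCivita_smul_left (a : ℝ) (v : Model d) (w : Fin d → Model d) :
    leviCivita (a • v) w = a * leviCivita v w :=
  (leviCivitaLeft w).map_smul a v

theorem leviCivita_smul_right_ne_zero {η : ℝ} (hη : η ≠ 0) {v : Model d}
    {L : (Fin d → ℝ) →L[ℝ] Model d} (h : leviCivita v (fun i => L (Pi.single i 1)) ≠ 0) :
    leviCivita v (fun i => (η • L) (Pi.single i 1)) ≠ 0 := by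
  have h1 : (fun i => (η • L) (Pi.single i 1)) =
      fun i => L ((η • ContinuousLinearMap.id ℝ (Fin d → ℝ)) (Pi.single i 1)) := by
    ext1 i
    simp
  rw [h1, leviCivita_comp_right]
  refine mul_ne_zero ?_ h
  simp [ContinuousLinearMap.det, hη]

theorem volume_diff_interior_Icc {ι : Type*} [Fintype ι] :
    volume (Icc (0 : ι → ℝ) 1 \ interior (Icc 0 1)) = 0 := by
  rw [← isClosed_Icc.frontier_eq]
  exact (convex_Icc _ _).addHaar_frontier volume

theorem volume_diff_interior_Icc_real : volume (Icc (0 : ℝ) 1 \ interior (Icc 0 1)) = 0 := by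
  rw [← isClosed_Icc.frontier_eq]
  exact (convex_Icc _ _).addHaar_frontier volume

variable [T2Space M]
variable (g : Bundle.RiemannianMetric (fun x : M => TangentSpace (𝓡 (d + 1)) x))

open Classical in
-- At a generic point of `e`, a small affine surface transversal to `e` meets the edges of the
-- combination only at that point. Each edge through the point crosses with the sign of its relative
-- orientation to `e`, up to a common sign.
theorem sum_transitionSign_edge_eq_zero (c : Edge d M →₀ ℝ)
    (h : ∀ S : Surface d M, (c.sum fun e a => a * orientedIntersection g e S) = 0)
    (e : Edge d M) {t : ℝ} (ht : t ∈ interior (Icc (0 : ℝ) 1))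
    (hov : ∀ k ∈ c.support, e.toFun t ∈ k.toFun '' Icc 0 1 →
      Overlap (Icc 0 1) e.toFun k.toFun t) :
    ∑ k ∈ c.support, (if Overlap (Icc 0 1) e.toFun k.toFun t then
      c k * transitionSign (Icc 0 1) e.toFun k.toFun t else 0) = 0 := by
  have htI := interior_subset ht
  set v : Model d := chartDeriv (d := d) e.toFun t 1 with hv
  have hv0 : v ≠ 0 := by
    intro h0
    exact one_ne_zero (e.isPatch.immersion t htI (h0.trans (map_zero _).symm))
  obtain ⟨w, hw⟩ := exists_leviCivita_ne_zero_of_ne_zero hv0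
  obtain ⟨L, hL⟩ : ∃ L : (Fin d → ℝ) →L[ℝ] Model d, ∀ i, L (Pi.single i 1) = w i := by
    refine ⟨LinearMap.toContinuousLinearMap ((Pi.basisFun ℝ (Fin d)).constr ℝ w), fun i => ?_⟩
    have := (Pi.basisFun ℝ (Fin d)).constr_basis ℝ w i
    rwa [Pi.basisFun_apply] at this
  have hlc : leviCivita v (fun i => L (Pi.single i 1)) ≠ 0 := by
    simpa only [hL] using hw
  have hLinj : Function.Injective L := by
    rw [← ContinuousLinearMap.coe_coe, ← LinearMap.ker_eq_bot, LinearMap.ker_eq_bot']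
    intro x hx
    exact (injective_of_leviCivita_ne_zero hlc (a := 0) (x := x) (by simpa using hx.symm)).2
  have hdata : ∀ k : Edge d M, Overlap (Icc 0 1) e.toFun k.toFun t →
      k.toFun (transition (Icc 0 1) e.toFun k.toFun t) = e.toFun t ∧
      transition (Icc 0 1) e.toFun k.toFun t ∈ interior (Icc (0 : ℝ) 1) ∧
      (fderiv ℝ (transition (Icc 0 1) e.toFun k.toFun) t).det ≠ 0 ∧
      v = (fderiv ℝ (transition (Icc 0 1) e.toFun k.toFun) t).det •
        chartDeriv (d := d) k.toFun (transition (Icc 0 1) e.toFun k.toFun t) 1 := by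
    intro k hk
    obtain ⟨-, h2, h3⟩ := hk.transition_spec k.isPatch.injOn
    refine ⟨h3.self_of_nhds.symm, h2, hk.det_ne_zero e.isPatch k.isPatch, ?_⟩
    rw [hv, hk.chartDeriv_eq k.isPatch, ContinuousLinearMap.comp_apply, ← map_smul]
    congr 1
    rw [ContinuousLinearMap.det, LinearMap.det_ring]
    simp
  -- An edge of the combination through the point overlaps with `e`, so its velocity there is a
  -- nonzero multiple of `v` and is transversal to the image of `L`.
  have hev : ∀ᶠ b in 𝓝 (0 : Fin d → ℝ), ∀ k ∈ c.support, ∀ s ∈ Icc (0 : ℝ) 1,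
      k.toFun s = affineMap (e.toFun t) L b → k.toFun s = e.toFun t ∧ b = 0 := by
    refine (eventually_all_finset _).2 fun k hk =>
      eventually_ne_affineMap isCompact_Icc k.isPatch fun s hs hks a b hab => ?_
    obtain ⟨h1, h2, h3, h4⟩ := hdata k (hov k hk ⟨s, hs, hks⟩)
    have hst : transition (Icc 0 1) e.toFun k.toFun t = s :=
      k.injOn (interior_subset h2) hs (h1.trans hks.symm)
    rw [hst] at h4
    set τ := (fderiv ℝ (transition (Icc 0 1) e.toFun k.toFun) t).det
    have h5 : (a / τ) • v = L b := by
      rw [h4, smul_smul, div_mul_cancel₀ _ h3, ← hab, ← map_smul, smul_eq_mul, mul_one]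
    obtain ⟨h6, h7⟩ := injective_of_leviCivita_ne_zero hlc h5
    exact ⟨(div_eq_zero_iff.1 h6).resolve_right h3, h7⟩
  have hmid : (fun _ => 1 / 2 : Fin d → ℝ) ∈ interior (cube d) := by
    have : cube d = univ.pi fun _ => Icc (0 : ℝ) 1 := by
      rw [cube, ← pi_univ_Icc]; rfl
    rw [this, interior_pi_set finite_univ]
    intro i _
    rw [interior_Icc]
    norm_num
  obtain ⟨η, hη, hpatch, hP, hder⟩ := exists_affine_patch (isCompact_cube (d := d))
    (u₀ := fun _ => 1 / 2) (e.toFun t) hLinj hev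
  let S : Surface d M := ⟨_, hpatch.analytic, hpatch.injOn, hpatch.immersion⟩
  have hS : S.toFun (fun _ => 1 / 2) = e.toFun t := by
    change affineMap (e.toFun t) L _ = _
    rw [sub_self, smul_zero, affineMap_zero]
  set l := leviCivita v (fun i => (η • L) (Pi.single i 1)) with hl
  have hl0 : l ≠ 0 := leviCivita_smul_right_ne_zero hη.ne' hlc
  have hI : ∀ k ∈ c.support, c k * orientedIntersection g k S =
      (SignType.sign l : ℝ) * (if Overlap (Icc 0 1) e.toFun k.toFun t then
      c k * transitionSign (Icc 0 1) e.toFun k.toFun t else 0) := by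
    intro k hk
    rw [orientedIntersection_eq_of_unique g k S (p := e.toFun t)
      fun s hs u hu hsu => (hP u hu k hk s hs hsu).1]
    split_ifs with hko
    · obtain ⟨h1, h2, h3, h4⟩ := hdata k hko
      have hdS : chartDeriv (d := d) S.toFun (fun _ => 1 / 2) = η • L := hder
      set s := transition (Icc 0 1) e.toFun k.toFun t with hs
      have h5 : l = (fderiv ℝ (transition (Icc 0 1) e.toFun k.toFun) t).det *
          leviCivita (chartDeriv (d := d) k.toFun s 1) (fun i => (η • L) (Pi.single i 1)) := by
        rw [hl, h4, leviCivita_smul_left]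
      have h6 : leviCivita (chartDeriv (d := d) k.toFun s 1)
          (fun i => (η • L) (Pi.single i 1)) ≠ 0 := fun h0 => hl0 (by rw [h5, h0, mul_zero])
      rw [intersectionAt_eq g k S (interior_subset h2) (interior_subset hmid) h1 hS,
        localIntersection_of_transversal g k S (by rwa [interior_Icc] at h2)
        (interior_subset hmid) (h1.trans hS.symm) (by rw [hdS]; exact h6),
        S.density_eq_one g hmid, hdS, transitionSign, h5, sign_mul, one_mul]
      push_cast
      have h7 : (SignType.sign (fderiv ℝ (transition (Icc 0 1) e.toFun k.toFun) t).det : ℝ) *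
          SignType.sign (fderiv ℝ (transition (Icc 0 1) e.toFun k.toFun) t).det = 1 := by
        rcases h3.lt_or_gt with h8 | h8
        · rw [sign_neg h8]; simp
        · rw [sign_pos h8]; simp
      linear_combination (-c k * (SignType.sign (leviCivita (chartDeriv (d := d) k.toFun s 1)
          (fun i => (η • L) (Pi.single i 1))) : ℝ)) * h7
    · rw [mul_zero]
      refine mul_eq_zero_of_right _ ?_
      by_contra hne
      obtain ⟨s, hs, u, hu, h1, -⟩ := exists_of_intersectionAt_ne_zero g hne
      exact hko (hov k hk ⟨s, hs, h1⟩)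
  have h1 := h S
  rw [Finsupp.sum, Finset.sum_congr rfl hI, ← Finset.mul_sum] at h1
  refine (mul_eq_zero.1 h1).resolve_left ?_
  rcases hl0.lt_or_gt with h8 | h8
  · simp [sign_neg h8]
  · simp [sign_pos h8]

/-- The intersection numbers with all surfaces determine a combination of edges. -/
theorem sum_formFactor_edge_eq_zero (c : Edge d M →₀ ℝ)
    (h : ∀ S : Surface d M, (c.sum fun e a => a * orientedIntersection g e S) = 0) :
    (c.sum fun e a => a • e.formFactor) = 0 := by
  classical
  ext A
  rw [Finsupp.sum, Finset.sum_apply]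
  simp only [Pi.smul_apply, smul_eq_mul, Pi.zero_apply, Edge.formFactor_eq_setIntegral]
  rw [← Finset.sum_coe_sort]
  refine sum_integral_eq_zero_of_overlap (d := d) (ι := c.support) volume isCompact_Icc
    volume_diff_interior_Icc_real (f := fun e => e.1.toFun) (fun e => e.1.isPatch)
    (w := fun e t => A.toFun (e.1.toFun t) (e.1.velocity t))
    (fun e => (e.1.continuousOn_pairing A).integrableOn_compact isCompact_Icc) (fun e => c e.1)
    (fun e k t hov => ?_) (fun e t ht hov => ?_)
  · let A' : M → Model d →L[ℝ] ℝ := A.toFun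
    have h1 : e.1.toFun t = k.1.toFun (transition (Icc 0 1) e.1.toFun k.1.toFun t) :=
      (hov.transition_spec k.1.isPatch.injOn).2.2.self_of_nhds
    change A' (e.1.toFun t) (chartDeriv (d := d) e.1.toFun t 1) = _ *
      A' (k.1.toFun (transition (Icc 0 1) e.1.toFun k.1.toFun t))
        (chartDeriv (d := d) k.1.toFun (transition (Icc 0 1) e.1.toFun k.1.toFun t) 1)
    rw [hov.chartDeriv_eq k.1.isPatch, ContinuousLinearMap.comp_apply, h1, ← smul_eq_mul,
      ← map_smul, ← map_smul]
    congr 2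
    -- In dimension one the determinant of the derivative is its value at `1`.
    rw [ContinuousLinearMap.det, LinearMap.det_ring]
    simp
  · rw [Finset.sum_coe_sort c.support fun k => if Overlap (Icc 0 1) e.1.toFun k.toFun t then
      c k * transitionSign (Icc 0 1) e.1.toFun k.toFun t else 0]
    exact sum_transitionSign_edge_eq_zero g c h e.1 ht fun k hk => hov ⟨k, hk⟩

open Classical in
-- The dual detector is a short affine edge along a vector `v` on the positive side of `S`. It
-- crosses each overlapping surface with the sign of the determinant of the transition.
theorem sum_transitionSign_surface_eq_zero (c : Surface d M →₀ ℝ)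
    (h : ∀ e : Edge d M, (c.sum fun S a => a * orientedIntersection g e S) = 0)
    (S : Surface d M) {u : Fin d → ℝ} (hu : u ∈ interior (cube d))
    (hov : ∀ k ∈ c.support, S.toFun u ∈ k.toFun '' cube d →
      Overlap (cube d) S.toFun k.toFun u) :
    ∑ k ∈ c.support, (if Overlap (cube d) S.toFun k.toFun u then
      c k * transitionSign (cube d) S.toFun k.toFun u else 0) = 0 := by
  have huI := interior_subset hu
  obtain ⟨v, hv⟩ := S.exists_leviCivita_pos huI
  rw [S.partialDeriv_eq] at hv
  set L : ℝ →L[ℝ] Model d := ContinuousLinearMap.toSpanSingleton ℝ v with hLdef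
  have hL : ∀ b, L b = b • v := fun b => ContinuousLinearMap.toSpanSingleton_apply ..
  have hLinj : Function.Injective L := by
    rw [← ContinuousLinearMap.coe_coe, ← LinearMap.ker_eq_bot, LinearMap.ker_eq_bot']
    intro b hb
    have h1 : b • v = chartDeriv (d := d) S.toFun u 0 := by
      rw [map_zero, ← hL]
      exact hb
    exact (injective_of_leviCivita_ne_zero hv.ne' h1).1
  have hdata : ∀ k : Surface d M, Overlap (cube d) S.toFun k.toFun u →
      k.toFun (transition (cube d) S.toFun k.toFun u) = S.toFun u ∧
      transition (cube d) S.toFun k.toFun u ∈ interior (cube d) ∧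
      0 < (fderiv ℝ (transition (cube d) S.toFun k.toFun) u).det * leviCivita v (fun i =>
        chartDeriv (d := d) k.toFun (transition (cube d) S.toFun k.toFun u) (Pi.single i 1)) := by
    intro k hk
    obtain ⟨-, h2, h3⟩ := hk.transition_spec k.isPatch.injOn
    refine ⟨h3.self_of_nhds.symm, h2, ?_⟩
    rw [← leviCivita_comp_right]
    rw [hk.chartDeriv_eq k.isPatch] at hv
    exact hv
  have hev : ∀ᶠ b in 𝓝 (0 : ℝ), ∀ k ∈ c.support, ∀ w ∈ cube d,
      k.toFun w = affineMap (S.toFun u) L b → k.toFun w = S.toFun u ∧ b = 0 := by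
    refine (eventually_all_finset _).2 fun k hk =>
      eventually_ne_affineMap isCompact_cube k.isPatch fun w hw hkw a b hab => ?_
    obtain ⟨h1, h2, h3⟩ := hdata k (hov k hk ⟨w, hw, hkw⟩)
    have hst : transition (cube d) S.toFun k.toFun u = w :=
      k.injOn (interior_subset h2) hw (h1.trans hkw.symm)
    rw [hst] at h3
    rw [hL] at hab
    exact (injective_of_leviCivita_ne_zero (right_ne_zero_of_mul h3.ne') hab.symm).symm
  obtain ⟨η, hη, hpatch, hP, hder⟩ := exists_affine_patch (isCompact_Icc (a := (0 : ℝ)) (b := 1))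
    (u₀ := 1 / 2) (S.toFun u) hLinj hev
  let e : Edge d M := ⟨_, hpatch.analytic, hpatch.injOn, hpatch.immersion⟩
  have hmid : (1 / 2 : ℝ) ∈ Ioo (0 : ℝ) 1 := by norm_num
  have he : e.toFun (1 / 2) = S.toFun u := by
    change affineMap (S.toFun u) L _ = _
    rw [sub_self, smul_zero, affineMap_zero]
  have hde : chartDeriv (d := d) e.toFun (1 / 2) 1 = η • v := by
    have h1 : chartDeriv (d := d) e.toFun (1 / 2) = η • L := hder
    rw [h1, smul_apply, hL, one_smul]
  have hI : ∀ k ∈ c.support, c k * orientedIntersection g e k =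
      (if Overlap (cube d) S.toFun k.toFun u then
      c k * transitionSign (cube d) S.toFun k.toFun u else 0) := by
    intro k hk
    rw [orientedIntersection_eq_of_unique g e k (p := S.toFun u)
      fun s hs w hw hsw => hsw.trans (hP s hs k hk w hw hsw.symm).1]
    split_ifs with hko
    · obtain ⟨h1, h2, h3⟩ := hdata k hko
      set w := transition (cube d) S.toFun k.toFun u with hw
      have h4 : (SignType.sign (leviCivita (η • v) (fun i =>
          chartDeriv (d := d) k.toFun w (Pi.single i 1))) : ℝ) =
          SignType.sign (fderiv ℝ (transition (cube d) S.toFun k.toFun) u).det := by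
        rw [leviCivita_smul_left, sign_mul, sign_pos hη, one_mul]
        rcases mul_pos_iff.1 h3 with ⟨h5, h6⟩ | ⟨h5, h6⟩
        · rw [sign_pos h5, sign_pos h6]
        · rw [sign_neg h5, sign_neg h6]
      rw [intersectionAt_eq g e k (Ioo_subset_Icc_self hmid) (interior_subset h2) he h1,
        localIntersection_of_transversal g e k hmid (interior_subset h2) (he.trans h1.symm)
        (by rw [hde, leviCivita_smul_left]
            exact mul_ne_zero hη.ne' (right_ne_zero_of_mul h3.ne')),
        k.density_eq_one g h2, hde, h4, one_mul]
      rfl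
    · refine mul_eq_zero_of_right _ ?_
      by_contra hne
      obtain ⟨s, hs, w, hw, -, h1, -⟩ := exists_of_intersectionAt_ne_zero g hne
      exact hko (hov k hk ⟨w, hw, h1⟩)
  have h1 := h e
  rwa [Finsupp.sum, Finset.sum_congr rfl hI] at h1

/-- The intersection numbers with all edges determine a combination of surfaces. -/
theorem sum_formFactor_surface_eq_zero (hM : IsOrientedAtlas d M) (c : Surface d M →₀ ℝ)
    (h : ∀ e : Edge d M, (c.sum fun S a => a * orientedIntersection g e S) = 0) :
    (c.sum fun S a => a • S.formFactor) = 0 := by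
  classical
  ext A
  rw [Finsupp.sum, Finset.sum_apply]
  simp only [Pi.smul_apply, smul_eq_mul, Pi.zero_apply, Surface.formFactor]
  rw [← Finset.sum_coe_sort]
  refine sum_integral_eq_zero_of_overlap (d := d) (ι := c.support) volume isCompact_cube
    volume_diff_interior_Icc (f := fun S => S.1.toFun) (fun S => S.1.isPatch)
    (w := fun S u => leviCivita (A.toFun (S.1.toFun u)) (S.1.partialDeriv u))
    (fun S => S.1.integrableOn_pairing hM A) (fun S => c S.1)
    (fun S k u hov => ?_) (fun S u hu hov => ?_)
  · let A' : M → Model d := A.toFun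
    have h1 : S.1.toFun u = k.1.toFun (transition (cube d) S.1.toFun k.1.toFun u) :=
      (hov.transition_spec k.1.isPatch.injOn).2.2.self_of_nhds
    change leviCivita (A' (S.1.toFun u))
      (fun i => chartDeriv (d := d) S.1.toFun u (Pi.single i 1)) = _ *
      leviCivita (A' (k.1.toFun (transition (cube d) S.1.toFun k.1.toFun u))) (fun i =>
        chartDeriv (d := d) k.1.toFun (transition (cube d) S.1.toFun k.1.toFun u) (Pi.single i 1))
    rw [hov.chartDeriv_eq k.1.isPatch, h1, ← leviCivita_comp_right]
    rfl
  · rw [Finset.sum_coe_sort c.support fun k => if Overlap (cube d) S.1.toFun k.toFun u then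
      c k * transitionSign (cube d) S.1.toFun k.toFun u else 0]
    exact sum_transitionSign_surface_eq_zero g c h S.1 hu fun k hk => hov ⟨k, hk⟩

end Detection

/-! ### Descent of a pairing to spans -/

section Descent

/-- A linear choice of coefficients makes any map built from it automatically linear on the span. -/
theorem exists_section_linearCombination {ι V : Type*} [AddCommGroup V] [Module ℝ V] (F : ι → V) :
    ∃ s : Submodule.span ℝ (range F) →ₗ[ℝ] (ι →₀ ℝ), ∀ x,
      Finsupp.linearCombination ℝ F (s x) = x := by
  have hmem : ∀ c, Finsupp.linearCombination ℝ F c ∈ Submodule.span ℝ (range F) := fun c => by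
    rw [← Finsupp.range_linearCombination]
    exact LinearMap.mem_range_self _ c
  have hsurj : LinearMap.range ((Finsupp.linearCombination ℝ F).codRestrict _ hmem) = ⊤ := by
    refine LinearMap.range_eq_top.2 fun x => ?_
    obtain ⟨c, hc⟩ := (Finsupp.range_linearCombination (R := ℝ) (v := F)).ge x.2
    exact ⟨c, Subtype.ext hc⟩
  obtain ⟨s, hs⟩ := LinearMap.exists_rightInverse_of_surjective _ hsurj
  exact ⟨s, fun x => congrArg Subtype.val (LinearMap.congr_fun hs x)⟩

/-- A pairing of two families of vectors that respects their linear relations extends to a bilinear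
map on their spans. -/
theorem exists_bilinear_extension {ι κ V W : Type*} [AddCommGroup V] [Module ℝ V]
    [AddCommGroup W] [Module ℝ W] (F : ι → V) (G : κ → W) (I : ι → κ → ℝ)
    (hF : ∀ c : ι →₀ ℝ, (c.sum fun i a => a • F i) = 0 → ∀ k, (c.sum fun i a => a * I i k) = 0)
    (hG : ∀ c : κ →₀ ℝ, (c.sum fun k a => a • G k) = 0 → ∀ i, (c.sum fun k a => a * I i k) = 0) :
    ∃ B : Submodule.span ℝ (range F) →ₗ[ℝ] Submodule.span ℝ (range G) →ₗ[ℝ] ℝ,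
      ∀ i k, B ⟨F i, Submodule.subset_span (mem_range_self i)⟩
        ⟨G k, Submodule.subset_span (mem_range_self k)⟩ = I i k := by
  obtain ⟨s, hs⟩ := exists_section_linearCombination F
  obtain ⟨t, ht⟩ := exists_section_linearCombination G
  let B₀ : (ι →₀ ℝ) →ₗ[ℝ] (κ →₀ ℝ) →ₗ[ℝ] ℝ :=
    Finsupp.linearCombination ℝ fun i => Finsupp.linearCombination ℝ (I i)
  have hB₀ : ∀ c k, B₀ c (Finsupp.single k 1) = c.sum fun i a => a * I i k := by
    intro c k
    simp [B₀, Finsupp.linearCombination_apply, Finsupp.sum, LinearMap.sum_apply]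
  have hB₁ : ∀ i c, B₀ (Finsupp.single i 1) c = c.sum fun k a => a * I i k := by
    intro i c
    simp [B₀, Finsupp.linearCombination_apply]
  have h1 : ∀ c, Finsupp.linearCombination ℝ F c = 0 → B₀ c = 0 := by
    intro c hc
    refine Finsupp.lhom_ext' fun k => LinearMap.ext_ring ?_
    change B₀ c (Finsupp.single k 1) = 0
    rw [hB₀]
    exact hF c hc k
  -- Bilinearity is automatic. The chosen coefficients of a generator may differ from the obvious
  -- ones by a relation, and relations pair to zero by `hF` and `hG`.
  refine ⟨B₀.compl₁₂ s t, fun i k => ?_⟩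
  rw [LinearMap.compl₁₂_apply]
  set x : Submodule.span ℝ (range F) := ⟨F i, Submodule.subset_span (mem_range_self i)⟩
  set y : Submodule.span ℝ (range G) := ⟨G k, Submodule.subset_span (mem_range_self k)⟩
  have h2 : B₀ (s x) = B₀ (Finsupp.single i 1) := by
    rw [← sub_eq_zero, ← map_sub]
    apply h1
    rw [map_sub, hs, Finsupp.linearCombination_single, one_smul, sub_self]
  have h3 : B₀ (Finsupp.single i 1) (t y - Finsupp.single k 1) = 0 := by
    rw [hB₁]
    refine hG _ ?_ i
    change Finsupp.linearCombination ℝ G _ = 0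
    rw [map_sub, ht, Finsupp.linearCombination_single, one_smul, sub_self]
  rw [map_sub, sub_eq_zero] at h3
  rw [h2, h3, hB₁]
  simp

end Descent

/-! ### The pairing and its nondegeneracy -/

section Pairing

variable {d : ℕ} {M : Type*} [TopologicalSpace M] [ChartedSpace (Model d) M]
  [IsManifold (𝓡 (d + 1)) ω M]

theorem HEdge.exists_finsupp (x : HEdge d M) : ∃ c : Edge d M →₀ ℝ,
    (c.sum fun e a => a • e.toH) = x ∧ (c.sum fun e a => a • e.formFactor) = x.1 := by
  obtain ⟨c, hc⟩ := Finsupp.mem_span_range_iff_exists_finsupp.1 x.2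
  refine ⟨c, Subtype.ext ?_, hc⟩
  rw [← hc, Finsupp.sum, Finsupp.sum, AddSubmonoidClass.coe_finsetSum]
  rfl

theorem HSurface.exists_finsupp (x : HSurface d M) : ∃ c : Surface d M →₀ ℝ,
    (c.sum fun S a => a • S.toH) = x ∧ (c.sum fun S a => a • S.formFactor) = x.1 := by
  obtain ⟨c, hc⟩ := Finsupp.mem_span_range_iff_exists_finsupp.1 x.2
  refine ⟨c, Subtype.ext ?_, hc⟩
  rw [← hc, Finsupp.sum, Finsupp.sum, AddSubmonoidClass.coe_finsetSum]
  rfl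

variable {g : Bundle.RiemannianMetric (fun x : M => TangentSpace (𝓡 (d + 1)) x)}
  {I J : HEdge d M →ₗ[ℝ] HSurface d M →ₗ[ℝ] ℝ}

theorem IsIntersectionPairing.apply_surface (hI : IsIntersectionPairing g I)
    (c : Edge d M →₀ ℝ) (S : Surface d M) : I (c.sum fun e a => a • e.toH) S.toH =
      c.sum fun e a => a * orientedIntersection g e S := by
  simp [Finsupp.sum, map_sum, LinearMap.sum_apply, hI _ S]

theorem IsIntersectionPairing.apply_edge (hI : IsIntersectionPairing g I)
    (e : Edge d M) (c : Surface d M →₀ ℝ) : I e.toH (c.sum fun S a => a • S.toH) =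
      c.sum fun S a => a * orientedIntersection g e S := by
  simp [Finsupp.sum, map_sum, hI e _]

theorem IsIntersectionPairing.unique (hI : IsIntersectionPairing g I)
    (hJ : IsIntersectionPairing g J) : I = J := by
  ext x y
  obtain ⟨a, rfl, -⟩ := HEdge.exists_finsupp x
  obtain ⟨b, rfl, -⟩ := HSurface.exists_finsupp y
  simp [Finsupp.sum, map_sum, LinearMap.sum_apply, hI _ _, hJ _ _]

theorem symplecticForm_isAlt (I : HEdge d M →ₗ[ℝ] HSurface d M →ₗ[ℝ] ℝ) :
    (symplecticForm I).IsAlt := fun x => by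
  rw [symplecticForm_apply, sub_self]

variable [T2Space M]

theorem exists_isIntersectionPairing (hM : IsOrientedAtlas d M)
    (g : Bundle.RiemannianMetric (fun x : M => TangentSpace (𝓡 (d + 1)) x)) :
    ∃ I : HEdge d M →ₗ[ℝ] HSurface d M →ₗ[ℝ] ℝ, IsIntersectionPairing g I :=
  exists_bilinear_extension _ _ (orientedIntersection g)
    (fun c hc S => sum_orientedIntersection_edge_eq_zero g c hc S)
    (fun c hc e => sum_orientedIntersection_surface_eq_zero g hM c hc e)

/-- Testing with `(0, S)` isolates the edge component of `x` and testing with `(e, 0)` its surface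
component. -/
theorem IsIntersectionPairing.nondegenerate (hM : IsOrientedAtlas d M)
    (hI : IsIntersectionPairing g I) (x : HEdge d M × HSurface d M)
    (hx : ∀ y : HEdge d M × HSurface d M, symplecticForm I x y = 0) : x = 0 := by
  obtain ⟨x₁, x₂⟩ := x
  obtain ⟨a, ha, ha'⟩ := HEdge.exists_finsupp x₁
  obtain ⟨b, hb, hb'⟩ := HSurface.exists_finsupp x₂
  have h1 : ∀ S : Surface d M, (a.sum fun e a => a * orientedIntersection g e S) = 0 := by
    intro S
    have h := hx (0, S.toH)
    rw [symplecticForm_apply, map_zero, LinearMap.zero_apply, sub_zero] at h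
    rw [← hI.apply_surface, ha]
    exact h
  have h2 : ∀ e : Edge d M, (b.sum fun S a => a * orientedIntersection g e S) = 0 := by
    intro e
    have h := hx (e.toH, 0)
    rw [symplecticForm_apply, map_zero, zero_sub, neg_eq_zero] at h
    rw [← hI.apply_edge, hb]
    exact h
  refine Prod.ext (Subtype.ext ?_) (Subtype.ext ?_)
  · exact ha'.symm.trans (sum_formFactor_edge_eq_zero g a h1)
  · exact hb'.symm.trans (sum_formFactor_surface_eq_zero g hM b h2)

end Pairing

end FormFactor

open FormFactor in
theorem mainTheorem4 (d : ℕ) {M : Type*} [TopologicalSpace M] [T2Space M]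
    [ChartedSpace (Model d) M] [IsManifold (𝓡 (d + 1)) ω M] (hM : IsOrientedAtlas d M)
    (g : Bundle.RiemannianMetric (fun x : M => TangentSpace (𝓡 (d + 1)) x)) :
    (∃! I : HEdge d M →ₗ[ℝ] HSurface d M →ₗ[ℝ] ℝ, IsIntersectionPairing g I) ∧
    ∀ I : HEdge d M →ₗ[ℝ] HSurface d M →ₗ[ℝ] ℝ, IsIntersectionPairing g I →
      (symplecticForm I).IsAlt ∧
      ∀ x : HEdge d M × HSurface d M,
        (∀ y : HEdge d M × HSurface d M, symplecticForm I x y = 0) → x = 0 := by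
  obtain ⟨I, hI⟩ := exists_isIntersectionPairing hM g
  exact ⟨⟨I, hI, fun J hJ => hJ.unique hI⟩,
    fun J hJ => ⟨symplecticForm_isAlt J, fun x hx => hJ.nondegenerate hM x hx⟩⟩
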